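/- Let $k$ be a field of characteristic zero and $V$ a $k$-vector space. **Algebra.** A graded pre-Lie algebra is a graded vector space with a bilinear degree-zero product $\star$ whose associator $\Phi(x,y,z)=(x\star y)\star z-x\star(y\star z)$ satisfies $\Phi(x,y,z)=(-1)^{|y||z|}\Phi(x,z,y)$ for homogeneous $x,y,z$; an (ungraded) pre-Lie algebra is one concentrated in degree $0$. Let $\mathsf{pL}(V)$ be the free pre-Lie algebra on $V$, let $\mathsf{pL}(V,\circ)$ be the free graded pre-Lie algebra on $V$ (in degree $0$) and one dummy variable $\circ$ of degree $1$, let $\mathsf{pL}^n(V)\subset\mathsf{pL}(V,\circ)$ be the span of the monomials with exactly $n$ occurrences of $\circ$, and let $\mathsf{rpL}(V)=\mathsf{pL}(V,\circ)/(\circ\star\circ)$ with the induced grading, so that $\mathsf{rpL}^0(V)=\mathsf{pL}(V)$ and $\mathsf{rpL}^1(V)=\mathsf{pL}^1(V)$. Let $d:\mathsf{rpL}^*(V)\to\mathsf{rpL}^{*+1}(V)$ be the unique degree $+1$ linear map with $d(v)=0$ for $v\in V$, $d(\circ)=0$ and $$d(a\star b)=d(a)\star b+(-1)^{|a|}a\star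 d(b)+\Phi(\circ,a,b),$$ and consider its restriction $d:\mathsf{pL}(V)\to\mathsf{pL}^1(V)$. **Trees.** All trees are finite, rooted and nonempty, with edges oriented towards the root. Let $\mathrm{Tr}_n$ be the set of trees with vertices numbered $1,\dots,n$, and $\mathrm{Tr}^1_n$ the set of trees with $n$ numbered vertices and one further, special vertex. Put $\mathrm{Tr}(V)=\bigoplus_{n\ge1}\mathrm{Span}_k(\mathrm{Tr}_n)\otimes_{\Sigma_n}V^{\otimes n}$ and $\mathrm{Tr}^1(V)=\bigoplus_{n\ge0}\mathrm{Span}_k(\mathrm{Tr}^1_n)\otimes_{\Sigma_n}V^{\otimes n}$ (trees with numbered vertices decorated by elements of $V$ and the special vertex decorated by $\circ$). An edge of $S\in \mathrm{Tr}^1_n$ is special if it is adjacent to the special vertex; for such an edge $e$ let $S/e\in\mathrm{Tr}_n$ be obtained by contracting $e$ to a vertex that keeps the label of the endpoint of $e$ different from the special vertex. A blow-up of $T\in\mathrm{Tr}_n$ is a pair $(S,e)$ with $S\in\mathrm{Tr}^1_n$, $e$ a special edge, $S/e=T$, such that the special vertex of $S$ has at least two incoming edges. Let $\epsilon_{(S,e)}=+1$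 if $e$ is an incoming edge of the special vertex and $-1$ if it is the outgoing edge. The blow-up map $\delta:\mathrm{Tr}(V)\to\mathrm{Tr}^1(V)$ is the linear map induced by $$\delta(T)=\sum_{(S,e)}\epsilon_{(S,e)}\,S,\qquad (S,e)\text{ running over the blow-ups of }T,$$ the decorations of the numbered vertices being kept. **Statement.** There is exactly one linear isomorphism $\Theta:\mathsf{pL}(V)\to\mathrm{Tr}(V)$ that takes $v\in V$ to the one-vertex tree decorated by $v$ and takes $\star$ to the insertion of decorated trees, $T\star S=\sum_x T\leftarrow_x S$, where $x$ runs over the vertices of $T$ and $T\leftarrow_x S$ is obtained by joining the root of $S$ to $x$ by an edge (Chapoton–Livernet). There is exactly one linear isomorphism $\Theta^1:\mathsf{pL}^1(V)\to\mathrm{Tr}^1(V)$ that takes $\circ$ to the tree consisting of the special vertex only and takes the products $a\star b$ and $b\star a$, $a\in\mathsf{pL}(V)$, $b\in\mathsf{pL}^1(V)$, to the insertion of the decorated trees that correspond to $a$ under $\Theta$ and to $b$ under $\Theta^1$. The square formed by these isomorphisms, $d$ and $\delta$ commutes: $$\Theta^1\circ d=\delta\circ\Theta:\ \mathsf{pL}(V)\to\mathrm{Tr}^1(V).$$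 -/

import Mathlib

open scoped TensorProduct DirectSum

set_option linter.unusedSectionVars false

noncomputable section

namespace PreLieTrees

/-! ### Two-sided ideals and quotients of nonassociative algebras -/

section Ideal

variable (k : Type*) {A B : Type*} [CommRing k]
  [NonUnitalNonAssocRing A] [Module k A] [IsScalarTower k A A] [SMulCommClass k A A]
  [NonUnitalNonAssocRing B] [Module k B] [IsScalarTower k B B] [SMulCommClass k B B]

/-- The two-sided ideal generated by a subset of a nonassociative `k`-algebra: the smallest
subspace containing the subset and stable under left and right multiplication. -/
def idealSpan (s : Set A) : Submodule k A :=
  sInf {I | s ⊆ I ∧ ∀ a x, x ∈ I → a * x ∈ I ∧ x * a ∈ I}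

theorem subset_idealSpan (s : Set A) : s ⊆ idealSpan k s := by
  intro x hx
  simp only [idealSpan, SetLike.mem_coe, Submodule.mem_sInf]
  exact fun I hI => hI.1 hx

theorem mul_mem_idealSpan (s : Set A) (a x : A) (hx : x ∈ idealSpan k s) :
    a * x ∈ idealSpan k s ∧ x * a ∈ idealSpan k s := by
  simp only [idealSpan, Submodule.mem_sInf] at hx ⊢
  exact ⟨fun I hI => (hI.2 a x (hx I hI)).1, fun I hI => (hI.2 a x (hx I hI)).2⟩

theorem idealSpan_le {s : Set A} (I : Submodule k A) (hs : ∀ x ∈ s, x ∈ I)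
    (hI : ∀ a x, x ∈ I → a * x ∈ I ∧ x * a ∈ I) : idealSpan k s ≤ I :=
  sInf_le ⟨hs, hI⟩

/-- The quotient algebra `A / (s)` of a nonassociative algebra by the two-sided ideal generated
by `s`. -/
def QuotAlg (s : Set A) : Type _ := A ⧸ idealSpan k s

instance (s : Set A) : AddCommGroup (QuotAlg k s) :=
  inferInstanceAs (AddCommGroup (A ⧸ idealSpan k s))

instance (s : Set A) : Module k (QuotAlg k s) :=
  inferInstanceAs (Module k (A ⧸ idealSpan k s))

instance (s : Set A) : AddCommMonoid (QuotAlg k s) := inferInstance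

/-- The linear quotient map `A → A / (s)`. -/
def quotMkLin (s : Set A) : A →ₗ[k] QuotAlg k s := Submodule.mkQ (idealSpan k s)

theorem quotMkLin_surjective (s : Set A) : Function.Surjective (quotMkLin k s) :=
  Submodule.mkQ_surjective _

theorem quotMkLin_eq_zero (s : Set A) (x : A) : quotMkLin k s x = 0 ↔ x ∈ idealSpan k s :=
  Submodule.Quotient.mk_eq_zero _

/-- The linear map `A / (s) → M` induced by a linear map `A → M` that vanishes on the ideal. -/
def quotLiftLin {M : Type*} [AddCommGroup M] [Module k M] (s : Set A) (f : A →ₗ[k] M)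
    (hf : idealSpan k s ≤ LinearMap.ker f) : QuotAlg k s →ₗ[k] M :=
  Submodule.liftQ (idealSpan k s) f hf

theorem quotLiftLin_mkLin {M : Type*} [AddCommGroup M] [Module k M] (s : Set A) (f : A →ₗ[k] M)
    (hf : idealSpan k s ≤ LinearMap.ker f) (x : A) :
    quotLiftLin k s f hf (quotMkLin k s x) = f x := rfl

/-- Left multiplication by an element of `A` on `A / (s)`. -/
def quotMulLeft (s : Set A) : A →ₗ[k] QuotAlg k s →ₗ[k] QuotAlg k s where
  toFun a := quotLiftLin k s (quotMkLin k s ∘ₗ LinearMap.mulLeft k a) (by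
    intro x hx
    simpa [quotMkLin_eq_zero] using (mul_mem_idealSpan k s a x hx).1)
  map_add' a b := by
    refine LinearMap.ext fun y => ?_
    obtain ⟨y, rfl⟩ := quotMkLin_surjective k s y
    simp [quotLiftLin_mkLin, add_mul]
  map_smul' c a := by
    refine LinearMap.ext fun y => ?_
    obtain ⟨y, rfl⟩ := quotMkLin_surjective k s y
    simp [quotLiftLin_mkLin, smul_mul_assoc]

/-- The product of the quotient algebra `A / (s)`. -/
def quotMul (s : Set A) : QuotAlg k s →ₗ[k] QuotAlg k s →ₗ[k] QuotAlg k s :=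
  quotLiftLin k s (quotMulLeft k s) (by
    intro x hx
    refine LinearMap.ext fun y => ?_
    obtain ⟨a, rfl⟩ := quotMkLin_surjective k s y
    exact (quotMkLin_eq_zero k s _).2 (mul_mem_idealSpan k s a x hx).2)

instance (s : Set A) : Mul (QuotAlg k s) := ⟨fun x y => quotMul k s x y⟩

theorem quot_mul_def (s : Set A) (x y : QuotAlg k s) : x * y = quotMul k s x y := rfl

instance (s : Set A) : NonUnitalNonAssocRing (QuotAlg k s) where
  left_distrib x y z := by simp [quot_mul_def]
  right_distrib x y z := by simp [quot_mul_def]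
  zero_mul x := by simp [quot_mul_def]
  mul_zero x := by simp [quot_mul_def]

instance (s : Set A) : NonUnitalNonAssocSemiring (QuotAlg k s) := inferInstance

instance (s : Set A) : IsScalarTower k (QuotAlg k s) (QuotAlg k s) :=
  ⟨fun c x y => by simp [quot_mul_def, smul_eq_mul]⟩

instance (s : Set A) : SMulCommClass k (QuotAlg k s) (QuotAlg k s) :=
  ⟨fun c x y => by simp [quot_mul_def, smul_eq_mul]⟩

/-- The quotient map `A → A / (s)`, a homomorphism of algebras. -/
def quotMk (s : Set A) : A →ₙₐ[k] QuotAlg k s where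
  toFun := quotMkLin k s
  map_smul' c x := by simp
  map_zero' := by simp
  map_add' x y := by simp
  map_mul' x y := rfl

theorem quotMk_surjective (s : Set A) : Function.Surjective (quotMk k s) :=
  quotMkLin_surjective k s

theorem quotMk_eq_zero (s : Set A) (x : A) : quotMk k s x = 0 ↔ x ∈ idealSpan k s :=
  quotMkLin_eq_zero k s x

theorem quotLiftLin_mk {M : Type*} [AddCommGroup M] [Module k M] (s : Set A) (f : A →ₗ[k] M)
    (hf : idealSpan k s ≤ LinearMap.ker f) (x : A) :
    quotLiftLin k s f hf (quotMk k s x) = f x := rfl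

/-- The homomorphism `A / (s) → B` induced by a homomorphism `A → B` that vanishes on `s`. -/
def quotLift (s : Set A) (f : A →ₙₐ[k] B) (hf : ∀ x ∈ s, f x = 0) : QuotAlg k s →ₙₐ[k] B :=
  let g : QuotAlg k s →ₗ[k] B := quotLiftLin k s (f : A →ₗ[k] B)
    (idealSpan_le k _ (fun x hx => by simpa using hf x hx)
      (fun a x hx => by
        have hx' : f x = 0 := by simpa using hx
        simp [hx']))
  { toFun := g
    map_smul' := fun c x => by simp
    map_zero' := by simp
    map_add' := fun x y => by simp
    map_mul' := fun x y => by
      obtain ⟨a, rfl⟩ := quotMk_surjective k s x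
      obtain ⟨b, rfl⟩ := quotMk_surjective k s y
      exact map_mul f a b }

@[simp]
theorem quotLift_mk (s : Set A) (f : A →ₙₐ[k] B) (hf : ∀ x ∈ s, f x = 0) (x : A) :
    quotLift k s f hf (quotMk k s x) = f x := rfl

theorem assoc_add₁ (a b y z : A) :
    associator (a + b) y z = associator a y z + associator b y z := by
  simp only [associator, add_mul]; abel

theorem assoc_add₂ (x a b z : A) :
    associator x (a + b) z = associator x a z + associator x b z := by
  simp only [associator, add_mul, mul_add]; abel

theorem assoc_add₃ (x y a b : A) :
    associator x y (a + b) = associator x y a + associator x y b := by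
  simp only [associator, mul_add]; abel

variable {k}

theorem assoc_smul₁ (c : k) (x y z : A) :
    associator (c • x) y z = c • associator x y z := by
  simp only [associator, smul_mul_assoc, smul_sub]

theorem assoc_smul₂ (c : k) (x y z : A) :
    associator x (c • y) z = c • associator x y z := by
  simp only [associator, smul_mul_assoc, mul_smul_comm, smul_sub]

theorem assoc_smul₃ (c : k) (x y z : A) :
    associator x y (c • z) = c • associator x y z := by
  simp only [associator, mul_smul_comm, smul_sub]

end Ideal

/-! ### The free pre-Lie algebra -/

section Free

variable (k : Type*) (V : Type*) [Field k] [AddCommGroup V] [Module k V]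

/-- The defining relations of the free pre-Lie algebra `pL(V)` in the free nonassociative algebra
on the set `V`: linearity of the generators and symmetry of the associator
`(x ⋆ y) ⋆ z - x ⋆ (y ⋆ z)` in the last two variables. -/
inductive PreLieRel : FreeNonUnitalNonAssocAlgebra k V → Prop
  | add (v w : V) : PreLieRel
      (FreeNonUnitalNonAssocAlgebra.of k (v + w) - FreeNonUnitalNonAssocAlgebra.of k v
        - FreeNonUnitalNonAssocAlgebra.of k w)
  | smul (c : k) (v : V) : PreLieRel
      (FreeNonUnitalNonAssocAlgebra.of k (c • v) - c • FreeNonUnitalNonAssocAlgebra.of k v)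
  | assoc (x y z : FreeNonUnitalNonAssocAlgebra k V) : PreLieRel
      (associator x y z - associator x z y)

/-- The free pre-Lie algebra `pL(V)` generated by the vector space `V`; its product `⋆` is
written `*`. -/
abbrev FreePreLie : Type _ :=
  QuotAlg k {r | PreLieRel k V r}

/-- The inclusion of the generators `V → pL(V)`. -/
def FreePreLie.gen (v : V) : FreePreLie k V :=
  quotMk k {r | PreLieRel k V r} (FreeNonUnitalNonAssocAlgebra.of k v)

theorem map_associator' {A B F : Type*} [NonUnitalNonAssocRing A] [NonUnitalNonAssocRing B]
    [FunLike F A B] [NonUnitalRingHomClass F A B] (f : F) (x y z : A) :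
    f (associator x y z) = associator (f x) (f y) (f z) := by
  simp [associator]

instance : RightPreLieRing (FreePreLie k V) where
  assoc_symm' x y z := by
    obtain ⟨x, rfl⟩ := quotMk_surjective k _ x
    obtain ⟨y, rfl⟩ := quotMk_surjective k _ y
    obtain ⟨z, rfl⟩ := quotMk_surjective k _ z
    rw [← map_associator', ← map_associator', ← sub_eq_zero, ← map_sub, quotMk_eq_zero]
    exact subset_idealSpan k _ (PreLieRel.assoc x y z)

instance : RightPreLieAlgebra k (FreePreLie k V) where

/-! ### The free graded pre-Lie algebra on `V` and a dummy variable of degree one -/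

variable {V} in
/-- The degree of a nonassociative monomial in `V` and the dummy variable `none`: the number of
occurrences of the dummy variable. -/
def deg : FreeMagma (Option V) → ℕ
  | .of none => 1
  | .of (some _) => 0
  | .mul x y => deg x + deg y

variable {V} in
/-- A nonassociative monomial as an element of the free nonassociative algebra. -/
def monom (w : FreeMagma (Option V)) : FreeNonUnitalNonAssocAlgebra k (Option V) :=
  MonoidAlgebra.ofMagma k _ w

/-- The defining relations of the free graded pre-Lie algebra on `V` (in degree `0`) and the dummy
variable (in degree `1`): linearity in `V`, and graded symmetry
`Φ(x, y, z) = (-1) ^ (|y| |z|) Φ(x, z, y)` of the associator. -/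
inductive GradedPreLieRel : FreeNonUnitalNonAssocAlgebra k (Option V) → Prop
  | add (v w : V) : GradedPreLieRel
      (FreeNonUnitalNonAssocAlgebra.of k (some (v + w))
        - FreeNonUnitalNonAssocAlgebra.of k (some v)
        - FreeNonUnitalNonAssocAlgebra.of k (some w))
  | smul (c : k) (v : V) : GradedPreLieRel
      (FreeNonUnitalNonAssocAlgebra.of k (some (c • v))
        - c • FreeNonUnitalNonAssocAlgebra.of k (some v))
  | assoc (x y z : FreeMagma (Option V)) : GradedPreLieRel
      (associator (monom k x) (monom k y) (monom k z)
        - (-1 : k) ^ (deg y * deg z) • associator (monom k x) (monom k z) (monom k y))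

/-- The free graded pre-Lie algebra `pL(V, ∘)` generated by `V` in degree `0` and one dummy
variable `∘` in degree `1`. -/
abbrev GradedPreLie : Type _ :=
  QuotAlg k {r | GradedPreLieRel k V r}

variable {V} in
/-- The class of a monomial in `pL(V, ∘)`. -/
def GradedPreLie.mon (w : FreeMagma (Option V)) : GradedPreLie k V :=
  quotMk k {r | GradedPreLieRel k V r} (monom k w)

/-- The generators from `V` in `pL(V, ∘)`. -/
def GradedPreLie.gen (v : V) : GradedPreLie k V := GradedPreLie.mon k (FreeMagma.of (some v))

/-- The dummy variable `∘` in `pL(V, ∘)`. -/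
def GradedPreLie.dummy : GradedPreLie k V := GradedPreLie.mon k (FreeMagma.of none)

/-- The homogeneous part `pLⁿ(V)` of `pL(V, ∘)`, spanned by the monomials with exactly `n`
occurrences of the dummy variable. -/
def GradedPreLie.homog (n : ℕ) : Submodule k (GradedPreLie k V) :=
  Submodule.span k {x | ∃ w : FreeMagma (Option V), deg w = n ∧ GradedPreLie.mon k w = x}

namespace GradedPreLie

theorem monom_mul (x y : FreeMagma (Option V)) :
    monom k (x * y) = monom k x * monom k y := map_mul (MonoidAlgebra.ofMagma k _) x y

theorem mon_mul (x y : FreeMagma (Option V)) : mon k (x * y) = mon k x * mon k y := by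
  simp only [mon, monom_mul, map_mul]

theorem deg_mul (x y : FreeMagma (Option V)) : deg (x * y) = deg x + deg y := rfl

theorem mon_mem (w : FreeMagma (Option V)) : mon k w ∈ homog k V (deg w) :=
  Submodule.subset_span ⟨w, rfl, rfl⟩

theorem gen_mem (v : V) : gen k V v ∈ homog k V 0 :=
  mon_mem k V (FreeMagma.of (some v))

theorem dummy_mem : dummy k V ∈ homog k V 1 :=
  mon_mem k V (FreeMagma.of none)

theorem mul_mem_homog {m n : ℕ} {x y : GradedPreLie k V} (hx : x ∈ homog k V m)
    (hy : y ∈ homog k V n) : x * y ∈ homog k V (m + n) := by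
  induction hx using Submodule.span_induction with
  | zero => simp
  | add a b _ _ ha hb => rw [add_mul]; exact add_mem ha hb
  | smul c a _ ha => rw [smul_mul_assoc]; exact Submodule.smul_mem _ _ ha
  | mem x hx =>
    obtain ⟨u, rfl, rfl⟩ := hx
    induction hy using Submodule.span_induction with
    | zero => simp
    | add a b _ _ ha hb => rw [mul_add]; exact add_mem ha hb
    | smul c a _ ha => rw [mul_smul_comm]; exact Submodule.smul_mem _ _ ha
    | mem y hy =>
      obtain ⟨w, rfl, rfl⟩ := hy
      rw [← mon_mul, ← deg_mul]
      exact mon_mem k V _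

/-- Linear maps out of the free nonassociative algebra, given on monomials. -/
def onMon {M : Type*} [AddCommGroup M] [Module k M] (f : FreeMagma (Option V) → M) :
    FreeNonUnitalNonAssocAlgebra k (Option V) →ₗ[k] M :=
  Finsupp.linearCombination k f ∘ₗ (MonoidAlgebra.coeffLinearEquiv k).toLinearMap

@[simp]
theorem onMon_monom {M : Type*} [AddCommGroup M] [Module k M] (f : FreeMagma (Option V) → M)
    (w : FreeMagma (Option V)) : onMon k V f (monom k w) = f w := by
  simp [onMon, monom]

theorem monom_induction {p : FreeNonUnitalNonAssocAlgebra k (Option V) → Prop}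
    (h0 : p 0) (hm : ∀ w, p (monom k w)) (ha : ∀ x y, p x → p y → p (x + y))
    (hs : ∀ (c : k) x, p x → p (c • x)) (x) : p x := by
  induction x using MonoidAlgebra.induction_linear with
  | zero => exact h0
  | add f g hf hg => exact ha _ _ hf hg
  | single a b =>
    have : MonoidAlgebra.single a b = b • monom k a := by simp [monom]
    rw [this]
    exact hs _ _ (hm a)

theorem span_mon : ⊤ ≤ Submodule.span k (Set.range (mon (V := V) k)) := by
  rintro x -
  obtain ⟨x, rfl⟩ := quotMk_surjective k _ x
  induction x using monom_induction with
  | h0 => simp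
  | hm w => exact Submodule.subset_span ⟨w, rfl⟩
  | ha x y hx hy => rw [map_add]; exact add_mem hx hy
  | hs c x hx => rw [map_smul]; exact Submodule.smul_mem _ _ hx

theorem mon_assoc (x y z : FreeMagma (Option V)) :
    associator (mon k x) (mon k y) (mon k z)
      = (-1 : k) ^ (deg y * deg z) • associator (mon k x) (mon k z) (mon k y) := by
  rw [← sub_eq_zero]
  simp only [mon, ← map_associator', ← map_smul, ← map_sub, quotMk_eq_zero]
  exact subset_idealSpan k _ (GradedPreLieRel.assoc x y z)

theorem assoc_homog {p q : ℕ} (x : GradedPreLie k V) {y z : GradedPreLie k V}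
    (hy : y ∈ homog k V p) (hz : z ∈ homog k V q) :
    associator x y z = (-1 : k) ^ (p * q) • associator x z y := by
  have hx := span_mon k V (x := x) trivial
  induction hx using Submodule.span_induction with
  | zero => simp [associator]
  | add a b _ _ ha hb => simp only [assoc_add₁, ha, hb, smul_add]
  | smul c a _ ha => rw [assoc_smul₁, assoc_smul₁, ha, smul_comm]
  | mem u hu =>
    obtain ⟨u, rfl⟩ := hu
    induction hy using Submodule.span_induction with
    | zero => simp [associator]
    | add a b _ _ ha hb => simp only [assoc_add₂, assoc_add₃, ha, hb, smul_add]
    | smul c a _ ha => rw [assoc_smul₂, assoc_smul₃, ha, smul_comm]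
    | mem y hy =>
      obtain ⟨y, rfl, rfl⟩ := hy
      induction hz using Submodule.span_induction with
      | zero => simp [associator]
      | add a b _ _ ha hb => simp only [assoc_add₂, assoc_add₃, ha, hb, smul_add]
      | smul c a _ ha => rw [assoc_smul₂, assoc_smul₃, ha, smul_comm]
      | mem z hz =>
        obtain ⟨z, rfl, rfl⟩ := hz
        exact mon_assoc k V u y z

variable {V} in
/-- The differential on monomials, defined by recursion through the twisted Leibniz rule. -/
def dMon : FreeMagma (Option V) → GradedPreLie k V
  | .of _ => 0
  | .mul x y => dMon x * mon k y + (-1 : k) ^ deg x • (mon k x * dMon y)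
      + associator (dummy k V) (mon k x) (mon k y)

theorem dMon_mul (x y : FreeMagma (Option V)) :
    dMon k (x * y) = dMon k x * mon k y + (-1 : k) ^ deg x • (mon k x * dMon k y)
      + associator (dummy k V) (mon k x) (mon k y) := rfl

theorem assoc_mem_homog {p q r : ℕ} {x y z : GradedPreLie k V} (hx : x ∈ homog k V p)
    (hy : y ∈ homog k V q) (hz : z ∈ homog k V r) :
    associator x y z ∈ homog k V (p + q + r) := by
  refine sub_mem (mul_mem_homog k V (mul_mem_homog k V hx hy) hz) ?_
  rw [add_assoc]
  exact mul_mem_homog k V hx (mul_mem_homog k V hy hz)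

theorem dMon_mem (w : FreeMagma (Option V)) : dMon k w ∈ homog k V (deg w + 1) := by
  induction w with
  | ih1 a => exact zero_mem _
  | ih2 x y hx hy =>
    rw [dMon_mul]
    change _ ∈ homog k V (deg x + deg y + 1)
    refine add_mem (add_mem ?_ (Submodule.smul_mem _ _ ?_)) ?_
    · rw [add_right_comm]; exact mul_mem_homog k V hx (mon_mem k V y)
    · rw [add_assoc]; exact mul_mem_homog k V (mon_mem k V x) hy
    · rw [add_comm, ← add_assoc]
      exact assoc_mem_homog k V (dummy_mem k V) (mon_mem k V x) (mon_mem k V y)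

/-- The extension of `dMon` to the free nonassociative algebra. -/
def dFree : FreeNonUnitalNonAssocAlgebra k (Option V) →ₗ[k] GradedPreLie k V :=
  onMon k V (dMon k)

/-- The sign automorphism of the free nonassociative algebra. -/
def sgnFree : FreeNonUnitalNonAssocAlgebra k (Option V) →ₗ[k]
    FreeNonUnitalNonAssocAlgebra k (Option V) :=
  onMon k V fun w => (-1 : k) ^ deg w • monom k w

/-- The projection of the free nonassociative algebra onto degree `n`. -/
def projFree (n : ℕ) : FreeNonUnitalNonAssocAlgebra k (Option V) →ₗ[k]
    FreeNonUnitalNonAssocAlgebra k (Option V) :=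
  onMon k V fun w => if deg w = n then monom k w else 0

theorem sgnFree_mul (x y : FreeNonUnitalNonAssocAlgebra k (Option V)) :
    sgnFree k V (x * y) = sgnFree k V x * sgnFree k V y := by
  induction x using monom_induction with
  | h0 => simp
  | ha x x' hx hx' => simp only [add_mul, map_add, hx, hx']
  | hs c x hx => simp only [smul_mul_assoc, map_smul, hx]
  | hm u =>
    induction y using monom_induction with
    | h0 => simp
    | ha x x' hx hx' => simp only [mul_add, map_add, hx, hx']
    | hs c x hx => simp only [mul_smul_comm, map_smul, hx]
    | hm w =>
      rw [← monom_mul]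
      simp only [sgnFree, onMon_monom, deg_mul, pow_add]
      rw [monom_mul, smul_mul_smul_comm]

theorem dFree_mul (x y : FreeNonUnitalNonAssocAlgebra k (Option V)) :
    dFree k V (x * y) = dFree k V x * quotMk k _ y + quotMk k _ (sgnFree k V x) * dFree k V y
      + associator (dummy k V) (quotMk k _ x) (quotMk k _ y) := by
  induction x using monom_induction with
  | h0 => simp [associator]
  | ha x x' hx hx' => simp only [add_mul, map_add, hx, hx', assoc_add₂]; abel
  | hs c x hx => simp only [smul_mul_assoc, map_smul, hx, assoc_smul₂, smul_add]
  | hm u =>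
    induction y using monom_induction with
    | h0 => simp [associator]
    | ha x x' hx hx' => simp only [mul_add, map_add, hx, hx', assoc_add₃]; abel
    | hs c x hx => simp only [mul_smul_comm, map_smul, hx, assoc_smul₃, smul_add]
    | hm w =>
      rw [← monom_mul]
      simp only [dFree, sgnFree, onMon_monom, dMon_mul, map_smul, smul_mul_assoc]
      rfl

theorem dMon_assoc (x y z : FreeMagma (Option V)) :
    dFree k V (associator (monom k x) (monom k y) (monom k z)) =
      associator (dMon k x) (mon k y) (mon k z)
      + (-1 : k) ^ deg x • associator (mon k x) (dMon k y) (mon k z)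
      + (-1 : k) ^ deg x • (-1 : k) ^ deg y • associator (mon k x) (mon k y) (dMon k z)
      - (-1 : k) ^ deg x • (mon k x * associator (dummy k V) (mon k y) (mon k z))
      + associator (dummy k V * mon k x) (mon k y) (mon k z)
      - dummy k V * associator (mon k x) (mon k y) (mon k z) := by
  simp only [associator, ← monom_mul, map_sub]
  simp only [dFree, onMon_monom, dMon_mul, mon_mul, deg_mul, pow_add, associator, mul_add, add_mul,
    mul_sub, sub_mul, smul_mul_assoc, mul_smul_comm, smul_add, smul_sub, mul_smul]
  abel

theorem dFree_rel (r : FreeNonUnitalNonAssocAlgebra k (Option V)) (hr : GradedPreLieRel k V r) :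
    quotMk k {r | GradedPreLieRel k V r} (sgnFree k V r) = 0 ∧ dFree k V r = 0 := by
  have h0 := (quotMk_eq_zero k {r | GradedPreLieRel k V r} r).2 (subset_idealSpan k _ hr)
  cases hr with
  | add v w =>
    have e : ∀ a : V, FreeNonUnitalNonAssocAlgebra.of k (some a) = monom k (.of (some a)) :=
      fun _ => rfl
    simp only [e, map_sub] at h0 ⊢
    simp only [sgnFree, dFree, onMon_monom, dMon, deg, pow_zero, one_smul]
    exact ⟨h0, by simp⟩
  | smul c v =>
    have e : ∀ a : V, FreeNonUnitalNonAssocAlgebra.of k (some a) = monom k (.of (some a)) :=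
      fun _ => rfl
    simp only [e, map_sub, map_smul] at h0 ⊢
    simp only [sgnFree, dFree, onMon_monom, dMon, deg, pow_zero, one_smul]
    exact ⟨h0, by simp⟩
  | assoc x y z =>
    constructor
    · have e : ∀ a b c : FreeMagma (Option V),
          sgnFree k V (associator (monom k a) (monom k b) (monom k c))
            = (-1 : k) ^ (deg a + deg b + deg c) •
              associator (monom k a) (monom k b) (monom k c) := by
        intro a b c
        simp only [associator, ← monom_mul, map_sub]
        simp only [sgnFree, onMon_monom, deg_mul, smul_sub, add_assoc]
      rw [map_sub, map_smul, e, e, add_right_comm, smul_comm, ← smul_sub, map_smul, h0, smul_zero]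
    · have hy := mon_mem k V y
      have hz := mon_mem k V z
      have dy := dMon_mem k V y
      have dz := dMon_mem k V z
      rw [map_sub, map_smul, dMon_assoc, dMon_assoc, assoc_homog k V _ hy hz,
        assoc_homog k V _ hy hz, assoc_homog k V _ hy hz, assoc_homog k V _ hy hz,
        assoc_homog k V _ dy hz, assoc_homog k V _ hy dz]
      simp only [mul_smul_comm, smul_add, smul_sub, add_mul, mul_add, pow_add, mul_one, one_mul,
        mul_smul]
      rcases neg_one_pow_eq_or k (deg y) with h | h <;>
      rcases neg_one_pow_eq_or k (deg z) with h₁ | h₁ <;>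
      rcases neg_one_pow_eq_or k (deg x) with h₂ | h₂ <;>
      rcases neg_one_pow_eq_or k (deg y * deg z) with h₃ | h₃ <;>
      · simp only [h, h₁, h₂, h₃, one_smul, neg_smul, smul_neg]
        abel

theorem sgn_dFree_ideal : idealSpan k {r | GradedPreLieRel k V r} ≤
    LinearMap.ker ((quotMk k {r | GradedPreLieRel k V r} :
      FreeNonUnitalNonAssocAlgebra k (Option V) →ₗ[k] GradedPreLie k V) ∘ₗ sgnFree k V) ⊓
    LinearMap.ker (dFree k V) := by
  refine le_trans (idealSpan_le k (LinearMap.ker (quotMk k {r | GradedPreLieRel k V r} :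
      FreeNonUnitalNonAssocAlgebra k (Option V) →ₗ[k] GradedPreLie k V) ⊓ _) ?_ ?_) inf_le_right
  · intro r hr
    refine ⟨(quotMk_eq_zero k _ r).2 (subset_idealSpan k _ hr), ?_, ?_⟩
    · exact (dFree_rel k V r hr).1
    · exact (dFree_rel k V r hr).2
  · rintro a x ⟨h1, h2, h3⟩
    have h1 : quotMk k {r | GradedPreLieRel k V r} x = 0 := h1
    have h2 : quotMk k {r | GradedPreLieRel k V r} (sgnFree k V x) = 0 := h2
    have h3 : dFree k V x = 0 := h3
    refine ⟨⟨?_, ?_, ?_⟩, ?_, ?_, ?_⟩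
    · change quotMk k _ (a * x) = 0
      simp [h1]
    · change quotMk k _ (sgnFree k V (a * x)) = 0
      simp [sgnFree_mul, h2]
    · change dFree k V (a * x) = 0
      simp [dFree_mul, h1, h3, associator]
    · change quotMk k _ (x * a) = 0
      simp [h1]
    · change quotMk k _ (sgnFree k V (x * a)) = 0
      simp [sgnFree_mul, h2]
    · change dFree k V (x * a) = 0
      simp [dFree_mul, h1, h2, h3, associator]

/-- The sign automorphism `x ↦ (-1) ^ |x| x` of `pL(V, ∘)`. -/
def sgn : GradedPreLie k V →ₗ[k] GradedPreLie k V :=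
  quotLiftLin k _ ((quotMk k {r | GradedPreLieRel k V r} :
      FreeNonUnitalNonAssocAlgebra k (Option V) →ₗ[k] GradedPreLie k V) ∘ₗ sgnFree k V)
    ((sgn_dFree_ideal k V).trans inf_le_left)

/-- The degree `+1` map of `pL(V, ∘)` that vanishes on the generators and satisfies the twisted
Leibniz rule. -/
def dTilde : GradedPreLie k V →ₗ[k] GradedPreLie k V :=
  quotLiftLin k _ (dFree k V) ((sgn_dFree_ideal k V).trans inf_le_right)

theorem sgn_mon (w : FreeMagma (Option V)) : sgn k V (mon k w) = (-1 : k) ^ deg w • mon k w := by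
  change quotMk k _ (sgnFree k V (monom k w)) = _
  simp only [sgnFree, onMon_monom, map_smul]
  rfl

theorem dTilde_mon (w : FreeMagma (Option V)) : dTilde k V (mon k w) = dMon k w := by
  change dFree k V (monom k w) = _
  simp only [dFree, onMon_monom]

theorem sgn_mul (x y : GradedPreLie k V) : sgn k V (x * y) = sgn k V x * sgn k V y := by
  obtain ⟨x, rfl⟩ := quotMk_surjective k _ x
  obtain ⟨y, rfl⟩ := quotMk_surjective k _ y
  change quotMk k _ (sgnFree k V (x * y)) = quotMk k _ (sgnFree k V x) * quotMk k _ (sgnFree k V y)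
  rw [sgnFree_mul, map_mul]

theorem dTilde_mul (x y : GradedPreLie k V) :
    dTilde k V (x * y) = dTilde k V x * y + sgn k V x * dTilde k V y
      + associator (dummy k V) x y := by
  obtain ⟨x, rfl⟩ := quotMk_surjective k _ x
  obtain ⟨y, rfl⟩ := quotMk_surjective k _ y
  exact dFree_mul k V x y

theorem sgn_homog {n : ℕ} {x : GradedPreLie k V} (hx : x ∈ homog k V n) :
    sgn k V x = (-1 : k) ^ n • x := by
  induction hx using Submodule.span_induction with
  | zero => simp
  | add a b _ _ ha hb => rw [map_add, ha, hb, smul_add]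
  | smul c a _ ha => rw [map_smul, ha, smul_comm]
  | mem x hx => obtain ⟨w, rfl, rfl⟩ := hx; exact sgn_mon k V w

theorem dTilde_homog {n : ℕ} {x : GradedPreLie k V} (hx : x ∈ homog k V n) :
    dTilde k V x ∈ homog k V (n + 1) := by
  induction hx using Submodule.span_induction with
  | zero => simp
  | add a b _ _ ha hb => rw [map_add]; exact add_mem ha hb
  | smul c a _ ha => rw [map_smul]; exact Submodule.smul_mem _ _ ha
  | mem x hx => obtain ⟨w, rfl, rfl⟩ := hx; rw [dTilde_mon]; exact dMon_mem k V w

/-! The components of degree zero and one. -/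

theorem projFree_zero_mul (x y : FreeNonUnitalNonAssocAlgebra k (Option V)) :
    projFree k V 0 (x * y) = projFree k V 0 x * projFree k V 0 y := by
  induction x using monom_induction with
  | h0 => simp
  | ha x x' hx hx' => simp only [add_mul, map_add, hx, hx']
  | hs c x hx => simp only [smul_mul_assoc, map_smul, hx]
  | hm u =>
    induction y using monom_induction with
    | h0 => simp
    | ha x x' hx hx' => simp only [mul_add, map_add, hx, hx']
    | hs c x hx => simp only [mul_smul_comm, map_smul, hx]
    | hm w =>
      rw [← monom_mul]
      simp only [projFree, onMon_monom, deg_mul, Nat.add_eq_zero_iff]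
      rw [monom_mul]
      by_cases h : deg u = 0 <;> by_cases h' : deg w = 0 <;> simp [h, h']

theorem projFree_one_mul (x y : FreeNonUnitalNonAssocAlgebra k (Option V)) :
    projFree k V 1 (x * y) = projFree k V 0 x * projFree k V 1 y
      + projFree k V 1 x * projFree k V 0 y := by
  induction x using monom_induction with
  | h0 => simp
  | ha x x' hx hx' => simp only [add_mul, map_add, hx, hx']; abel
  | hs c x hx => simp only [smul_mul_assoc, map_smul, hx, smul_add]
  | hm u =>
    induction y using monom_induction with
    | h0 => simp
    | ha x x' hx hx' => simp only [mul_add, map_add, hx, hx']; abel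
    | hs c x hx => simp only [mul_smul_comm, map_smul, hx, smul_add]
    | hm w =>
      rw [← monom_mul]
      simp only [projFree, onMon_monom, deg_mul, Nat.add_eq_one_iff]
      rw [monom_mul]
      by_cases h : deg u = 0 <;> by_cases h' : deg w = 0 <;>
      by_cases h₂ : deg u = 1 <;> by_cases h₃ : deg w = 1 <;> simp_all

theorem projFree_rel (n : ℕ) (r : FreeNonUnitalNonAssocAlgebra k (Option V))
    (hr : GradedPreLieRel k V r) :
    projFree k V n r = r ∨ projFree k V n r = 0 := by
  have e : ∀ a : V, FreeNonUnitalNonAssocAlgebra.of k (some a) = monom k (.of (some a)) :=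
      fun _ => rfl
  cases hr with
  | add v w =>
    simp only [e, map_sub, projFree, onMon_monom, deg]
    by_cases h : 0 = n <;> simp [h]
  | smul c v =>
    simp only [e, map_sub, map_smul, projFree, onMon_monom, deg]
    by_cases h : 0 = n <;> simp [h]
  | assoc x y z =>
    have e' : ∀ a b c : FreeMagma (Option V),
        projFree k V n (associator (monom k a) (monom k b) (monom k c))
          = if deg a + deg b + deg c = n then
            associator (monom k a) (monom k b) (monom k c) else 0 := by
      intro a b c
      simp only [associator, ← monom_mul, map_sub]
      simp only [projFree, onMon_monom, deg_mul, add_assoc]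
      by_cases h : deg a + (deg b + deg c) = n <;> simp [h]
    rw [map_sub, map_smul, e', e', add_right_comm (deg x) (deg z)]
    by_cases h : deg x + deg y + deg z = n <;> simp [h]

theorem projFree_ideal : idealSpan k {r | GradedPreLieRel k V r} ≤
    LinearMap.ker ((quotMk k {r | GradedPreLieRel k V r} :
      FreeNonUnitalNonAssocAlgebra k (Option V) →ₗ[k] GradedPreLie k V) ∘ₗ projFree k V 0) ⊓
    LinearMap.ker ((quotMk k {r | GradedPreLieRel k V r} :
      FreeNonUnitalNonAssocAlgebra k (Option V) →ₗ[k] GradedPreLie k V) ∘ₗ projFree k V 1) := by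
  refine idealSpan_le k _ ?_ ?_
  · intro r hr
    have h0 := (quotMk_eq_zero k {r | GradedPreLieRel k V r} r).2 (subset_idealSpan k _ hr)
    constructor
    · change quotMk k _ (projFree k V 0 r) = 0
      rcases projFree_rel k V 0 r hr with h | h <;> simp [h, h0]
    · change quotMk k _ (projFree k V 1 r) = 0
      rcases projFree_rel k V 1 r hr with h | h <;> simp [h, h0]
  · rintro a x ⟨h1, h2⟩
    have h1 : quotMk k {r | GradedPreLieRel k V r} (projFree k V 0 x) = 0 := h1
    have h2 : quotMk k {r | GradedPreLieRel k V r} (projFree k V 1 x) = 0 := h2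
    refine ⟨⟨?_, ?_⟩, ?_, ?_⟩
    · change quotMk k _ (projFree k V 0 (a * x)) = 0
      simp [projFree_zero_mul, h1]
    · change quotMk k _ (projFree k V 1 (a * x)) = 0
      simp [projFree_one_mul, h1, h2]
    · change quotMk k _ (projFree k V 0 (x * a)) = 0
      simp [projFree_zero_mul, h1]
    · change quotMk k _ (projFree k V 1 (x * a)) = 0
      simp [projFree_one_mul, h1, h2]

/-- The component of degree zero of an element of `pL(V, ∘)`. -/
def projZero : GradedPreLie k V →ₗ[k] GradedPreLie k V :=
  quotLiftLin k _ _ ((projFree_ideal k V).trans inf_le_left)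

/-- The component of degree one of an element of `pL(V, ∘)`. -/
def projOne : GradedPreLie k V →ₗ[k] GradedPreLie k V :=
  quotLiftLin k _ _ ((projFree_ideal k V).trans inf_le_right)

theorem projZero_mul (x y : GradedPreLie k V) :
    projZero k V (x * y) = projZero k V x * projZero k V y := by
  obtain ⟨x, rfl⟩ := quotMk_surjective k _ x
  obtain ⟨y, rfl⟩ := quotMk_surjective k _ y
  change quotMk k _ (projFree k V 0 (x * y))
    = quotMk k _ (projFree k V 0 x) * quotMk k _ (projFree k V 0 y)
  rw [projFree_zero_mul, map_mul]

theorem projOne_mul (x y : GradedPreLie k V) :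
    projOne k V (x * y) = projZero k V x * projOne k V y + projOne k V x * projZero k V y := by
  obtain ⟨x, rfl⟩ := quotMk_surjective k _ x
  obtain ⟨y, rfl⟩ := quotMk_surjective k _ y
  change quotMk k _ (projFree k V 1 (x * y))
    = quotMk k _ (projFree k V 0 x) * quotMk k _ (projFree k V 1 y)
      + quotMk k _ (projFree k V 1 x) * quotMk k _ (projFree k V 0 y)
  rw [projFree_one_mul, map_add, map_mul, map_mul]

theorem projZero_mon (w : FreeMagma (Option V)) :
    projZero k V (mon k w) = if deg w = 0 then mon k w else 0 := by
  change quotMk k _ (projFree k V 0 (monom k w)) = _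
  simp only [projFree, onMon_monom]
  split_ifs
  · rfl
  · simp

theorem projOne_mon (w : FreeMagma (Option V)) :
    projOne k V (mon k w) = if deg w = 1 then mon k w else 0 := by
  change quotMk k _ (projFree k V 1 (monom k w)) = _
  simp only [projFree, onMon_monom]
  split_ifs
  · rfl
  · simp

theorem projOne_homog {x : GradedPreLie k V} (hx : x ∈ homog k V 1) : projOne k V x = x := by
  induction hx using Submodule.span_induction with
  | zero => simp
  | add a b _ _ ha hb => rw [map_add, ha, hb]
  | smul c a _ ha => rw [map_smul, ha]
  | mem x hx => obtain ⟨w, hw, rfl⟩ := hx; simp [projOne_mon, hw]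

theorem projZero_dummy : projZero k V (dummy k V) = 0 := by
  simp [dummy, projZero_mon, deg]

end GradedPreLie

/-! ### The reduced graded pre-Lie algebra and its differential -/

/-- The reduced graded pre-Lie algebra `rpL(V) = pL(V, ∘) / (∘ ⋆ ∘)`. -/
abbrev ReducedPreLie : Type _ :=
  QuotAlg k {GradedPreLie.dummy k V * GradedPreLie.dummy k V}

namespace ReducedPreLie

/-- The projection `pL(V, ∘) → rpL(V)`. -/
def proj : GradedPreLie k V →ₙₐ[k] ReducedPreLie k V :=
  quotMk k {GradedPreLie.dummy k V * GradedPreLie.dummy k V}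

/-- The homogeneous part `rpLⁿ(V)`, the image of `pLⁿ(V)`. -/
def homog (n : ℕ) : Submodule k (ReducedPreLie k V) :=
  (GradedPreLie.homog k V n).map (proj k V : GradedPreLie k V →ₗ[k] ReducedPreLie k V)

/-- The defining properties of the differential of `rpL(V)`: it is a linear map of degree `+1`
that vanishes on `V` and on the dummy variable `∘` and satisfies
`d (a ⋆ b) = d a ⋆ b + (-1) ^ |a| a ⋆ d b + Φ(∘, a, b)`,
where `Φ(∘, a, b) = (∘ ⋆ a) ⋆ b - ∘ ⋆ (a ⋆ b)`. -/
structure IsDifferential (d : ReducedPreLie k V →ₗ[k] ReducedPreLie k V) : Prop where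
  degree : ∀ n : ℕ, ∀ a ∈ homog k V n, d a ∈ homog k V (n + 1)
  gen : ∀ v : V, d (proj k V (GradedPreLie.gen k V v)) = 0
  dummy : d (proj k V (GradedPreLie.dummy k V)) = 0
  mul : ∀ n : ℕ, ∀ a ∈ homog k V n, ∀ b : ReducedPreLie k V,
    d (a * b) = d a * b + (-1 : k) ^ n • (a * d b)
      + associator (proj k V (GradedPreLie.dummy k V)) a b

theorem proj_dummy_mul :
    proj k V (GradedPreLie.dummy k V) * proj k V (GradedPreLie.dummy k V) = 0 := by
  rw [← map_mul]
  exact (quotMk_eq_zero k _ _).2 (subset_idealSpan k _ rfl)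

theorem dTilde_ideal : idealSpan k {GradedPreLie.dummy k V * GradedPreLie.dummy k V} ≤
    LinearMap.ker ((proj k V : GradedPreLie k V →ₗ[k] ReducedPreLie k V)
      ∘ₗ GradedPreLie.dTilde k V) := by
  refine le_trans (idealSpan_le k
    (LinearMap.ker (proj k V : GradedPreLie k V →ₗ[k] ReducedPreLie k V) ⊓
      (LinearMap.ker ((proj k V : GradedPreLie k V →ₗ[k] ReducedPreLie k V)
        ∘ₗ GradedPreLie.sgn k V) ⊓ _)) ?_ ?_) (inf_le_right.trans inf_le_right)
  · rintro r rfl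
    have hs := GradedPreLie.sgn_homog k V (GradedPreLie.dummy_mem k V)
    have hd : GradedPreLie.dTilde k V (GradedPreLie.dummy k V) = 0 :=
      GradedPreLie.dTilde_mon k V (.of none)
    refine ⟨?_, ?_, ?_⟩
    · change proj k V (_ * _) = 0
      simp [proj_dummy_mul]
    · change proj k V (GradedPreLie.sgn k V (_ * _)) = 0
      simp [GradedPreLie.sgn_mul, hs, proj_dummy_mul]
    · change proj k V (GradedPreLie.dTilde k V (_ * _)) = 0
      simp [GradedPreLie.dTilde_mul, hd, proj_dummy_mul, associator]
  · rintro a x ⟨h1, h2, h3⟩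
    have h1 : proj k V x = 0 := h1
    have h2 : proj k V (GradedPreLie.sgn k V x) = 0 := h2
    have h3 : proj k V (GradedPreLie.dTilde k V x) = 0 := h3
    refine ⟨⟨?_, ?_, ?_⟩, ?_, ?_, ?_⟩
    · change proj k V (_ * _) = 0
      simp [h1]
    · change proj k V (GradedPreLie.sgn k V (_ * _)) = 0
      simp [GradedPreLie.sgn_mul, h2]
    · change proj k V (GradedPreLie.dTilde k V (_ * _)) = 0
      simp [GradedPreLie.dTilde_mul, h1, h3, associator]
    · change proj k V (_ * _) = 0
      simp [h1]
    · change proj k V (GradedPreLie.sgn k V (_ * _)) = 0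
      simp [GradedPreLie.sgn_mul, h2]
    · change proj k V (GradedPreLie.dTilde k V (_ * _)) = 0
      simp [GradedPreLie.dTilde_mul, h1, h2, h3, associator]

theorem differential_unique {d d' : ReducedPreLie k V →ₗ[k] ReducedPreLie k V}
    (hd : IsDifferential k V d) (hd' : IsDifferential k V d') : d = d' := by
  have hw : ∀ w : FreeMagma (Option V),
      d (proj k V (GradedPreLie.mon k w)) = d' (proj k V (GradedPreLie.mon k w)) := by
    intro w
    induction w with
    | ih1 a =>
      cases a with
      | none => exact hd.dummy.trans hd'.dummy.symm
      | some v => exact (hd.gen v).trans (hd'.gen v).symm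
    | ih2 x y hx hy =>
      have hm : proj k V (GradedPreLie.mon k x) ∈ homog k V (deg x) :=
        ⟨_, GradedPreLie.mon_mem k V x, rfl⟩
      rw [GradedPreLie.mon_mul, map_mul, hd.mul _ _ hm, hd'.mul _ _ hm, hx, hy]
  refine LinearMap.ext fun x => ?_
  obtain ⟨x, rfl⟩ := quotMk_surjective k _ x
  change d (proj k V x) = d' (proj k V x)
  have hx := GradedPreLie.span_mon k V (x := x) trivial
  induction hx using Submodule.span_induction with
  | zero => simp
  | add a b _ _ ha hb => simp only [map_add, ha, hb]
  | smul c a _ ha => simp only [map_smul, ha]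
  | mem x hx => obtain ⟨w, rfl⟩ := hx; exact hw w

/-- There is exactly one such map. -/
theorem existsUnique_differential :
    ∃! d : ReducedPreLie k V →ₗ[k] ReducedPreLie k V, IsDifferential k V d := by
  have h1 : ∀ n : ℕ, ∀ a ∈ homog k V n,
      quotLiftLin k _ _ (dTilde_ideal k V) a ∈ homog k V (n + 1) := by
    rintro n _ ⟨a, ha, rfl⟩
    exact ⟨_, GradedPreLie.dTilde_homog k V ha, rfl⟩
  have h2 : ∀ v : V,
      quotLiftLin k _ _ (dTilde_ideal k V) (proj k V (GradedPreLie.gen k V v)) = 0 := by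
    intro v
    change proj k V (GradedPreLie.dTilde k V (GradedPreLie.mon k _)) = 0
    rw [GradedPreLie.dTilde_mon, GradedPreLie.dMon, map_zero]
  have h3 : quotLiftLin k _ _ (dTilde_ideal k V) (proj k V (GradedPreLie.dummy k V)) = 0 := by
    change proj k V (GradedPreLie.dTilde k V (GradedPreLie.mon k _)) = 0
    rw [GradedPreLie.dTilde_mon, GradedPreLie.dMon, map_zero]
  have h4 : ∀ n : ℕ, ∀ a ∈ homog k V n, ∀ b : ReducedPreLie k V,
      quotLiftLin k _ _ (dTilde_ideal k V) (a * b)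
        = quotLiftLin k _ _ (dTilde_ideal k V) a * b
          + (-1 : k) ^ n • (a * quotLiftLin k _ _ (dTilde_ideal k V) b)
          + associator (proj k V (GradedPreLie.dummy k V)) a b := by
    rintro n _ ⟨a, ha, rfl⟩ b
    obtain ⟨b, rfl⟩ := quotMk_surjective k _ b
    change proj k V (GradedPreLie.dTilde k V (a * b)) = _
    rw [GradedPreLie.dTilde_mul, GradedPreLie.sgn_homog k V ha, smul_mul_assoc]
    simp only [map_add, map_mul, map_smul, map_associator']
    rfl
  refine ⟨quotLiftLin k _ _ (dTilde_ideal k V), ⟨h1, h2, h3, h4⟩, ?_⟩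
  · exact fun d hd => differential_unique k V hd ⟨h1, h2, h3, h4⟩

/-- The differential `d` of `rpL(V)`. -/
def differential : ReducedPreLie k V →ₗ[k] ReducedPreLie k V :=
  (existsUnique_differential k V).choose

theorem differential_spec : IsDifferential k V (differential k V) :=
  (existsUnique_differential k V).choose_spec.1

/-- `rpL¹(V) = pL¹(V)`: the projection is injective on `pL¹(V)`. -/
theorem proj_injective_homog_one :
    Function.Injective ((proj k V : GradedPreLie k V →ₗ[k] ReducedPreLie k V).domRestrict
      (GradedPreLie.homog k V 1)) := by
  have hI : idealSpan k {GradedPreLie.dummy k V * GradedPreLie.dummy k V} ≤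
      LinearMap.ker (GradedPreLie.projZero k V) ⊓ LinearMap.ker (GradedPreLie.projOne k V) := by
    refine idealSpan_le k _ ?_ ?_
    · rintro r rfl
      constructor
      · simp [GradedPreLie.projZero_mul, GradedPreLie.projZero_dummy]
      · simp [GradedPreLie.projOne_mul, GradedPreLie.projZero_dummy]
    · rintro a x ⟨h1, h2⟩
      have h1 : GradedPreLie.projZero k V x = 0 := h1
      have h2 : GradedPreLie.projOne k V x = 0 := h2
      refine ⟨⟨?_, ?_⟩, ?_, ?_⟩ <;>
      simp [GradedPreLie.projZero_mul, GradedPreLie.projOne_mul, h1, h2]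
  rw [← LinearMap.ker_eq_bot, LinearMap.ker_eq_bot']
  rintro ⟨x, hx⟩ h
  have h' : proj k V x = 0 := h
  have h2 : GradedPreLie.projOne k V x = 0 := (hI ((quotMk_eq_zero k _ x).1 h')).2
  rw [GradedPreLie.projOne_homog k V hx] at h2
  exact Subtype.ext h2

/-- The identification `pL¹(V) ≅ rpL¹(V)` induced by the projection. -/
def homogOneEquiv : GradedPreLie.homog k V 1 ≃ₗ[k] homog k V 1 :=
  (LinearEquiv.ofInjective _ (proj_injective_homog_one k V)).trans
    (LinearEquiv.ofEq _ _ (LinearMap.range_domRestrict _ _))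

theorem homogOneEquiv_apply (x : GradedPreLie.homog k V 1) :
    (homogOneEquiv k V x : ReducedPreLie k V) = proj k V x := rfl

end ReducedPreLie

/-! ### The map `d : pL(V) → pL¹(V)` -/

namespace FreePreLie

theorem toGraded_mem (x : FreeNonUnitalNonAssocAlgebra k V) :
    FreeNonUnitalNonAssocAlgebra.lift k (GradedPreLie.gen k V) x ∈ GradedPreLie.homog k V 0 := by
  induction x using MonoidAlgebra.induction_linear with
  | zero => simp
  | add f g hf hg => rw [map_add]; exact add_mem hf hg
  | single a b =>
    have : MonoidAlgebra.single a b = b • MonoidAlgebra.ofMagma k _ a := by simp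
    rw [this, map_smul]
    refine Submodule.smul_mem _ _ ?_
    clear this
    induction a with
    | ih1 v =>
      have e : MonoidAlgebra.ofMagma k _ (FreeMagma.of v)
          = FreeNonUnitalNonAssocAlgebra.of k v := rfl
      rw [e, FreeNonUnitalNonAssocAlgebra.lift_of_apply]
      exact GradedPreLie.gen_mem k V v
    | ih2 x y hx hy =>
      rw [map_mul (MonoidAlgebra.ofMagma k (FreeMagma V)) x y, map_mul]
      exact GradedPreLie.mul_mem_homog k V (m := 0) (n := 0) hx hy

/-- The inclusion `pL(V) = pL⁰(V) ⊆ pL(V, ∘)`, the algebra homomorphism that is the identity on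
`V`. -/
def toGraded : FreePreLie k V →ₙₐ[k] GradedPreLie k V :=
  quotLift k _ (FreeNonUnitalNonAssocAlgebra.lift k (GradedPreLie.gen k V)) (by
    intro r hr
    cases hr with
    | add v w =>
      simp only [map_sub, FreeNonUnitalNonAssocAlgebra.lift_of_apply]
      have := (quotMk_eq_zero k {r | GradedPreLieRel k V r} _).2
        (subset_idealSpan k _ (GradedPreLieRel.add v w))
      rwa [map_sub, map_sub] at this
    | smul c v =>
      simp only [map_sub, map_smul, FreeNonUnitalNonAssocAlgebra.lift_of_apply]
      have := (quotMk_eq_zero k {r | GradedPreLieRel k V r} _).2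
        (subset_idealSpan k _ (GradedPreLieRel.smul c v))
      rwa [map_sub, map_smul] at this
    | assoc x y z =>
      rw [map_sub, map_associator', map_associator',
        GradedPreLie.assoc_homog k V _ (toGraded_mem k V y) (toGraded_mem k V z)]
      simp)

theorem toGraded_gen (v : V) : toGraded k V (gen k V v) = GradedPreLie.gen k V v :=
  FreeNonUnitalNonAssocAlgebra.lift_of_apply k _ v

theorem toGraded_mem_homog (x : FreePreLie k V) : toGraded k V x ∈ GradedPreLie.homog k V 0 := by
  obtain ⟨x, rfl⟩ := quotMk_surjective k _ x
  exact toGraded_mem k V x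

/-- The product `a ⋆ b ∈ pL¹(V)` of `a ∈ pL(V)` and `b ∈ pL¹(V)`. -/
def lmul (a : FreePreLie k V) (b : GradedPreLie.homog k V 1) : GradedPreLie.homog k V 1 :=
  ⟨toGraded k V a * (b : GradedPreLie k V),
    GradedPreLie.mul_mem_homog k V (m := 0) (n := 1) (toGraded_mem_homog k V a) b.2⟩

/-- The product `a ⋆ b ∈ pL¹(V)` of `a ∈ pL¹(V)` and `b ∈ pL(V)`. -/
def rmul (a : GradedPreLie.homog k V 1) (b : FreePreLie k V) : GradedPreLie.homog k V 1 :=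
  ⟨(a : GradedPreLie k V) * toGraded k V b,
    GradedPreLie.mul_mem_homog k V (m := 1) (n := 0) a.2 (toGraded_mem_homog k V b)⟩

/-- The differential `d : pL(V) → pL¹(V)`: the restriction of the differential of `rpL(V)` to
degree `0`, with `pL(V) = rpL⁰(V)` and `pL¹(V) = rpL¹(V)`. -/
def d : FreePreLie k V →ₗ[k] GradedPreLie.homog k V 1 :=
  (ReducedPreLie.homogOneEquiv k V).symm.toLinearMap ∘ₗ
    LinearMap.codRestrict (ReducedPreLie.homog k V 1)
      (ReducedPreLie.differential k V ∘ₗ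
        (ReducedPreLie.proj k V : GradedPreLie k V →ₗ[k] ReducedPreLie k V) ∘ₗ
        (toGraded k V : FreePreLie k V →ₗ[k] GradedPreLie k V))
      (fun x => (ReducedPreLie.differential_spec k V).degree 0 _
        ⟨toGraded k V x, toGraded_mem_homog k V x, rfl⟩)

theorem proj_d (x : FreePreLie k V) :
    ReducedPreLie.proj k V (d k V x)
      = ReducedPreLie.differential k V (ReducedPreLie.proj k V (toGraded k V x)) := by
  rw [← ReducedPreLie.homogOneEquiv_apply, d, LinearMap.comp_apply, LinearEquiv.coe_coe,
    LinearEquiv.apply_symm_apply]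
  rfl

end FreePreLie

end Free
/-! ### Rooted trees -/

/-- A rooted tree with vertex set `α`, whose edges are oriented towards the root: every vertex
`x` other than the root has exactly one outgoing edge, which leads to `parent x`, and the path
that starts in any vertex arrives at the root (where, by convention, `parent` is the identity). -/
@[ext]
structure RTree (α : Type*) where
  root : α
  parent : α → α
  parent_root : parent root = root
  reach : ∀ x, ∃ m : ℕ, parent^[m] x = root

namespace RTree

variable {α β γ : Type*}

/-- The tree with one vertex. -/
def single (α : Type*) [Unique α] : RTree α :=
  ⟨default, id, rfl, fun _ => ⟨0, Subsingleton.elim _ _⟩⟩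

/-- Relabelling of the vertices. -/
def relabel (e : α ≃ β) (T : RTree α) : RTree β where
  root := e T.root
  parent x := e (T.parent (e.symm x))
  parent_root := by simp [T.parent_root]
  reach x := by
    obtain ⟨m, hm⟩ := T.reach (e.symm x)
    refine ⟨m, ?_⟩
    have h : ∀ (m : ℕ) (y : α), (fun x => e (T.parent (e.symm x)))^[m] (e y)
        = e (T.parent^[m] y) := by
      intro m
      induction m with
      | zero => intro y; rfl
      | succ m ih => intro y; simp [Function.iterate_succ_apply, ih]
    rw [← hm, ← h, Equiv.apply_symm_apply]

/-- The action of a group on trees by relabelling the vertices. -/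
instance {G : Type*} [Group G] [MulAction G α] : MulAction G (RTree α) where
  smul g T := T.relabel (MulAction.toPerm g)
  one_smul T := by
    ext x
    · exact one_smul G T.root
    · change (1 : G) • T.parent ((1 : G)⁻¹ • x) = T.parent x
      simp
  mul_smul g h T := by
    ext x
    · exact mul_smul g h T.root
    · change (g * h) • T.parent ((g * h)⁻¹ • x) = g • h • T.parent (h⁻¹ • g⁻¹ • x)
      simp [mul_smul]

theorem smul_root {G : Type*} [Group G] [MulAction G α] (g : G) (T : RTree α) :
    (g • T).root = g • T.root := rfl

theorem smul_parent {G : Type*} [Group G] [MulAction G α] (g : G) (T : RTree α) (x : α) :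
    (g • T).parent x = g • T.parent (g⁻¹ • x) := rfl

instance [Finite α] : Finite (RTree α) :=
  Finite.of_injective (fun T : RTree α => (T.root, T.parent)) (by
    intro T S h
    simp only [Prod.mk.injEq] at h
    exact RTree.ext h.1 h.2)

open Classical in
/-- Insertion of `S` at the vertex `x` of `T`: the disjoint union of `T` and `S` with one more edge,
which leads from the root of `S` to `x`. -/
def graft (T : RTree α) (S : RTree β) (x : α) : RTree (α ⊕ β) where
  root := Sum.inl T.root
  parent
    | Sum.inl a => Sum.inl (T.parent a)
    | Sum.inr b => if b = S.root then Sum.inl x else Sum.inr (S.parent b)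
  parent_root := by simp [T.parent_root]
  reach := by
    set p : α ⊕ β → α ⊕ β := fun
      | Sum.inl a => Sum.inl (T.parent a)
      | Sum.inr b => if b = S.root then Sum.inl x else Sum.inr (S.parent b) with hp
    have hl : ∀ a : α, ∃ m : ℕ, p^[m] (Sum.inl a) = Sum.inl T.root := by
      intro a
      obtain ⟨m, hm⟩ := T.reach a
      refine ⟨m, ?_⟩
      rw [← hm]
      clear hm
      induction m generalizing a with
      | zero => rfl
      | succ m ih => exact ih (T.parent a)
    have hr : ∀ (m : ℕ) (b : β), S.parent^[m] b = S.root →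
        ∃ m : ℕ, p^[m] (Sum.inr b) = Sum.inl T.root := by
      intro m
      induction m with
      | zero =>
        intro b hb
        obtain ⟨m, hm⟩ := hl x
        refine ⟨m + 1, ?_⟩
        have hb' : b = S.root := hb
        rw [Function.iterate_succ_apply, hp]
        simpa [hb'] using hm
      | succ m ih =>
        intro b hb
        by_cases h : b = S.root
        · obtain ⟨m, hm⟩ := hl x
          refine ⟨m + 1, ?_⟩
          rw [Function.iterate_succ_apply, hp]
          simpa [h] using hm
        · obtain ⟨m, hm⟩ := ih (S.parent b) hb
          refine ⟨m + 1, ?_⟩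
          rw [Function.iterate_succ_apply, hp]
          simpa [h] using hm
    rintro (a | b)
    · exact hl a
    · obtain ⟨m, hm⟩ := S.reach b
      exact hr m b hm

/-- The arity of a vertex: the number of its incoming edges. -/
def arity (T : RTree α) (x : α) : ℕ := {z | z ≠ T.root ∧ T.parent z = x}.ncard

/-! A tree with one special vertex (decorated by the dummy variable `∘`) and further vertices `α`
is a tree with vertex set `Option α`; the special vertex is `none`. A special edge, that is, an
edge adjacent to the special vertex, is given by its other endpoint. -/

/-- There is a special edge between the special vertex and `y`: either it is an incoming edge of
the special vertex, or it is the outgoing edge. -/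
def IsSpecial (S : RTree (Option α)) (y : α) : Prop :=
  S.parent (some y) = none ∨ S.parent none = some y

/-- The map on vertices that contracts the special edge with other endpoint `y`. -/
def merge (y : α) : Option α → α
  | none => y
  | some z => z

open Classical in
/-- The outgoing edges after contraction of the special edge with other endpoint `y`. The outgoing
edge of the new vertex `y` is that of the special vertex if the contracted edge leads from `y` to
the special vertex, and that of `y` otherwise. -/
def contractParent (S : RTree (Option α)) (y : α) (z : α) : α :=
  if z = y ∧ S.parent (some y) = none then merge y (S.parent none)
  else merge y (S.parent (some z))

theorem contractParent_merge (S : RTree (Option α)) (y : α) (h : S.IsSpecial y) (x : Option α) :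
    contractParent S y (merge y x) = merge y (S.parent x) ∨
      merge y (S.parent x) = merge y x := by
  classical
  cases x with
  | none =>
    by_cases h' : S.parent (some y) = none
    · left; simp [contractParent, merge, h']
    · right
      have : S.parent none = some y := h.resolve_left h'
      simp [merge, this]
  | some z =>
    by_cases hz : z = y ∧ S.parent (some y) = none
    · right
      obtain ⟨rfl, hz⟩ := hz
      simp [merge, hz]
    · left
      simp only [contractParent, merge, hz, if_false]

/-- The quotient `S / e` of a tree by the special edge `e` with other endpoint `y`: the edge is
contracted into one vertex, which keeps the label `y`. -/
def contract (S : RTree (Option α)) (y : α) (h : S.IsSpecial y) : RTree α where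
  root := merge y S.root
  parent := contractParent S y
  parent_root := by
    rcases contractParent_merge S y h S.root with h' | h'
    · rw [h', S.parent_root]
    · classical
      have hroot := S.parent_root
      cases hr : S.root with
      | none =>
        rw [hr] at hroot
        have h1 : S.parent (some y) = none := h.resolve_right (by simp [hroot])
        simp [contractParent, merge, h1, hroot]
      | some z =>
        rw [hr] at hroot
        by_cases hz : z = y ∧ S.parent (some y) = none
        · obtain ⟨rfl, hz⟩ := hz
          simp [hz] at hroot
        · simp [contractParent, merge, hz, hroot]
  reach := by
    have key : ∀ (m : ℕ) (x : Option α), S.parent^[m] x = S.root →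
        ∃ m : ℕ, (contractParent S y)^[m] (merge y x) = merge y S.root := by
      intro m
      induction m with
      | zero => intro x hx; exact ⟨0, congrArg (merge y) hx⟩
      | succ m ih =>
        intro x hx
        obtain ⟨l, hl⟩ := ih (S.parent x) hx
        rcases contractParent_merge S y h x with h' | h'
        · exact ⟨l + 1, by rw [Function.iterate_succ_apply, h', hl]⟩
        · exact ⟨l, by rw [← h', hl]⟩
    intro z
    obtain ⟨m, hm⟩ := S.reach (some z)
    exact key m (some z) hm

/-- The set `bl(T)` of blow-ups of `T`: the pairs of a tree `S` with a special vertex and a special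
edge `e` of `S`, given by its other endpoint, such that `S / e = T` and the special vertex of `S`
has arity at least `2`. -/
def blowUps (T : RTree α) : Set (RTree (Option α) × α) :=
  {p | ∃ h : p.1.IsSpecial p.2, p.1.contract p.2 h = T ∧ 2 ≤ p.1.arity none}

open Classical in
/-- The sign of a blow-up: `+1` if the special edge is an incoming edge of the special vertex, and
`-1` if it is the outgoing edge. -/
def blowUpSign (k : Type*) [Ring k] (p : RTree (Option α) × α) : k :=
  if p.1.parent (some p.2) = none then 1 else -1

section Equivariance

variable {G : Type*} [Group G] [MulAction G α]

theorem isSpecial_smul (g : G) {S : RTree (Option α)} {y : α} (h : S.IsSpecial y) :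
    (g • S).IsSpecial (g • y) := by
  rcases h with h | h
  · left
    rw [smul_parent, Option.smul_some, inv_smul_smul, h]; rfl
  · right
    rw [smul_parent, Option.smul_none, h]; rfl

theorem merge_smul (g : G) (y : α) (x : Option α) : merge (g • y) (g • x) = g • merge y x := by
  cases x <;> rfl

theorem parent_some_smul (g : G) (S : RTree (Option α)) (z : α) :
    (g • S).parent (some z) = g • S.parent (some (g⁻¹ • z)) := rfl

theorem parent_none_smul (g : G) (S : RTree (Option α)) :
    (g • S).parent none = g • S.parent none := rfl

theorem smul_eq_none (g : G) (x : Option α) : g • x = none ↔ x = none := by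
  cases x <;> simp

theorem contract_smul (g : G) (S : RTree (Option α)) (y : α) (h : S.IsSpecial y) :
    (g • S).contract (g • y) (isSpecial_smul g h) = g • S.contract y h := by
  classical
  ext z
  · exact merge_smul g y S.root
  · rw [smul_parent]
    change contractParent (g • S) (g • y) z = g • contractParent S y (g⁻¹ • z)
    simp only [contractParent, parent_some_smul, parent_none_smul, merge_smul, smul_eq_none,
      inv_smul_smul, inv_smul_eq_iff]
    split_ifs <;> rfl

theorem arity_smul (g : G) (T : RTree α) (x : α) : (g • T).arity (g • x) = T.arity x := by
  unfold arity
  have : {z | z ≠ (g • T).root ∧ (g • T).parent z = g • x}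
      = (fun z => g • z) '' {z | z ≠ T.root ∧ T.parent z = x} := by
    ext z
    constructor
    · rintro ⟨h1, h2⟩
      refine ⟨g⁻¹ • z, ⟨fun h => h1 ?_, ?_⟩, smul_inv_smul g z⟩
      · rw [smul_root, ← h, smul_inv_smul]
      · exact smul_left_cancel g h2
    · rintro ⟨w, ⟨h1, h2⟩, rfl⟩
      refine ⟨fun h => h1 (smul_left_cancel g h), ?_⟩
      change g • T.parent (g⁻¹ • g • w) = g • x
      rw [inv_smul_smul, h2]
  rw [this, Set.ncard_image_of_injective _ (MulAction.injective g)]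

theorem smul_mem_blowUps (g : G) {T : RTree α} {p : RTree (Option α) × α} (hp : p ∈ T.blowUps) :
    g • p ∈ (g • T).blowUps := by
  obtain ⟨h, h1, h2⟩ := hp
  refine ⟨isSpecial_smul g h, ?_, ?_⟩
  · rw [← h1]; exact contract_smul g p.1 p.2 h
  · exact h2.trans (arity_smul g p.1 none).ge

theorem smul_mem_blowUps_iff (g : G) {T : RTree α} {p : RTree (Option α) × α} :
    g • p ∈ (g • T).blowUps ↔ p ∈ T.blowUps :=
  ⟨fun h => by simpa using smul_mem_blowUps g⁻¹ h, smul_mem_blowUps g⟩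

theorem blowUpSign_smul (k : Type*) [Ring k] (g : G) (p : RTree (Option α) × α) :
    blowUpSign k (g • p) = blowUpSign k p := by
  classical
  simp only [blowUpSign, Prod.smul_fst, Prod.smul_snd, parent_some_smul, inv_smul_smul,
    smul_eq_none]

end Equivariance

/-- The signed sum of the blow-ups of a tree `T` with numbered vertices. -/
def blowUpSum (k : Type*) [Ring k] [Finite α] (T : RTree α) : MonoidAlgebra k (RTree (Option α)) :=
  ∑ p ∈ (Set.toFinite T.blowUps).toFinset, MonoidAlgebra.single p.1 (blowUpSign k p)

end RTree

/-! ### Spaces of decorated trees -/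

section Decorated

variable (k : Type*) (V : Type*) [Field k] [AddCommGroup V] [Module k V]

/-- The representation of the symmetric group on the `n`-th tensor power of `V` that permutes the
factors. -/
def permTensor (n : ℕ) : Representation k (Equiv.Perm (Fin n)) (⨂[k] _ : Fin n, V) where
  toFun σ := (PiTensorProduct.reindex k (fun _ : Fin n => V) σ).toLinearMap
  map_one' := by
    ext v
    simp
    rfl
  map_mul' σ τ := by
    ext v
    simp [PiTensorProduct.reindex_tprod]
    rfl

/-- The diagonal representation of the symmetric group on `Span(X) ⊗ V ⊗ ⋯ ⊗ V` (with
`n` factors `V`). -/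
def decRep (n : ℕ) (X : Type*) [MulAction (Equiv.Perm (Fin n)) X] :
    Representation k (Equiv.Perm (Fin n)) (MonoidAlgebra k X ⊗[k] (⨂[k] _ : Fin n, V)) :=
  (Representation.ofMulAction k (Equiv.Perm (Fin n)) X).tprod (permTensor k V n)

/-- The space `Span(X) ⊗_{Σₙ} (V ⊗ ⋯ ⊗ V)` of coinvariants of the symmetric group. -/
abbrev Decorated (n : ℕ) (X : Type*) [MulAction (Equiv.Perm (Fin n)) X] : Type _ :=
  (decRep k V n X).Coinvariants

/-- The element of `X` decorated by the vectors `v 0, …, v (n - 1)`. -/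
def Decorated.mk (n : ℕ) {X : Type*} [MulAction (Equiv.Perm (Fin n)) X] (x : X) (v : Fin n → V) :
    Decorated k V n X :=
  Representation.Coinvariants.mk (decRep k V n X)
    (MonoidAlgebra.single x 1 ⊗ₜ[k] PiTensorProduct.tprod k v)

/-- The space `Tr(V) = ⨁ₙ Trₙ(V)` of trees with vertices decorated by elements of `V`. The summand
`n = 0` is zero, as there is no tree without vertices. -/
abbrev Tr : Type _ := ⨁ n : ℕ, Decorated k V n (RTree (Fin n))

/-- The space `Tr¹(V) = ⨁ₙ Tr¹ₙ(V)` of trees with one special vertex, decorated by the dummy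
variable, and `n` further vertices decorated by elements of `V`. -/
abbrev TrOne : Type _ := ⨁ n : ℕ, Decorated k V n (RTree (Option (Fin n)))

variable {V} in
/-- The tree `T` with the vertex `i` decorated by `v i`. -/
def Tr.mk {n : ℕ} (T : RTree (Fin n)) (v : Fin n → V) : Tr k V :=
  DirectSum.lof k ℕ (fun n => Decorated k V n (RTree (Fin n))) n (Decorated.mk k V n T v)

variable {V} in
/-- The tree `T` with the vertex `some i` decorated by `v i` and the special vertex `none`. -/
def TrOne.mk {n : ℕ} (T : RTree (Option (Fin n))) (v : Fin n → V) : TrOne k V :=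
  DirectSum.lof k ℕ (fun n => Decorated k V n (RTree (Option (Fin n)))) n (Decorated.mk k V n T v)

/-- The map `T ↦ ∑ ε S`, with the sum over the blow-ups `(S, e)` of `T`, on trees with numbered
vertices. -/
def blowUpLin (n : ℕ) :
    MonoidAlgebra k (RTree (Fin n)) →ₗ[k] MonoidAlgebra k (RTree (Option (Fin n))) :=
  Finsupp.linearCombination k (RTree.blowUpSum k) ∘ₗ (MonoidAlgebra.coeffLinearEquiv k).toLinearMap

theorem blowUpLin_single (n : ℕ) (T : RTree (Fin n)) :
    blowUpLin k n (MonoidAlgebra.single T 1) = RTree.blowUpSum k T := by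
  simp [blowUpLin]

theorem blowUpSum_smul (n : ℕ) (σ : Equiv.Perm (Fin n)) (T : RTree (Fin n)) :
    RTree.blowUpSum k (σ • T) =
      Representation.ofMulAction k (Equiv.Perm (Fin n)) (RTree (Option (Fin n))) σ
        (RTree.blowUpSum k T) := by
  simp only [RTree.blowUpSum, map_sum, Representation.ofMulAction_single]
  symm
  refine Finset.sum_bij (fun p _ => σ • p) ?_ ?_ ?_ ?_
  · intro p hp
    simpa [RTree.smul_mem_blowUps_iff] using hp
  · intro p _ q _ h
    exact smul_left_cancel σ h
  · intro p hp
    refine ⟨σ⁻¹ • p, ?_, smul_inv_smul σ p⟩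
    rw [Set.Finite.mem_toFinset] at hp ⊢
    rw [← RTree.smul_mem_blowUps_iff σ, smul_inv_smul]
    exact hp
  · intro p _
    rw [RTree.blowUpSign_smul]
    rfl

theorem blowUpLin_equivariant (n : ℕ) (σ : Equiv.Perm (Fin n)) :
    blowUpLin k n ∘ₗ Representation.ofMulAction k (Equiv.Perm (Fin n)) (RTree (Fin n)) σ =
      Representation.ofMulAction k (Equiv.Perm (Fin n)) (RTree (Option (Fin n))) σ
        ∘ₗ blowUpLin k n := by
  ext T : 2
  simp [blowUpLin_single, blowUpSum_smul]

/-- The component `Trₙ(V) → Tr¹ₙ(V)` of the blow-up map. -/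
def deltaAux (n : ℕ) :
    Decorated k V n (RTree (Fin n)) →ₗ[k] Decorated k V n (RTree (Option (Fin n))) :=
  Representation.Coinvariants.lift _
    (Representation.Coinvariants.mk (decRep k V n (RTree (Option (Fin n)))) ∘ₗ
      TensorProduct.map (blowUpLin k n) LinearMap.id)
    (by
      intro σ
      have h : TensorProduct.map (blowUpLin k n) LinearMap.id ∘ₗ decRep k V n (RTree (Fin n)) σ =
          decRep k V n (RTree (Option (Fin n))) σ ∘ₗ
            TensorProduct.map (blowUpLin k n) LinearMap.id := by
        change TensorProduct.map _ _ ∘ₗ TensorProduct.map _ _ =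
          TensorProduct.map _ _ ∘ₗ TensorProduct.map _ _
        rw [← TensorProduct.map_comp, ← TensorProduct.map_comp, blowUpLin_equivariant]
        rfl
      rw [LinearMap.comp_assoc, h]
      ext x
      simp)

/-- The blow-up map `δ : Tr(V) → Tr¹(V)`, `δ(T) = ∑ ε S`, with the sum over the blow-ups `(S, e)`
of `T`. -/
def delta : Tr k V →ₗ[k] TrOne k V := DirectSum.lmap (deltaAux k V)

theorem delta_mk {n : ℕ} (T : RTree (Fin n)) (v : Fin n → V) :
    delta k V (Tr.mk k T v) = ∑ p ∈ (Set.toFinite T.blowUps).toFinset,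
      RTree.blowUpSign k p • TrOne.mk k p.1 v := by
  have h : deltaAux k V n (Decorated.mk k V n T v) =
      ∑ p ∈ (Set.toFinite T.blowUps).toFinset,
        RTree.blowUpSign k p • Decorated.mk k V n p.1 v := by
    change Representation.Coinvariants.mk (decRep k V n (RTree (Option (Fin n))))
      (TensorProduct.map (blowUpLin k n) LinearMap.id
        (MonoidAlgebra.single T 1 ⊗ₜ[k] PiTensorProduct.tprod k v)) = _
    rw [TensorProduct.map_tmul, blowUpLin_single, RTree.blowUpSum, TensorProduct.sum_tmul, map_sum]
    refine Finset.sum_congr rfl fun p _ => ?_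
    rw [Decorated.mk, ← map_smul, TensorProduct.smul_tmul', MonoidAlgebra.smul_single, smul_eq_mul,
      mul_one]
    rfl
  simp only [delta, Tr.mk, TrOne.mk, ← map_smul, ← map_sum]
  rw [← h]
  exact DirectSum.lmap_lof _ _ _

/-! ### The Chapoton–Livernet isomorphisms -/

/-- If the vertices `α` of one tree and `β` of another are numbered by `γ` together, then so are
those of two trees the first of which has a special vertex besides. -/
def optionSumLeft {α β γ : Type*} (e : α ⊕ β ≃ γ) : Option α ⊕ β ≃ Option γ where
  toFun
    | Sum.inl none => none
    | Sum.inl (some a) => some (e (Sum.inl a))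
    | Sum.inr b => some (e (Sum.inr b))
  invFun
    | none => Sum.inl none
    | some c => Sum.elim (fun a => Sum.inl (some a)) Sum.inr (e.symm c)
  left_inv := by rintro ((_ | a) | b) <;> simp
  right_inv := by
    rintro (_ | c)
    · rfl
    · obtain ⟨x, rfl⟩ := e.surjective c
      rcases x with a | b <;> simp

/-- The same if the second tree has a special vertex. -/
def optionSumRight {α β γ : Type*} (e : α ⊕ β ≃ γ) : α ⊕ Option β ≃ Option γ where
  toFun
    | Sum.inl a => some (e (Sum.inl a))
    | Sum.inr none => none
    | Sum.inr (some b) => some (e (Sum.inr b))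
  invFun
    | none => Sum.inr none
    | some c => Sum.elim Sum.inl (fun b => Sum.inr (some b)) (e.symm c)
  left_inv := by rintro (a | (_ | b)) <;> simp
  right_inv := by
    rintro (_ | c)
    · rfl
    · obtain ⟨x, rfl⟩ := e.surjective c
      rcases x with a | b <;> simp

variable {k V}

/-- `e` is the Chapoton–Livernet isomorphism `pL(V) ≅ Tr(V)`: it takes a generator `v` to the
one-vertex tree decorated by `v`, and the pre-Lie product to the insertion of decorated trees,
`T ⋆ S = ∑ (S inserted at x)`, with the sum over the vertices `x` of `T`. -/
structure IsChapotonLivernet (e : FreePreLie k V ≃ₗ[k] Tr k V) : Prop where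
  gen : ∀ v : V, e (FreePreLie.gen k V v) = Tr.mk k (RTree.single (Fin 1)) fun _ => v
  mul : ∀ (m n : ℕ) (T : RTree (Fin m)) (t : Fin m → V) (S : RTree (Fin n)) (s : Fin n → V)
    (a b : FreePreLie k V), e a = Tr.mk k T t → e b = Tr.mk k S s →
      e (a * b) = ∑ x : Fin m, Tr.mk k ((T.graft S x).relabel finSumFinEquiv) (Fin.append t s)

/-- `e₁` is the Chapoton–Livernet isomorphism `pL¹(V) ≅ Tr¹(V)`, where `e` is the isomorphism
`pL(V) ≅ Tr(V)`: it takes the dummy variable `∘` to the tree with the special vertex only, and the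
products of elements of `pL(V)` and `pL¹(V)`, in both orders, to the insertion of decorated
trees. -/
structure IsChapotonLivernetOne (e : FreePreLie k V ≃ₗ[k] Tr k V)
    (e₁ : GradedPreLie.homog k V 1 ≃ₗ[k] TrOne k V) : Prop where
  dummy : e₁ ⟨GradedPreLie.dummy k V, GradedPreLie.dummy_mem k V⟩
    = TrOne.mk k (RTree.single (Option (Fin 0))) Fin.elim0
  mul_left : ∀ (m n : ℕ) (T : RTree (Fin m)) (t : Fin m → V) (S : RTree (Option (Fin n)))
    (s : Fin n → V) (a : FreePreLie k V) (b : GradedPreLie.homog k V 1),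
      e a = Tr.mk k T t → e₁ b = TrOne.mk k S s →
      e₁ (FreePreLie.lmul k V a b)
        = ∑ x : Fin m, TrOne.mk k ((T.graft S x).relabel (optionSumRight finSumFinEquiv))
            (Fin.append t s)
  mul_right : ∀ (m n : ℕ) (T : RTree (Option (Fin m))) (t : Fin m → V) (S : RTree (Fin n))
    (s : Fin n → V) (a : GradedPreLie.homog k V 1) (b : FreePreLie k V),
      e₁ a = TrOne.mk k T t → e b = Tr.mk k S s →
      e₁ (FreePreLie.rmul k V a b)
        = ∑ x : Option (Fin m), TrOne.mk k
            ((T.graft S x).relabel (optionSumLeft finSumFinEquiv)) (Fin.append t s)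

end Decorated

end PreLieTrees

end

open scoped TensorProduct DirectSum

noncomputable section

namespace PreLieTrees

open Function

/-! ### Symmetric braces in a pre-Lie ring -/

section Brace

/-! Trees over `V` are evaluated in an arbitrary right pre-Lie algebra `A`: the value at a vertex is
the symmetric brace of its decoration with the values at its children. The braces of Oudom and Guin
are obtained by solving `a{x₁,…,xₙ} ⋆ y = a{x₁,…,xₙ,y} + ∑ᵢ a{x₁,…,xᵢ ⋆ y,…,xₙ}` for the longest
brace; the pre-Lie identity makes the result independent of the order of the arguments
(`braceStep_comm`, `braceAux_erase`). Read the other way, the same formula says that evaluation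
turns insertion into the product (`sum_val_graft`, `RTree.ev_mul_ev`).

Degree zero. Decorated trees with insertion form a pre-Lie algebra `TrAlg`, since the associator of
`T`, `S`, `U` sums the ways to insert `S` and `U` separately into `T`. Evaluation in `pL(V)` gives
`treeToFree`. It is onto because its range contains the generators and is closed under products. It
is injective because the homomorphism `pL(V) → TrAlg` that extends the generators undoes it: in
`TrAlg` a tree of one-vertex trees evaluates to itself (`TrAlg.ev_gen`).

Degree one. `pL¹(V)` is a `pL(V)`-bimodule generated by `∘`, so a tree with a special vertex can be
evaluated in the square-zero extension of `pL(V)` by `pL¹(V)`, with `(0, ∘)` at the special vertex.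
This map `treeToFreeOne` is onto by generation. For injectivity, `pL(V, ∘)` is sent to the dual
numbers over trees decorated by `V × k`, with `v ↦ (v, 0)` and `∘ ↦ ε (0, 1)`; the coefficient of
`ε` returns the tree, and the vertex decorated by `(0, 1)` is marked as special
(`gradedToDual_evOne`, `markVertex_decPair`).

The square. A blow-up of `T` amounts to a vertex `y`, a direction of the edge and a set `A` of
children of `y` moved to the special vertex, with `|A| ≥ 1` for the incoming edge and `|A| ≥ 2` for
the outgoing one (`sum_blowUps`). In a tree `T ←ₓ S` the blow-ups at vertices other than `x`, and
those at `x` that leave the root of `S` at `x`, come from blow-ups of `T` or of `S`. If the root of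
`S` is moved, the bounds on the remaining moved children drop by one; the surplus terms insert the
special vertex just below some vertex `z` of `T`, and they telescope over `T` to the term with `z`
the root. That term is `Φ(∘, T, S)`. Hence `δ` satisfies the twisted Leibniz rule (`sum_blow_graft`,
`delta_mul`); it vanishes on one-vertex trees, as `d` does on `V`, so both agree. -/

open Classical in
/-- Symmetric braces with fuel: `braceAux a n s f` is the symmetric brace of `a` with the elements
`f i`, `i ∈ s`, if `s` has `n` elements. -/
def braceAux {A ι : Type*} [NonUnitalNonAssocRing A] (a : A) : ℕ → Finset ι → (ι → A) → A
  | 0, _, _ => a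
  | n + 1, s, f =>
    -- The element split off is an arbitrary choice; in a pre-Lie ring `braceAux_erase` removes the
    -- dependence on it.
    if h : s.Nonempty then
      braceAux a n (s.erase h.choose) f * f h.choose
        - ∑ i ∈ s.erase h.choose,
            braceAux a n (s.erase h.choose) (Function.update f i (f i * f h.choose))
    else a

/-- The symmetric brace `a {f i | i ∈ s}` of Oudom and Guin in a right pre-Lie ring. -/
def brace {A ι : Type*} [NonUnitalNonAssocRing A] (a : A) (s : Finset ι) (f : ι → A) : A :=
  braceAux a s.card s f

variable {A ι : Type*}

section NonAssoc

variable [NonUnitalNonAssocRing A]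

theorem braceAux_congr (a : A) (n : ℕ) {s : Finset ι} {f g : ι → A} (h : ∀ i ∈ s, f i = g i) :
    braceAux a n s f = braceAux a n s g := by
  classical
  induction n generalizing s f g with
  | zero => rfl
  | succ n ih =>
    simp only [braceAux]
    split_ifs with hs
    · have hj := hs.choose_spec
      rw [h _ hj, ih fun i hi => h i (Finset.mem_of_mem_erase hi)]
      congr 1
      refine Finset.sum_congr rfl fun i hi => ih fun l hl => ?_
      by_cases hli : l = i
      · subst hli; simp [h l (Finset.mem_of_mem_erase hl)]
      · simp [hli, h l (Finset.mem_of_mem_erase hl)]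
    · rfl

-- Needed before independence of the order: there, two products that occupy the same slot must be
-- merged into one sum. The fuel has to equal the cardinality, since an exhausted recursion returns
-- `a`, which is not additive in `f i`.
open Classical in
theorem braceAux_add (a : A) {n : ℕ} {s : Finset ι} (hn : s.card = n) (f : ι → A) {i : ι}
    (hi : i ∈ s) (x y : A) :
    braceAux a n s (update f i (x + y))
      = braceAux a n s (update f i x) + braceAux a n s (update f i y) := by
  induction n generalizing s f i x y with
  | zero => simp_all
  | succ n ih =>
    have hs : s.Nonempty := ⟨i, hi⟩
    simp only [braceAux, dif_pos hs]
    generalize hs.choose = j, hs.choose_spec = hj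
    have hc : (s.erase j).card = n := by rw [Finset.card_erase_of_mem hj, hn]; rfl
    by_cases hij : j = i
    · subst hij
      have e : ∀ z, braceAux a n (s.erase j) (update f j z) = braceAux a n (s.erase j) f :=
        fun z => braceAux_congr a n fun l hl => by simp [Finset.ne_of_mem_erase hl]
      have e' : ∀ l ∈ s.erase j, ∀ z w, braceAux a n (s.erase j) (update (update f j z) l w)
          = braceAux a n (s.erase j) (update f l w) := fun l hl z w =>
        braceAux_congr a n fun m hm => by
          rw [update_comm (Finset.ne_of_mem_erase hl).symm]
          simp [Finset.ne_of_mem_erase hm]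
      simp only [e, update_self, mul_add]
      rw [sub_add_sub_comm, ← Finset.sum_add_distrib]
      congr 1
      refine Finset.sum_congr rfl fun l hl => ?_
      rw [e' l hl, e' l hl, e' l hl, update_of_ne (Finset.ne_of_mem_erase hl),
        update_of_ne (Finset.ne_of_mem_erase hl), update_of_ne (Finset.ne_of_mem_erase hl),
        ih hc _ hl]
    · have hi' : i ∈ s.erase j := Finset.mem_erase.2 ⟨Ne.symm hij, hi⟩
      simp only [update_of_ne hij]
      rw [ih hc _ hi', add_mul, sub_add_sub_comm, ← Finset.sum_add_distrib]
      congr 1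
      refine Finset.sum_congr rfl fun l hl => ?_
      by_cases hli : l = i
      · subst hli
        simp only [update_self, update_idem, add_mul]
        exact ih hc _ hi' _ _
      · simp only [update_of_ne hli]
        rw [update_comm (Ne.symm hli), update_comm (Ne.symm hli), update_comm (Ne.symm hli)]
        exact ih hc _ hi' _ _

open Classical in
/-- The recursion formula for symmetric braces, solved for the brace of the family indexed by
`s`. -/
def braceStep (B : Finset ι → (ι → A) → A) (j : ι) (s : Finset ι) (f : ι → A) : A :=
  B s f * f j - ∑ i ∈ s, B s (update f i (f i * f j))

end NonAssoc

variable [RightPreLieRing A]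

/-- The pre-Lie identity without subtraction, so that both sides can stand in one slot of a brace
that is only known to be additive there. -/
theorem mul_mul_add_comm (x y z : A) :
    x * (y * z) + (x * z) * y = x * (z * y) + (x * y) * z := by
  have := RightPreLieRing.assoc_symm' x y z
  simp only [associator] at this
  rw [sub_eq_sub_iff_add_eq_add] at this
  rw [add_comm, ← this, add_comm]

-- Two elements `j`, `j'` are split off in either order. Both expansions consist of the same four
-- kinds of terms: an associator with `f j`, `f j'` in the last two places, symmetric by the pre-Lie
-- identity; terms with one changed slot times `f j` or `f j'`, visibly symmetric; terms with one
-- slot changed twice, symmetric by `mul_mul_add_comm`; and terms with two changed slots, symmetric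
-- after exchange of the summations.
open Classical in
theorem braceStep_comm (C D : Finset ι → (ι → A) → A) {t : Finset ι} {j j' : ι} (hj : j ∉ t)
    (hj' : j' ∉ t) (hjj : j ≠ j') (f : ι → A)
    (hC : ∀ f g : ι → A, (∀ i ∈ t, f i = g i) → C t f = C t g)
    (hadd : ∀ (f : ι → A), ∀ i ∈ t, ∀ x y,
      C t (update f i (x + y)) = C t (update f i x) + C t (update f i y))
    (hD : ∀ f, D (insert j t) f = braceStep C j t f)
    (hD' : ∀ f, D (insert j' t) f = braceStep C j' t f) :
    braceStep D j (insert j' t) f = braceStep D j' (insert j t) f := by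
  have key : ∀ j j' : ι, j ∉ t → j' ∉ t → j ≠ j' →
      (∀ f, D (insert j' t) f = braceStep C j' t f) →
      braceStep D j (insert j' t) f =
        associator (C t f) (f j') (f j)
        - (∑ i ∈ t, C t (update f i (f i * f j')) * f j
          + ∑ i ∈ t, C t (update f i (f i * f j)) * f j')
        + ∑ i ∈ t, C t (update f i (f i * (f j' * f j) + (f i * f j) * f j'))
        + ∑ i ∈ t, ∑ l ∈ t.erase i,
          C t (update (update f i (f i * f j)) l (f l * f j')) := by
    intro j j' hj hj' hjj hD'
    rw [braceStep, Finset.sum_insert hj', hD', hD']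
    have e1 : braceStep C j' t (update f j' (f j' * f j)) =
        C t f * (f j' * f j) - ∑ i ∈ t, C t (update f i (f i * (f j' * f j))) := by
      rw [braceStep, update_self, hC (update f j' (f j' * f j)) f
        fun i hi => update_of_ne (ne_of_mem_of_not_mem hi hj') _ _]
      congr 1
      refine Finset.sum_congr rfl fun i hi => hC _ _ fun l hl => ?_
      have hne : ∀ l ∈ t, l ≠ j' := fun l hl h => hj' (h ▸ hl)
      rw [update_comm (hne i hi).symm, update_of_ne (hne l hl), update_of_ne (hne i hi)]
    have e2 : ∀ i ∈ t, D (insert j' t) (update f i (f i * f j)) =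
        C t (update f i (f i * f j)) * f j' - (C t (update f i ((f i * f j) * f j'))
          + ∑ l ∈ t.erase i, C t (update (update f i (f i * f j)) l (f l * f j'))) := by
      intro i hi
      have hne : j' ≠ i := fun h => hj' (h ▸ hi)
      rw [hD', braceStep, update_of_ne hne]
      congr 1
      rw [← Finset.add_sum_erase _ _ hi]
      congr 1
      · simp
      · refine Finset.sum_congr rfl fun l hl => ?_
        rw [update_of_ne (Finset.ne_of_mem_erase hl)]
    rw [e1, Finset.sum_congr rfl e2, Finset.sum_congr rfl fun i hi => hadd f i hi _ _]
    simp only [braceStep, associator, sub_mul, Finset.sum_mul, Finset.sum_add_distrib,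
      Finset.sum_sub_distrib]
    abel
  rw [key j j' hj hj' hjj hD', key j' j hj' hj hjj.symm hD]
  have e3 : ∑ i ∈ t, ∑ l ∈ t.erase i, C t (update (update f i (f i * f j)) l (f l * f j')) =
      ∑ i ∈ t, ∑ l ∈ t.erase i, C t (update (update f i (f i * f j')) l (f l * f j)) := by
    rw [Finset.sum_comm' (t' := t) (s' := fun l => t.erase l)]
    · refine Finset.sum_congr rfl fun l _ => Finset.sum_congr rfl fun i hi => ?_
      rw [update_comm (Finset.ne_of_mem_erase hi)]
    · intro x y
      simp only [Finset.mem_erase]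
      tauto
  rw [e3, RightPreLieRing.assoc_symm']
  simp only [mul_mul_add_comm (f _) (f j') (f j)]
  abel

-- Any element may be split off in place of the chosen one. By induction on the fuel, both orders of
-- removing the chosen element and the given one can be expanded to the common remainder, where
-- `braceStep_comm` compares them.
open Classical in
theorem braceAux_erase (a : A) (n : ℕ) {s : Finset ι} (hn : s.card = n + 1) {j : ι} (hj : j ∈ s)
    (f : ι → A) : braceAux a (n + 1) s f = braceStep (braceAux a n) j (s.erase j) f := by
  induction n generalizing s j f with
  | zero =>
    obtain ⟨i, rfl⟩ := Finset.card_eq_one.1 hn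
    obtain rfl := Finset.mem_singleton.1 hj
    simp only [braceAux, Finset.singleton_nonempty, dif_pos]
    generalize_proofs h
    have := Finset.mem_singleton.1 h.choose_spec
    rw [this]; rfl
  | succ n ih =>
    have hs : s.Nonempty := ⟨j, hj⟩
    have h1 : braceAux a (n + 1 + 1) s f
        = braceStep (braceAux a (n + 1)) hs.choose (s.erase hs.choose) f := by
      rw [braceAux, dif_pos hs]; rfl
    rw [h1]
    generalize hs.choose = j', hs.choose_spec = hj'
    by_cases hjj : j' = j
    · rw [hjj]
    set t := (s.erase j).erase j' with ht
    have ht1 : s.erase j = insert j' t := (Finset.insert_erase (by simp [hjj, hj'])).symm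
    have ht2 : s.erase j' = insert j t := by
      rw [ht, Finset.erase_right_comm]
      exact (Finset.insert_erase (by simp [Ne.symm hjj, hj])).symm
    have hjt : j ∉ t := by simp [ht]
    have hjt' : j' ∉ t := by simp [ht]
    have hc : t.card = n := by
      have := Finset.card_erase_of_mem hj
      rw [ht1, Finset.card_insert_of_notMem hjt', hn] at this
      simpa using this
    rw [ht1, ht2]
    refine braceStep_comm (braceAux a n) _ hjt' hjt hjj f (fun f g h => braceAux_congr a n h)
      (fun f i hi x y => braceAux_add a hc f hi x y) ?_ ?_
    · intro f
      rw [ih (by rw [Finset.card_insert_of_notMem hjt', hc]) (Finset.mem_insert_self j' t),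
        Finset.erase_insert hjt']
    · intro f
      rw [ih (by rw [Finset.card_insert_of_notMem hjt, hc]) (Finset.mem_insert_self j t),
        Finset.erase_insert hjt]

theorem brace_congr (a : A) {s : Finset ι} {f g : ι → A} (h : ∀ i ∈ s, f i = g i) :
    brace a s f = brace a s g := braceAux_congr a _ h

@[simp]
theorem brace_empty (a : A) (f : ι → A) : brace a ∅ f = a := rfl

open Classical in
theorem brace_insert (a : A) {s : Finset ι} {j : ι} (hj : j ∉ s) (f : ι → A) :
    brace a (insert j s) f = brace a s f * f j - ∑ i ∈ s, brace a s (update f i (f i * f j)) := by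
  rw [brace, Finset.card_insert_of_notMem hj, braceAux_erase a _
    (Finset.card_insert_of_notMem hj) (Finset.mem_insert_self j s), Finset.erase_insert hj]
  rfl

open Classical in
theorem brace_update_add (a : A) {s : Finset ι} (f : ι → A) {i : ι} (hi : i ∈ s) (x y : A) :
    brace a s (update f i (x + y)) = brace a s (update f i x) + brace a s (update f i y) :=
  braceAux_add a rfl f hi x y

/-- Symmetric braces are additive in each argument. -/
theorem brace_add_right (a : A) {s : Finset ι} {f g h : ι → A} {i : ι} (hi : i ∈ s)
    (hf : f i = g i + h i) (hg : ∀ j ∈ s, j ≠ i → f j = g j) (hh : ∀ j ∈ s, j ≠ i → f j = h j) :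
    brace a s f = brace a s g + brace a s h := by
  classical
  have e := brace_update_add a f hi (g i) (h i)
  rw [← hf, update_eq_self] at e
  rw [e]
  congr 1
  · refine brace_congr a fun j hj => ?_
    by_cases hji : j = i
    · subst hji; simp
    · simp [hji, hg j hj hji]
  · refine brace_congr a fun j hj => ?_
    by_cases hji : j = i
    · subst hji; simp
    · simp [hji, hh j hj hji]

theorem brace_add_left (a b : A) (s : Finset ι) (f : ι → A) :
    brace (a + b) s f = brace a s f + brace b s f := by
  classical
  induction s using Finset.induction_on generalizing f with
  | empty => simp
  | insert j s hj ih =>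
    simp only [brace_insert _ hj, ih, add_mul, Finset.sum_add_distrib]
    abel

theorem brace_smul_left {k : Type*} [CommRing k] [Module k A] [IsScalarTower k A A] (c : k) (a : A)
    (s : Finset ι) (f : ι → A) : brace (c • a) s f = c • brace a s f := by
  classical
  induction s using Finset.induction_on generalizing f with
  | empty => simp
  | insert j s hj ih =>
    simp only [brace_insert _ hj, ih, smul_mul_assoc, smul_sub, Finset.smul_sum]

open Classical in
theorem brace_update_smul {k : Type*} [CommRing k] [Module k A] [IsScalarTower k A A]
    [SMulCommClass k A A] (a : A) {s : Finset ι} (f : ι → A) {i : ι} (hi : i ∈ s) (c : k) (x : A) :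
    brace a s (update f i (c • x)) = c • brace a s (update f i x) := by
  -- The slot `i` itself is split off. The scalar then appears as a factor on the right, or inside
  -- another slot `l` of a brace over the smaller set `s.erase i`.
  induction s using Finset.strongInduction generalizing f i x with
  | H s ih =>
    rw [← Finset.insert_erase hi]
    have hi' := Finset.notMem_erase i s
    have e : ∀ z, brace a (s.erase i) (update f i z) = brace a (s.erase i) f :=
      fun z => brace_congr a fun l hl => by simp [Finset.ne_of_mem_erase hl]
    have e' : ∀ l ∈ s.erase i, ∀ z w, brace a (s.erase i) (update (update f i z) l w)
        = brace a (s.erase i) (update f l w) := fun l hl z w =>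
      brace_congr a fun m hm => by
        rw [update_comm (Finset.ne_of_mem_erase hl).symm]
        simp [Finset.ne_of_mem_erase hm]
    rw [brace_insert _ hi', brace_insert _ hi', e, e, update_self, update_self, mul_smul_comm,
      smul_sub, Finset.smul_sum]
    congr 1
    refine Finset.sum_congr rfl fun l hl => ?_
    rw [e' l hl, e' l hl, update_of_ne (Finset.ne_of_mem_erase hl),
      update_of_ne (Finset.ne_of_mem_erase hl), mul_smul_comm,
      ih _ (Finset.erase_ssubset hi) f hl]

/-- Symmetric braces are homogeneous in each argument. -/
theorem brace_smul_right {k : Type*} [CommRing k] [Module k A] [IsScalarTower k A A]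
    [SMulCommClass k A A] (a : A) {s : Finset ι} {f g : ι → A} {i : ι} (hi : i ∈ s) (c : k)
    (hf : f i = c • g i) (hg : ∀ j ∈ s, j ≠ i → f j = g j) :
    brace a s f = c • brace a s g := by
  classical
  have e := brace_update_smul a f hi c (g i)
  rw [← hf, update_eq_self] at e
  rw [e]
  congr 1
  refine brace_congr a fun j hj => ?_
  by_cases hji : j = i
  · subst hji; simp
  · simp [hji, hg j hj hji]

theorem brace_map {κ : Type*} (a : A) (e : ι ↪ κ) (s : Finset ι) (f : κ → A) :
    brace a (s.map e) f = brace a s (f ∘ e) := by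
  classical
  induction s using Finset.induction_on generalizing f with
  | empty => simp
  | insert j s hj ih =>
    rw [Finset.map_insert, brace_insert _ (by simpa using hj), brace_insert _ hj, ih,
      Finset.sum_map]
    simp only [ih]
    congr 1
    refine Finset.sum_congr rfl fun i _ => ?_
    rw [update_comp_eq_of_injective _ e.injective]
    rfl

theorem map_brace {B F : Type*} [RightPreLieRing B] [FunLike F A B] [NonUnitalRingHomClass F A B]
    (φ : F) (a : A) (s : Finset ι) (f : ι → A) :
    φ (brace a s f) = brace (φ a) s (φ ∘ f) := by
  classical
  induction s using Finset.induction_on generalizing f with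
  | empty => simp
  | insert j s hj ih =>
    simp only [brace_insert _ hj, map_sub, map_mul, map_sum, ih, comp_update, comp_apply]

/-- The recursion formula for symmetric braces, solved for the product. -/
theorem brace_mul [DecidableEq ι] (a : A) {s : Finset ι} {j : ι} (hj : j ∉ s) (f : ι → A) :
    brace a s f * f j = brace a (insert j s) f + ∑ i ∈ s, brace a s (update f i (f i * f j)) := by
  have h := brace_insert a hj f
  rw [eq_sub_iff_add_eq] at h
  convert h.symm

end Brace

section BraceSum

variable {A ι : Type*} [RightPreLieRing A]

theorem brace_update_sum [DecidableEq ι] {κ : Type*} (a : A) {s : Finset ι} (f : ι → A) {i : ι} (hi : i ∈ s)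
    (t : Finset κ) (g : κ → A) :
    brace a s (update f i (∑ x ∈ t, g x)) = ∑ x ∈ t, brace a s (update f i (g x)) :=
  map_sum (AddMonoidHom.mk' (fun z => brace a s (update f i z)) (fun x y => by
    convert brace_update_add a f hi x y)) g t

end BraceSum

namespace RTree

/-! ### Children, ancestors and depth in rooted trees -/

section Anc

variable {α : Type*}

/-- `a` lies on the path from `x` to the root. -/
def Anc (T : RTree α) (a x : α) : Prop := ∃ m : ℕ, T.parent^[m] x = a

theorem Anc.refl (T : RTree α) (a : α) : T.Anc a a := ⟨0, rfl⟩

theorem anc_root (T : RTree α) (x : α) : T.Anc T.root x := T.reach x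

theorem Anc.trans {T : RTree α} {a b c : α} (h : T.Anc a b) (h' : T.Anc b c) : T.Anc a c := by
  obtain ⟨m, rfl⟩ := h
  obtain ⟨n, rfl⟩ := h'
  exact ⟨m + n, iterate_add_apply _ _ _ _⟩

theorem anc_parent (T : RTree α) (x : α) : T.Anc (T.parent x) x := ⟨1, rfl⟩

open Classical in
/-- The distance of a vertex from the root. -/
def depth (T : RTree α) (x : α) : ℕ := Nat.find (T.reach x)

theorem depth_parent (T : RTree α) {x : α} (hx : x ≠ T.root) :
    T.depth x = T.depth (T.parent x) + 1 := by
  classical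
  refine (Nat.find_eq_iff _).2 ⟨Nat.find_spec (T.reach (T.parent x)), fun n hn h => ?_⟩
  cases n with
  | zero => exact hx h
  | succ n => exact Nat.find_min (T.reach (T.parent x)) (Nat.lt_of_succ_lt_succ hn) h

/-- Each step of `parent` lowers the depth, except at the root, where `parent` is the identity. -/
theorem Anc.eq_or_depth_lt {T : RTree α} {a x : α} (h : T.Anc a x) :
    a = x ∨ T.depth a < T.depth x := by
  obtain ⟨m, hm⟩ := h
  induction m generalizing x with
  | zero => exact Or.inl hm.symm
  | succ m ih =>
    by_cases hx : x = T.root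
    · have hp : ∀ n, T.parent^[n] T.root = T.root := fun n => iterate_fixed T.parent_root n
      left
      rw [← hm, hx, hp]
    · right
      rw [T.depth_parent hx]
      rcases ih hm with rfl | h
      · exact Nat.lt_succ_self _
      · exact h.trans (Nat.lt_succ_self _)

theorem Anc.antisymm {T : RTree α} {a x : α} (h : T.Anc a x) (h' : T.Anc x a) : a = x := by
  rcases h.eq_or_depth_lt with h | h
  · exact h
  · rcases h'.eq_or_depth_lt with h' | h'
    · exact h'.symm
    · exact absurd h h'.asymm

theorem Anc.total {T : RTree α} {a b x : α} (h : T.Anc a x) (h' : T.Anc b x) :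
    T.Anc a b ∨ T.Anc b a := by
  obtain ⟨m, rfl⟩ := h
  obtain ⟨n, rfl⟩ := h'
  rcases le_total m n with h | h
  · right
    exact ⟨n - m, by rw [← iterate_add_apply, Nat.sub_add_cancel h]⟩
  · left
    exact ⟨m - n, by rw [← iterate_add_apply, Nat.sub_add_cancel h]⟩

variable [Fintype α]

open Classical in
/-- The finite set of the vertices from which an edge leads to `x`. -/
def children (T : RTree α) (x : α) : Finset α :=
  Finset.univ.filter fun z => z ≠ T.root ∧ T.parent z = x

theorem mem_children {T : RTree α} {x z : α} :
    z ∈ T.children x ↔ z ≠ T.root ∧ T.parent z = x := by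
  simp [children]

theorem depth_of_mem_children {T : RTree α} {x c : α} (h : c ∈ T.children x) :
    T.depth c = T.depth x + 1 := by
  obtain ⟨h', rfl⟩ := mem_children.1 h
  exact T.depth_parent h'

theorem anc_of_mem_children {T : RTree α} {x c : α} (h : c ∈ T.children x) : T.Anc x c := by
  rw [← (mem_children.1 h).2]
  exact T.anc_parent c

theorem not_anc_of_mem_children {T : RTree α} {x c : α} (h : c ∈ T.children x) :
    ¬ T.Anc c x := fun h' => by
  have := depth_of_mem_children h
  rcases h'.eq_or_depth_lt with rfl | h' <;> omega

/-- The vertices below `x` form a chain, on which depth is injective; siblings have equal depth.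
Hence the subtrees above the children of a vertex are disjoint. -/
theorem eq_of_anc_of_mem_children {T : RTree α} {a x c c' : α} (h : c ∈ T.children a)
    (h' : c' ∈ T.children a) (hc : T.Anc c x) (hc' : T.Anc c' x) : c = c' := by
  have h1 := depth_of_mem_children h
  have h2 := depth_of_mem_children h'
  rcases hc.total hc' with h | h
  · rcases h.eq_or_depth_lt with h | h
    · exact h
    · omega
  · rcases h.eq_or_depth_lt with h | h
    · exact h.symm
    · omega

/-- The subtree above `a` splits into `a` and the subtrees above its children, the decomposition
behind the inductions on values below. -/
theorem anc_iff {T : RTree α} {a x : α} :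
    T.Anc a x ↔ x = a ∨ ∃ c ∈ T.children a, T.Anc c x := by
  constructor
  · rintro ⟨m, hm⟩
    induction m generalizing x with
    | zero => exact Or.inl hm
    | succ m ih =>
      by_cases hx : x = T.root
      · left
        rw [← hm, hx, iterate_fixed T.parent_root]
      · right
        rcases ih hm with h | ⟨c, hc, h⟩
        · exact ⟨x, mem_children.2 ⟨hx, h⟩, Anc.refl T x⟩
        · exact ⟨c, hc, h.trans (T.anc_parent x)⟩
  · rintro (rfl | ⟨c, hc, h⟩)
    · exact Anc.refl T x
    · exact (anc_of_mem_children hc).trans h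

/-- Recursion runs from the leaves towards the root: depth grows on passing to a child, and there
are finitely many vertices. -/
theorem children_wf (T : RTree α) : WellFounded fun c x => c ∈ T.children x := by
  refine Subrelation.wf (r := InvImage (· > ·) T.depth) ?_ ?_
  · intro c x h
    have := depth_of_mem_children h
    simp only [InvImage]
    omega
  · have : IsTrans α (InvImage (· > ·) T.depth) := ⟨fun a b c h h' => gt_trans (α := ℕ) h h'⟩
    have : Std.Irrefl (InvImage (· > ·) T.depth) := ⟨fun a h => lt_irrefl (α := ℕ) _ h⟩
    exact Finite.wellFounded_of_trans_of_irrefl _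

theorem children_relabel {β : Type*} [Fintype β] (e : α ≃ β) (T : RTree α) (x : α) :
    (T.relabel e).children (e x) = (T.children x).map e.toEmbedding := by
  ext z
  obtain ⟨z, rfl⟩ := e.surjective z
  simp [mem_children, relabel]

end Anc

/-! ### Evaluation of decorated trees in a pre-Lie algebra -/

section Val

variable {α β A : Type*} [Fintype α] [Fintype β]

open Classical in
/-- The value in `A` of the subtree above the vertex `x` of a tree whose vertices are decorated by
elements of `A`: the symmetric brace of the decoration of `x` with the values at the children. -/
def val [NonUnitalNonAssocRing A] (T : RTree α) (v : α → A) : α → A :=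
  T.children_wf.fix fun x rec =>
    -- A brace reads its family only on the given index set (`brace_congr`), so the value `0` off
    -- the children is immaterial.
    brace (v x) (T.children x) fun c => if h : c ∈ T.children x then rec c h else 0

/-- The value of a decorated tree in `A`. -/
def ev [NonUnitalNonAssocRing A] (T : RTree α) (v : α → A) : A := T.val v T.root

variable [RightPreLieRing A]

theorem val_eq (T : RTree α) (v : α → A) (x : α) :
    T.val v x = brace (v x) (T.children x) (T.val v) := by
  rw [val, WellFounded.fix_eq]
  exact brace_congr _ fun i hi => by rw [dif_pos hi]

theorem val_congr {T : RTree α} {v w : α → A} {a : α} (h : ∀ x, T.Anc a x → v x = w x) :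
    T.val v a = T.val w a := by
  induction a using T.children_wf.induction with
  | _ a ih =>
    rw [val_eq, val_eq T w, h a (Anc.refl T a)]
    exact brace_congr _ fun c hc => ih c hc fun x hx => h x ((anc_of_mem_children hc).trans hx)

theorem val_update_of_not_anc [DecidableEq α] {T : RTree α} (v : α → A) {a i : α}
    (h : ¬ T.Anc a i) (z : A) : T.val (update v i z) a = T.val v a :=
  val_congr fun x hx => update_of_ne (fun e : x = i => h (e ▸ hx)) _ _

/-- If `i` is not `a`, it lies above exactly one child `c` of `a`; in the brace at `a` only the
entry of `c` changes, and braces are additive in each entry. -/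
theorem val_update_add [DecidableEq α] {T : RTree α} (v : α → A) {a i : α} (h : T.Anc a i)
    (y z : A) :
    T.val (update v i (y + z)) a = T.val (update v i y) a + T.val (update v i z) a := by
  induction a using T.children_wf.induction with
  | _ a ih =>
    simp only [val_eq T _ a]
    rcases anc_iff.1 h with rfl | ⟨c, hc, hci⟩
    · simp only [update_self, brace_add_left]
      congr 1 <;> refine brace_congr _ fun j hj => ?_ <;>
      simp only [val_update_of_not_anc v (not_anc_of_mem_children hj)]
    · have ha : a ≠ i := fun e => not_anc_of_mem_children hc (e ▸ hci)
      simp only [update_of_ne ha]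
      have hj : ∀ j ∈ T.children a, j ≠ c → ¬ T.Anc j i := fun j hj hjc hji =>
        hjc (eq_of_anc_of_mem_children hj hc hji hci)
      exact brace_add_right _ hc (ih c hc hci)
        (fun j hja hjc => by simp only [val_update_of_not_anc v (hj j hja hjc)])
        (fun j hja hjc => by simp only [val_update_of_not_anc v (hj j hja hjc)])

theorem val_update_smul {k : Type*} [CommRing k] [RightPreLieAlgebra k A] [DecidableEq α]
    {T : RTree α} (v : α → A) {a i : α} (h : T.Anc a i) (c : k) (z : A) :
    T.val (update v i (c • z)) a = c • T.val (update v i z) a := by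
  induction a using T.children_wf.induction with
  | _ a ih =>
    simp only [val_eq T _ a]
    rcases anc_iff.1 h with rfl | ⟨b, hc, hci⟩
    · simp only [update_self, brace_smul_left]
      congr 1
      refine brace_congr _ fun j hj => ?_
      simp only [val_update_of_not_anc v (not_anc_of_mem_children hj)]
    · have ha : a ≠ i := fun e => not_anc_of_mem_children hc (e ▸ hci)
      simp only [update_of_ne ha]
      have hj : ∀ j ∈ T.children a, j ≠ b → ¬ T.Anc j i := fun j hj hjc hji =>
        hjc (eq_of_anc_of_mem_children hj hc hji hci)
      exact brace_smul_right _ hc c (ih b hc hci)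
        (fun j hja hjc => by simp only [val_update_of_not_anc v (hj j hja hjc)])

/-- The value of a tree as a multilinear function of the decorations. -/
def evMultilinear (k : Type*) [CommRing k] [RightPreLieAlgebra k A] (T : RTree α) :
    MultilinearMap k (fun _ : α => A) A where
  toFun v := T.ev v
  map_update_add' v i x y := val_update_add v (T.anc_root i) x y
  map_update_smul' v i c x := val_update_smul v (T.anc_root i) c x

@[simp]
theorem evMultilinear_apply (k : Type*) [CommRing k] [RightPreLieAlgebra k A] (T : RTree α)
    (v : α → A) : T.evMultilinear k v = T.ev v := rfl

theorem map_val {B F : Type*} [RightPreLieRing B] [FunLike F A B] [NonUnitalRingHomClass F A B]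
    (φ : F) (T : RTree α) (v : α → A) (a : α) : φ (T.val v a) = T.val (φ ∘ v) a := by
  induction a using T.children_wf.induction with
  | _ a ih =>
    rw [val_eq, map_brace, val_eq T (φ ∘ v)]
    exact brace_congr _ fun c hc => ih c hc

theorem map_ev {B F : Type*} [RightPreLieRing B] [FunLike F A B] [NonUnitalRingHomClass F A B]
    (φ : F) (T : RTree α) (v : α → A) : φ (T.ev v) = T.ev (φ ∘ v) := map_val φ T v _

theorem val_relabel (e : α ≃ β) (T : RTree α) (v : β → A) (a : α) :
    (T.relabel e).val v (e a) = T.val (v ∘ e) a := by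
  induction a using T.children_wf.induction with
  | _ a ih =>
    rw [val_eq, children_relabel, brace_map, val_eq T (v ∘ e)]
    exact brace_congr _ fun c hc => ih c hc

theorem ev_relabel (e : α ≃ β) (T : RTree α) (v : β → A) :
    (T.relabel e).ev v = T.ev (v ∘ e) := val_relabel e T v _

theorem ev_single {α : Type*} [Unique α] [Fintype α] (v : α → A) :
    (single α).ev v = v default := by
  have : (single α).children default = ∅ := by
    ext z
    simp [mem_children, single, Unique.eq_default z]
  change val _ _ default = _
  rw [val_eq, this, brace_empty]

theorem children_graft_inr (T : RTree α) (S : RTree β) (x : α) (b : β) :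
    (T.graft S x).children (Sum.inr b) = (S.children b).map .inr := by
  classical
  ext z
  rcases z with z | z
  · simp [mem_children, graft]
  · by_cases hz : z = S.root <;> simp [mem_children, graft, hz]

theorem children_graft_inl_of_ne (T : RTree α) (S : RTree β) {x a : α} (h : a ≠ x) :
    (T.graft S x).children (Sum.inl a) = (T.children a).map .inl := by
  classical
  ext z
  rcases z with z | z
  · simp [mem_children, graft]
  · by_cases hz : z = S.root <;> simp [mem_children, graft, hz, h.symm]

theorem children_graft_inl_self [DecidableEq α] [DecidableEq β] (T : RTree α) (S : RTree β) (x : α) :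
    (T.graft S x).children (Sum.inl x) = insert (Sum.inr S.root) ((T.children x).map .inl) := by
  ext z
  rcases z with z | z
  · simp [mem_children, graft]
  · by_cases hz : z = S.root <;> simp [mem_children, graft, hz]

theorem val_graft_inr (T : RTree α) (S : RTree β) (x : α) (t : α → A) (s : β → A) (b : β) :
    (T.graft S x).val (Sum.elim t s) (Sum.inr b) = S.val s b := by
  induction b using S.children_wf.induction with
  | _ b ih =>
    rw [val_eq, children_graft_inr, brace_map, val_eq S]
    exact brace_congr _ fun c hc => ih c hc

theorem val_graft_inl_of_not_anc (T : RTree α) (S : RTree β) {x a : α} (h : ¬ T.Anc a x)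
    (t : α → A) (s : β → A) : (T.graft S x).val (Sum.elim t s) (Sum.inl a) = T.val t a := by
  induction a using T.children_wf.induction with
  | _ a ih =>
    have ha : a ≠ x := by rintro rfl; exact h (Anc.refl T a)
    rw [val_eq, children_graft_inl_of_ne T S ha, brace_map, val_eq T]
    exact brace_congr _ fun c hc => ih c hc fun h' => h ((anc_of_mem_children hc).trans h')

-- The recursion of braces read on trees. By `brace_mul`, the brace at `a` times the value of `S` is
-- a brace with that value as one more entry, which is insertion at `a`, plus braces in which the
-- entry of one child `c` is multiplied by it, which by induction are the insertions above `c`. The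
-- sum is restricted to the subtree above `a` so that this induction closes.
open Classical in
theorem sum_val_graft (T : RTree α) (S : RTree β) (t : α → A) (s : β → A) (a : α) :
    ∑ x ∈ Finset.univ.filter (T.Anc a), (T.graft S x).val (Sum.elim t s) (Sum.inl a)
      = T.val t a * S.ev s := by
  induction a using T.children_wf.induction with
  | _ a ih =>
    have hd : Finset.univ.filter (T.Anc a) = insert a ((T.children a).biUnion
        fun c => Finset.univ.filter (T.Anc c)) := by
      ext x
      simp [anc_iff (a := a)]
    rw [hd, Finset.sum_insert, Finset.sum_biUnion]
    -- One family holds the values in `T` and in `S`, so that the value of `S` can be the entry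
    -- adjoined to the brace at `a`.
    · set F : α ⊕ β → A := Sum.elim (T.val t) (S.val s) with hF
      have hr : (Sum.inr S.root : α ⊕ β) ∉ (T.children a).map .inl := by simp
      have h1 : (T.graft S a).val (Sum.elim t s) (Sum.inl a)
          = brace (t a) (insert (Sum.inr S.root) ((T.children a).map .inl)) F := by
        rw [val_eq, children_graft_inl_self]
        refine brace_congr _ fun z hz => ?_
        rcases z with z | z
        · have hz : z ∈ T.children a := by simpa using hz
          exact val_graft_inl_of_not_anc T S (not_anc_of_mem_children hz) t s
        · exact val_graft_inr T S a t s z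
      have h2 : ∀ c ∈ T.children a, ∑ x ∈ Finset.univ.filter (T.Anc c),
          (T.graft S x).val (Sum.elim t s) (Sum.inl a)
            = brace (t a) ((T.children a).map .inl)
              (update F (Sum.inl c) (F (Sum.inl c) * F (Sum.inr S.root))) := by
        intro c hc
        have : F (Sum.inl c) * F (Sum.inr S.root) = T.val t c * S.ev s := rfl
        rw [this, ← ih c hc, brace_update_sum _ _ (by simpa using hc)]
        refine Finset.sum_congr rfl fun x hx => ?_
        have hx : T.Anc c x := by simpa using hx
        have hax : a ≠ x := by rintro rfl; exact not_anc_of_mem_children hc hx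
        rw [val_eq, children_graft_inl_of_ne T S hax]
        refine brace_congr _ fun z hz => ?_
        obtain ⟨z, hz', rfl⟩ := Finset.mem_map.1 hz
        by_cases hzc : z = c
        · subst hzc; simp
        · rw [update_of_ne (by simpa using hzc)]
          exact val_graft_inl_of_not_anc T S
            (fun h => hzc (eq_of_anc_of_mem_children hz' hc h hx)) t s
      have h3 : T.val t a * S.ev s
          = brace (t a) ((T.children a).map .inl) F * F (Sum.inr S.root) := by
        rw [val_eq, brace_map]; rfl
      rw [h1, Finset.sum_congr rfl h2, h3, brace_mul _ hr, Finset.sum_map]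
      rfl
    · intro c hc c' hc' hne
      refine Finset.disjoint_left.2 fun x hx hx' => hne ?_
      exact eq_of_anc_of_mem_children hc hc' (by simpa using hx) (by simpa using hx')
    · simp only [Finset.mem_biUnion, Finset.mem_filter, Finset.mem_univ, true_and, not_exists,
        not_and]
      exact fun c hc => not_anc_of_mem_children hc

/-- Evaluation of trees takes insertion to the pre-Lie product. -/
theorem ev_mul_ev (T : RTree α) (S : RTree β) (t : α → A) (s : β → A) :
    T.ev t * S.ev s = ∑ x, (T.graft S x).ev (Sum.elim t s) := by
  classical
  have : Finset.univ.filter (T.Anc T.root) = Finset.univ := by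
    simp [T.anc_root]
  rw [ev, ← sum_val_graft, this]
  rfl

end Val

end RTree

/-! ### Linear maps out of spaces of decorated objects -/

section DecLift

variable {k V : Type*} [Field k] [AddCommGroup V] [Module k V]

theorem Decorated.mk_smul {n : ℕ} {X : Type*} [MulAction (Equiv.Perm (Fin n)) X]
    (σ : Equiv.Perm (Fin n)) (x : X) (v : Fin n → V) :
    Decorated.mk k V n (σ • x) v = Decorated.mk k V n x (v ∘ σ) := by
  have h := Representation.Coinvariants.mk_self_apply (decRep k V n X) σ
    (MonoidAlgebra.single x 1 ⊗ₜ[k] PiTensorProduct.tprod k (v ∘ σ))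
  rw [Decorated.mk, Decorated.mk, ← h]
  congr 1
  change _ = (TensorProduct.map _ _) _
  rw [TensorProduct.map_tmul, Representation.ofMulAction_single]
  congr 1
  change _ = PiTensorProduct.reindex k (fun _ : Fin n => V) σ _
  rw [PiTensorProduct.reindex_tprod]
  congr 1
  ext i
  simp

theorem Decorated.hom_ext {n : ℕ} {X M : Type*} [MulAction (Equiv.Perm (Fin n)) X]
    [AddCommGroup M] [Module k M] {f g : Decorated k V n X →ₗ[k] M}
    (h : ∀ x v, f (Decorated.mk k V n x v) = g (Decorated.mk k V n x v)) : f = g := by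
  apply Representation.Coinvariants.hom_ext
  apply TensorProduct.ext
  ext x v
  exact h x v

/-- The linear map on `Span(X) ⊗_{Σₙ} (V ⊗ ⋯ ⊗ V)` induced by an equivariant family of multilinear
maps. -/
def Decorated.lift {n : ℕ} {X M : Type*} [MulAction (Equiv.Perm (Fin n)) X]
    [AddCommGroup M] [Module k M] (f : X → MultilinearMap k (fun _ : Fin n => V) M)
    (hf : ∀ (σ : Equiv.Perm (Fin n)) x v, f (σ • x) v = f x (v ∘ σ)) :
    Decorated k V n X →ₗ[k] M :=
  Representation.Coinvariants.lift (decRep k V n X)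
    (TensorProduct.lift (Finsupp.linearCombination k (fun x => PiTensorProduct.lift (f x))
      ∘ₗ (MonoidAlgebra.coeffLinearEquiv k).toLinearMap)) (by
    intro σ
    apply TensorProduct.ext
    ext x v
    have h1 : decRep k V n X σ (MonoidAlgebra.single x 1 ⊗ₜ[k] PiTensorProduct.tprod k v)
        = MonoidAlgebra.single (σ • x) 1 ⊗ₜ[k] PiTensorProduct.tprod k (v ∘ σ.symm) := by
      change (TensorProduct.map _ _) _ = _
      rw [TensorProduct.map_tmul, Representation.ofMulAction_single]
      congr 1
      change PiTensorProduct.reindex k (fun _ : Fin n => V) σ _ = _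
      rw [PiTensorProduct.reindex_tprod]
      rfl
    change TensorProduct.lift _ (decRep k V n X σ
      (MonoidAlgebra.single x 1 ⊗ₜ[k] PiTensorProduct.tprod k v))
        = TensorProduct.lift _ (MonoidAlgebra.single x 1 ⊗ₜ[k] PiTensorProduct.tprod k v)
    rw [h1]
    simp [hf, comp_assoc])

@[simp]
theorem Decorated.lift_mk {n : ℕ} {X M : Type*} [MulAction (Equiv.Perm (Fin n)) X]
    [AddCommGroup M] [Module k M] (f : X → MultilinearMap k (fun _ : Fin n => V) M)
    (hf : ∀ (σ : Equiv.Perm (Fin n)) x v, f (σ • x) v = f x (v ∘ σ)) (x : X) (v : Fin n → V) :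
    Decorated.lift f hf (Decorated.mk k V n x v) = f x v := by
  rw [Decorated.lift, Decorated.mk, Representation.Coinvariants.lift_mk]
  simp

/-- The element `x` decorated by `v`, as a multilinear function of `v`. -/
def Decorated.mkMultilinear {n : ℕ} {X : Type*} [MulAction (Equiv.Perm (Fin n)) X] (x : X) :
    MultilinearMap k (fun _ : Fin n => V) (Decorated k V n X) :=
  (Representation.Coinvariants.mk (decRep k V n X) ∘ₗ
    TensorProduct.mk k _ _ (MonoidAlgebra.single x 1)).compMultilinearMap
      (PiTensorProduct.tprod k)

variable {X : ℕ → Type*} [∀ n, MulAction (Equiv.Perm (Fin n)) (X n)]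
  {M : Type*} [AddCommGroup M] [Module k M]

theorem directSum_hom_ext {f g : (⨁ n, Decorated k V n (X n)) →ₗ[k] M}
    (h : ∀ n x v, f (DirectSum.lof k ℕ (fun n => Decorated k V n (X n)) n
      (Decorated.mk k V n x v)) = g (DirectSum.lof k ℕ (fun n => Decorated k V n (X n)) n
      (Decorated.mk k V n x v))) : f = g :=
  DirectSum.linearMap_ext _ fun n => Decorated.hom_ext fun x v => h n x v

end DecLift

/-! ### Trees with arbitrary finite vertex sets -/

section Of

variable (k : Type*) {V : Type*} [Field k] [AddCommGroup V] [Module k V]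

/-- Permutations act trivially on coinvariants. Two numbers `m`, `n` are allowed because numberings
of one finite set may use cardinalities that are equal only by a proof. -/
theorem Tr.mk_relabel {m n : ℕ} (e : Fin m ≃ Fin n) (T : RTree (Fin m)) (v : Fin n → V) :
    Tr.mk k (T.relabel e) v = Tr.mk k T (v ∘ e) := by
  obtain rfl : m = n := Fin.equiv_iff_eq.1 ⟨e⟩
  exact congrArg (DirectSum.lof k ℕ _ m) (Decorated.mk_smul e T v)

theorem TrOne.mk_relabel {m n : ℕ} (e : Fin m ≃ Fin n) (T : RTree (Option (Fin m)))
    (v : Fin n → V) : TrOne.mk k (T.relabel e.optionCongr) v = TrOne.mk k T (v ∘ e) := by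
  obtain rfl : m = n := Fin.equiv_iff_eq.1 ⟨e⟩
  have h : e.optionCongr = MulAction.toPerm (α := Equiv.Perm (Fin m)) e := by
    ext x : 1
    cases x <;> rfl
  rw [h]
  exact congrArg (DirectSum.lof k ℕ _ m) (Decorated.mk_smul e T v)

theorem RTree.relabel_relabel {α β γ : Type*} (e : α ≃ β) (e' : β ≃ γ) (T : RTree α) :
    (T.relabel e).relabel e' = T.relabel (e.trans e') := rfl

variable {α β : Type*} [Fintype α] [Fintype β]

/-- The tree `T` with vertices in a finite set, decorated by `v`. -/
def Tr.of (T : RTree α) (v : α → V) : Tr k V :=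
  Tr.mk k (T.relabel (Fintype.equivFin α)) (v ∘ (Fintype.equivFin α).symm)

/-- The tree `T` with a special vertex and further vertices in a finite set, decorated by `v`. -/
def TrOne.of (T : RTree (Option α)) (v : α → V) : TrOne k V :=
  TrOne.mk k (T.relabel (Fintype.equivFin α).optionCongr) (v ∘ (Fintype.equivFin α).symm)

/-- Two numberings of the vertices differ by a bijection between initial segments of `ℕ`, which
`Tr.mk_relabel` absorbs; hence the numbering in `Tr.of` plays no role. -/
theorem Tr.of_eq_mk {n : ℕ} (e : α ≃ Fin n) (T : RTree α) (v : α → V) :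
    Tr.of k T v = Tr.mk k (T.relabel e) (v ∘ e.symm) := by
  have h := Tr.mk_relabel k ((Fintype.equivFin α).symm.trans e)
    (T.relabel (Fintype.equivFin α)) (v ∘ e.symm)
  have h1 : (v ∘ e.symm) ∘ ((Fintype.equivFin α).symm.trans e)
      = v ∘ (Fintype.equivFin α).symm := by ext; simp
  have h2 : (T.relabel (Fintype.equivFin α)).relabel ((Fintype.equivFin α).symm.trans e)
      = T.relabel e := by
    rw [RTree.relabel_relabel, ← Equiv.trans_assoc, Equiv.self_trans_symm, Equiv.refl_trans]
  rw [Tr.of, ← h1, ← h, h2]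

theorem TrOne.of_eq_mk {n : ℕ} (e : α ≃ Fin n) (T : RTree (Option α)) (v : α → V) :
    TrOne.of k T v = TrOne.mk k (T.relabel e.optionCongr) (v ∘ e.symm) := by
  have h := TrOne.mk_relabel k ((Fintype.equivFin α).symm.trans e)
    (T.relabel (Fintype.equivFin α).optionCongr) (v ∘ e.symm)
  have h1 : (v ∘ e.symm) ∘ ((Fintype.equivFin α).symm.trans e)
      = v ∘ (Fintype.equivFin α).symm := by ext; simp
  have h2 : (T.relabel (Fintype.equivFin α).optionCongr).relabel
      ((Fintype.equivFin α).symm.trans e).optionCongr = T.relabel e.optionCongr := by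
    rw [RTree.relabel_relabel, ← Equiv.optionCongr_trans, ← Equiv.trans_assoc,
      Equiv.self_trans_symm, Equiv.refl_trans]
  rw [TrOne.of, ← h1, ← h, h2]

theorem Tr.mk_eq_of {n : ℕ} (T : RTree (Fin n)) (v : Fin n → V) : Tr.mk k T v = Tr.of k T v :=
  (Tr.of_eq_mk k (Equiv.refl _) T v).symm

theorem TrOne.mk_eq_of {n : ℕ} (T : RTree (Option (Fin n))) (v : Fin n → V) :
    TrOne.mk k T v = TrOne.of k T v := by
  rw [TrOne.of_eq_mk k (Equiv.refl _) T v, Equiv.optionCongr_refl]; rfl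

theorem Tr.of_relabel (e : α ≃ β) (T : RTree α) (v : β → V) :
    Tr.of k (T.relabel e) v = Tr.of k T (v ∘ e) := by
  rw [Tr.of_eq_mk k (Fintype.equivFin β), Tr.of_eq_mk k (e.trans (Fintype.equivFin β))]
  congr 1
  ext; simp

theorem TrOne.of_relabel (e : α ≃ β) (T : RTree (Option α)) (v : β → V) :
    TrOne.of k (T.relabel e.optionCongr) v = TrOne.of k T (v ∘ e) := by
  rw [TrOne.of_eq_mk k (Fintype.equivFin β), TrOne.of_eq_mk k (e.trans (Fintype.equivFin β)),
    Equiv.optionCongr_trans]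
  congr 1
  ext; simp

/-- `Tr.of` as a multilinear function of the decorations. -/
def Tr.ofMultilinear (T : RTree α) : MultilinearMap k (fun _ : α => V) (Tr k V) :=
  ((DirectSum.lof k ℕ (fun n => Decorated k V n (RTree (Fin n))) _).compMultilinearMap
    (Decorated.mkMultilinear (T.relabel (Fintype.equivFin α)))).domDomCongr
      (Fintype.equivFin α).symm

theorem Tr.ofMultilinear_apply (T : RTree α) (v : α → V) :
    Tr.ofMultilinear k T v = Tr.of k T v := rfl

/-- `TrOne.of` as a multilinear function of the decorations. -/
def TrOne.ofMultilinear (T : RTree (Option α)) :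
    MultilinearMap k (fun _ : α => V) (TrOne k V) :=
  ((DirectSum.lof k ℕ (fun n => Decorated k V n (RTree (Option (Fin n)))) _).compMultilinearMap
    (Decorated.mkMultilinear (T.relabel (Fintype.equivFin α).optionCongr))).domDomCongr
      (Fintype.equivFin α).symm

theorem TrOne.ofMultilinear_apply (T : RTree (Option α)) (v : α → V) :
    TrOne.ofMultilinear k T v = TrOne.of k T v := rfl

variable {k} {M : Type*} [AddCommGroup M] [Module k M]

theorem Tr.hom_ext {f g : Tr k V →ₗ[k] M}
    (h : ∀ n (T : RTree (Fin n)) v, f (Tr.mk k T v) = g (Tr.mk k T v)) : f = g :=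
  directSum_hom_ext h

theorem TrOne.hom_ext {f g : TrOne k V →ₗ[k] M}
    (h : ∀ n (T : RTree (Option (Fin n))) v, f (TrOne.mk k T v) = g (TrOne.mk k T v)) : f = g :=
  directSum_hom_ext h

/-- The linear map on `Tr(V)` induced by an equivariant family of multilinear maps. -/
def Tr.lift (f : ∀ n, RTree (Fin n) → MultilinearMap k (fun _ : Fin n => V) M)
    (hf : ∀ n (σ : Equiv.Perm (Fin n)) T v, f n (T.relabel σ) v = f n T (v ∘ σ)) :
    Tr k V →ₗ[k] M :=
  DirectSum.toModule k ℕ M fun n => Decorated.lift (f n) (hf n)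

@[simp]
theorem Tr.lift_mk (f : ∀ n, RTree (Fin n) → MultilinearMap k (fun _ : Fin n => V) M)
    (hf : ∀ n (σ : Equiv.Perm (Fin n)) T v, f n (T.relabel σ) v = f n T (v ∘ σ))
    {n : ℕ} (T : RTree (Fin n)) (v : Fin n → V) : Tr.lift f hf (Tr.mk k T v) = f n T v := by
  rw [Tr.lift, Tr.mk, DirectSum.toModule_lof]
  exact Decorated.lift_mk _ _ _ _

/-- The linear map on `Tr¹(V)` induced by an equivariant family of multilinear maps. -/
def TrOne.lift (f : ∀ n, RTree (Option (Fin n)) → MultilinearMap k (fun _ : Fin n => V) M)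
    (hf : ∀ n (σ : Equiv.Perm (Fin n)) T v, f n (T.relabel σ.optionCongr) v = f n T (v ∘ σ)) :
    TrOne k V →ₗ[k] M :=
  DirectSum.toModule k ℕ M fun n => Decorated.lift (f n) (fun σ T v => by
    have h : σ.optionCongr = MulAction.toPerm (α := Equiv.Perm (Fin n)) σ := by
      ext x : 1
      cases x <;> rfl
    rw [← hf, h]
    rfl)

@[simp]
theorem TrOne.lift_mk (f : ∀ n, RTree (Option (Fin n)) → MultilinearMap k (fun _ : Fin n => V) M)
    (hf : ∀ n (σ : Equiv.Perm (Fin n)) T v, f n (T.relabel σ.optionCongr) v = f n T (v ∘ σ))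
    {n : ℕ} (T : RTree (Option (Fin n))) (v : Fin n → V) :
    TrOne.lift f hf (TrOne.mk k T v) = f n T v := by
  rw [TrOne.lift, TrOne.mk, DirectSum.toModule_lof]
  exact Decorated.lift_mk _ _ _ _

end Of

/-! ### Combinatorics of insertion -/

namespace RTree

section Graft

variable {α β γ α' β' : Type*}

theorem graft_relabel (e : α ≃ α') (e' : β ≃ β') (T : RTree α) (S : RTree β) (x : α) :
    (T.relabel e).graft (S.relabel e') (e x) = (T.graft S x).relabel (e.sumCongr e') := by
  ext z
  · rfl
  · rcases z with z | z
    · rfl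
    · by_cases h : z = e' S.root
      · subst h; simp [graft, relabel]
      · have h' : ¬ e'.symm z = S.root := fun h' => h (by rw [← h', Equiv.apply_symm_apply])
        simp [graft, relabel, h, h']

/-- The terms of `(T ⋆ S) ⋆ U` in which `U` sits on `S` are those of `T ⋆ (S ⋆ U)`; they cancel in
the associator. -/
theorem graft_graft_inr (T : RTree α) (S : RTree β) (U : RTree γ) (x : α) (y : β) :
    ((T.graft S x).graft U (Sum.inr y)).relabel (Equiv.sumAssoc α β γ)
      = T.graft (S.graft U y) x := by
  ext z
  · rfl
  · rcases z with z | z | z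
    · rfl
    · by_cases h : z = S.root <;> simp [graft, relabel, h]
    · by_cases h : z = U.root <;> simp [graft, relabel, h]

/-- Exchange of the last two summands. -/
def sumRightComm (α β γ : Type*) : (α ⊕ β) ⊕ γ ≃ (α ⊕ γ) ⊕ β :=
  (Equiv.sumAssoc α β γ).trans
    (((Equiv.refl α).sumCongr (Equiv.sumComm β γ)).trans (Equiv.sumAssoc α γ β).symm)

/-- The terms that survive in the associator carry `S` and `U` separately on `T`, and are therefore
symmetric in `S` and `U`. -/
theorem graft_graft_inl (T : RTree α) (S : RTree β) (U : RTree γ) (x y : α) :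
    ((T.graft S x).graft U (Sum.inl y)).relabel (sumRightComm α β γ)
      = (T.graft U y).graft S (Sum.inl x) := by
  ext z
  · rfl
  · rcases z with (z | z) | z
    · rfl
    · by_cases h : z = U.root <;> simp [graft, relabel, sumRightComm, h]
    · by_cases h : z = S.root <;> simp [graft, relabel, sumRightComm, h]

/-- The subtree above the vertex `c`. -/
def above (T : RTree α) (c : α) : RTree {x // T.Anc c x} where
  root := ⟨c, Anc.refl T c⟩
  parent x := open Classical in if h : x.1 = c then x else ⟨T.parent x, by
    obtain ⟨m, hm⟩ := x.2
    cases m with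
    | zero => exact absurd hm h
    | succ m => exact ⟨m, hm⟩⟩
  parent_root := by simp
  reach := by
    classical
    have key : ∀ (m : ℕ) (x : {x // T.Anc c x}), T.parent^[m] x = c → ∃ n : ℕ,
        (fun x : {x // T.Anc c x} => if h : x.1 = c then x else (⟨T.parent x, by
          obtain ⟨m, hm⟩ := x.2
          cases m with
          | zero => exact absurd hm h
          | succ m => exact ⟨m, hm⟩⟩ : {x // T.Anc c x}))^[n] x = ⟨c, Anc.refl T c⟩ := by
      intro m
      induction m with
      | zero => intro x hx; exact ⟨0, Subtype.ext hx⟩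
      | succ m ih =>
        intro x hx
        by_cases h : x.1 = c
        · exact ⟨0, Subtype.ext h⟩
        · obtain ⟨n, hn⟩ := ih ⟨T.parent x, by
            obtain ⟨m, hm⟩ := x.2
            cases m with
            | zero => exact absurd hm h
            | succ m => exact ⟨m, hm⟩⟩ hx
          refine ⟨n + 1, ?_⟩
          rw [iterate_succ_apply, dif_neg h, hn]
    intro x
    obtain ⟨m, hm⟩ := x.2
    obtain ⟨n, hn⟩ := key m x hm
    exact ⟨n, hn⟩

/-- What remains of a tree if the subtree above a vertex `c` other than the root is removed. -/
def below (T : RTree α) (c : α) (hc : c ≠ T.root) : RTree {x // ¬ T.Anc c x} where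
  root := ⟨T.root, fun h => hc (h.antisymm (T.anc_root c))⟩
  parent x := ⟨T.parent x, fun h => x.2 (h.trans (T.anc_parent x))⟩
  parent_root := Subtype.ext T.parent_root
  reach x := by
    obtain ⟨m, hm⟩ := T.reach x
    refine ⟨m, Subtype.ext (Eq.trans ?_ hm)⟩
    clear hm
    induction m generalizing x with
    | zero => rfl
    | succ m ih => exact ih _

-- Cutting the edge of a child of the root inverts an insertion at the root; this is the
-- decomposition behind `induction_on`.
open Classical in
theorem below_graft_above (T : RTree α) {c : α} (hc : c ≠ T.root) (hp : T.parent c = T.root) :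
    ((T.below c hc).graft (T.above c) (T.below c hc).root).relabel
      ((Equiv.sumComm _ _).trans (Equiv.sumCompl fun x => T.Anc c x)) = T := by
  ext z
  · rfl
  · by_cases hz : T.Anc c z
    · by_cases hzc : z = c
      · subst hzc
        simp [graft, relabel, hz, above, below, hp]
      · simp [graft, relabel, hz, above, below, hzc]
    · simp [graft, relabel, hz, above, below]

/-- Induction on rooted trees: every tree with more than one vertex arises by joining the root of a
smaller tree to the root of another one, and it may be assumed that all the other insertions of
these two trees have been treated. -/
theorem induction_on {P : ∀ (α : Type) [Fintype α], RTree α → Prop}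
    (hrel : ∀ (α β : Type) [Fintype α] [Fintype β] (e : α ≃ β) (T : RTree α), P α T →
      P β (T.relabel e))
    (hsingle : ∀ (α : Type) [Fintype α] [Unique α], P α (single α))
    (hgraft : ∀ (α β : Type) [Fintype α] [Fintype β] (T : RTree α) (S : RTree β), P α T → P β S →
      (∀ x, x ≠ T.root → P _ (T.graft S x)) → P _ (T.graft S T.root))
    (α : Type) [Fintype α] (T : RTree α) : P α T := by
  classical
  -- Double induction, on the number `n` of vertices and then on the number `m` of children of the
  -- root. Cutting off a child leaves two smaller trees; reinserting it at a vertex other than the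
  -- root keeps `n` and lowers `m` by one.
  have key : ∀ (n m : ℕ) (α : Type) [Fintype α] (T : RTree α), Fintype.card α = n →
      (T.children T.root).card = m → P α T := by
    intro n
    induction n using Nat.strong_induction_on with
    | _ n ihn =>
      intro m
      induction m with
      | zero =>
        intro α _ T _ hm
        have hroot : ∀ x, x = T.root := fun x => by
          rcases anc_iff.1 (T.anc_root x) with h | ⟨c, hc, -⟩
          · exact h
          · rw [Finset.card_eq_zero.1 hm] at hc
            simp at hc
        have u : Unique α := ⟨⟨T.root⟩, hroot⟩
        have : T = single α := by
          ext z
          · exact Subsingleton.elim _ _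
          · exact Subsingleton.elim _ _
        rw [this]
        exact hsingle α
      | succ m ihm =>
        intro α _ T hn hm
        obtain ⟨c, hc⟩ : (T.children T.root).Nonempty := Finset.card_pos.1 (by omega)
        have hcr := (mem_children.1 hc).1
        have hT := below_graft_above T hcr (mem_children.1 hc).2
        set B := T.below c hcr
        set A := T.above c
        have hcard : Fintype.card {x // ¬ T.Anc c x} + Fintype.card {x // T.Anc c x} = n := by
          rw [← hn, ← Fintype.card_sum]
          exact Fintype.card_congr ((Equiv.sumComm _ _).trans (Equiv.sumCompl fun x => T.Anc c x))
        have h1 : 0 < Fintype.card {x // T.Anc c x} := Fintype.card_pos_iff.2 ⟨A.root⟩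
        have h2 : 0 < Fintype.card {x // ¬ T.Anc c x} := Fintype.card_pos_iff.2 ⟨B.root⟩
        have hch : (T.children T.root).card = (B.children B.root).card + 1 := by
          have h3 := children_relabel
            ((Equiv.sumComm _ _).trans (Equiv.sumCompl fun x => T.Anc c x))
            (B.graft A B.root) (Sum.inl B.root)
          rw [hT] at h3
          change T.children T.root = _ at h3
          rw [h3, Finset.card_map, children_graft_inl_self, Finset.card_insert_of_notMem (by simp),
            Finset.card_map]
        rw [← hT]
        refine hrel _ _ _ _ (hgraft _ _ _ _ (ihn _ (by omega) _ _ _ rfl rfl)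
          (ihn _ (by omega) _ _ _ rfl rfl) fun x hx => ihm _ _ ?_ ?_)
        · rw [Fintype.card_sum, hcard]
        · change ((B.graft A x).children (Sum.inl B.root)).card = m
          rw [children_graft_inl_of_ne _ _ hx.symm, Finset.card_map]
          omega
  exact key _ _ α T rfl rfl

end Graft

end RTree

/-- Two relabelling invariant and multiplicative functions on decorated trees agree if they agree on
the trees with one vertex. -/
theorem RTree.eq_of_mul {C M : Type*} [NonUnitalNonAssocRing M]
    (F G : ∀ (α : Type) [Fintype α], RTree α → (α → C) → M)
    (hF : ∀ (α β : Type) [Fintype α] [Fintype β] (e : α ≃ β) (T : RTree α) (v : β → C),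
      F β (T.relabel e) v = F α T (v ∘ e))
    (hG : ∀ (α β : Type) [Fintype α] [Fintype β] (e : α ≃ β) (T : RTree α) (v : β → C),
      G β (T.relabel e) v = G α T (v ∘ e))
    (hFm : ∀ (α β : Type) [Fintype α] [Fintype β] (T : RTree α) (t : α → C) (S : RTree β)
      (s : β → C), F α T t * F β S s = ∑ x, F _ (T.graft S x) (Sum.elim t s))
    (hGm : ∀ (α β : Type) [Fintype α] [Fintype β] (T : RTree α) (t : α → C) (S : RTree β)
      (s : β → C), G α T t * G β S s = ∑ x, G _ (T.graft S x) (Sum.elim t s))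
    (hs : ∀ (α : Type) [Fintype α] [Unique α] (v : α → C),
      F α (RTree.single α) v = G α (RTree.single α) v)
    (α : Type) [Fintype α] (T : RTree α) (v : α → C) : F α T v = G α T v := by
  revert v
  refine RTree.induction_on (P := fun α _ T => ∀ v : α → C, F α T v = G α T v) ?_ ?_ ?_ α T
  · intro α β _ _ e T h v
    rw [hF, hG, h]
  · intro α _ _ v
    exact hs α v
  · intro α β _ _ T S hT hS hx v
    classical
    obtain ⟨t, s, rfl⟩ : ∃ t s, v = Sum.elim t s :=
      ⟨v ∘ Sum.inl, v ∘ Sum.inr, (Sum.elim_comp_inl_inr v).symm⟩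
    -- Both functions expand the same product over all insertions. The terms away from the root
    -- agree by hypothesis, so cancellation leaves equality at the root.
    have h := hFm α β T t S s
    rw [hT, hS, hGm, ← Finset.add_sum_erase _ _ (Finset.mem_univ T.root),
      ← Finset.add_sum_erase _ (fun x => F _ (T.graft S x) _) (Finset.mem_univ T.root),
      Finset.sum_congr rfl fun x hx' => hx x (Finset.ne_of_mem_erase hx') (Sum.elim t s)] at h
    exact (add_right_cancel h).symm

/-! ### The pre-Lie algebra of decorated trees -/

section TrAlg

variable (k : Type*) {V : Type*} [Field k] [AddCommGroup V] [Module k V]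

theorem Tr.induction_on {p : Tr k V → Prop} (x : Tr k V) (zero : p 0)
    (add : ∀ x y, p x → p y → p (x + y)) (smul : ∀ (c : k) x, p x → p (c • x))
    (mk : ∀ n (T : RTree (Fin n)) v, p (Tr.mk k T v)) : p x := by
  -- The elements with property `p` form a subspace; the quotient map vanishes on decorated trees,
  -- hence everywhere.
  let G : Submodule k (Tr k V) := ⟨⟨⟨{x | p x}, fun hx hy => add _ _ hx hy⟩, zero⟩, smul⟩
  have h : G.mkQ = 0 := Tr.hom_ext fun n T v => by
    exact (Submodule.Quotient.mk_eq_zero G).2 (mk n T v)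
  have hx : G.mkQ x = 0 := by rw [h]; rfl
  exact (Submodule.Quotient.mk_eq_zero G).1 hx

theorem TrOne.induction_on {p : TrOne k V → Prop} (x : TrOne k V) (zero : p 0)
    (add : ∀ x y, p x → p y → p (x + y)) (smul : ∀ (c : k) x, p x → p (c • x))
    (mk : ∀ n (T : RTree (Option (Fin n))) v, p (TrOne.mk k T v)) : p x := by
  let G : Submodule k (TrOne k V) := ⟨⟨⟨{x | p x}, fun hx hy => add _ _ hx hy⟩, zero⟩, smul⟩
  have h : G.mkQ = 0 := TrOne.hom_ext fun n T v => by
    exact (Submodule.Quotient.mk_eq_zero G).2 (mk n T v)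
  have hx : G.mkQ x = 0 := by rw [h]; rfl
  exact (Submodule.Quotient.mk_eq_zero G).1 hx

/-- Insertion into a fixed decorated tree. -/
def Tr.mulAux {m : ℕ} (T : RTree (Fin m)) (t : Fin m → V) : Tr k V →ₗ[k] Tr k V :=
  Tr.lift (fun _ S => ∑ x, (Tr.ofMultilinear k (T.graft S x)).currySum t) (by
    intro n σ S s
    simp only [sum_apply, MultilinearMap.currySum_apply', Tr.ofMultilinear_apply]
    refine Finset.sum_congr rfl fun x _ => ?_
    have h := RTree.graft_relabel (Equiv.refl _) σ T S x
    change T.graft (S.relabel σ) x = _ at h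
    rw [h, Tr.of_relabel]
    congr 1
    ext z; rcases z with z | z <;> rfl)

theorem Tr.mulAux_mk {m n : ℕ} (T : RTree (Fin m)) (t : Fin m → V) (S : RTree (Fin n))
    (s : Fin n → V) :
    Tr.mulAux k T t (Tr.mk k S s) = ∑ x, Tr.of k (T.graft S x) (Sum.elim t s) := by
  simp only [Tr.mulAux, Tr.lift_mk, sum_apply, MultilinearMap.currySum_apply',
    Tr.ofMultilinear_apply]

/-- The insertion product of decorated trees. -/
def Tr.mulLin : Tr k V →ₗ[k] Tr k V →ₗ[k] Tr k V :=
  Tr.lift (fun m T =>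
    { toFun := fun t => Tr.mulAux k T t
      map_update_add' := fun t i x y => Tr.hom_ext fun n S s => by
        simp only [LinearMap.add_apply, Tr.mulAux_mk, ← Finset.sum_add_distrib,
          ← Tr.ofMultilinear_apply, Sum.elim_update_left, MultilinearMap.map_update_add]
      map_update_smul' := fun t i c x => Tr.hom_ext fun n S s => by
        simp only [LinearMap.smul_apply, Tr.mulAux_mk, Finset.smul_sum,
          ← Tr.ofMultilinear_apply, Sum.elim_update_left, MultilinearMap.map_update_smul] }) (by
    intro m σ T t
    refine Tr.hom_ext fun n S s => ?_
    change Tr.mulAux k _ _ _ = Tr.mulAux k _ _ _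
    simp only [Tr.mulAux_mk]
    refine (Fintype.sum_equiv σ _ _ fun x => ?_).symm
    have h := RTree.graft_relabel σ (Equiv.refl _) T S x
    change (T.relabel σ).graft S (σ x) = _ at h
    rw [h, Tr.of_relabel]
    congr 1
    ext z; rcases z with z | z <;> rfl)

theorem Tr.mulLin_of {α β : Type*} [Fintype α] [Fintype β] (T : RTree α) (t : α → V)
    (S : RTree β) (s : β → V) :
    Tr.mulLin k (Tr.of k T t) (Tr.of k S s) = ∑ x, Tr.of k (T.graft S x) (Sum.elim t s) := by
  have h : ∀ {m n : ℕ} (T : RTree (Fin m)) (t : Fin m → V) (S : RTree (Fin n)) (s : Fin n → V),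
      Tr.mulLin k (Tr.mk k T t) (Tr.mk k S s)
        = ∑ x, Tr.of k (T.graft S x) (Sum.elim t s) := by
    intro m n T t S s
    rw [Tr.mulLin, Tr.lift_mk]
    exact Tr.mulAux_mk k T t S s
  rw [Tr.of, Tr.of, h]
  refine (Fintype.sum_equiv (Fintype.equivFin α) _ _ fun x => ?_).symm
  rw [RTree.graft_relabel, Tr.of_relabel]
  congr 1
  ext z; rcases z with z | z <;> simp

variable (V) in
/-- The space `Tr(V)` as an algebra, with the insertion product. -/
def TrAlg : Type _ := Tr k V

instance : AddCommGroup (TrAlg k V) := inferInstanceAs (AddCommGroup (Tr k V))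

instance : Module k (TrAlg k V) := inferInstanceAs (Module k (Tr k V))

instance : Mul (TrAlg k V) := ⟨fun x y => Tr.mulLin k (V := V) x y⟩

instance : NonUnitalNonAssocRing (TrAlg k V) where
  left_distrib x y z := map_add (Tr.mulLin k (V := V) x) y z
  right_distrib x y z := LinearMap.map_add₂ (Tr.mulLin k (V := V)) x y z
  zero_mul x := LinearMap.map_zero₂ (Tr.mulLin k (V := V)) x
  mul_zero x := map_zero (Tr.mulLin k (V := V) x)

instance : IsScalarTower k (TrAlg k V) (TrAlg k V) :=
  ⟨fun c x y => LinearMap.map_smul₂ (Tr.mulLin k (V := V)) c x y⟩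

instance : SMulCommClass k (TrAlg k V) (TrAlg k V) :=
  ⟨fun c x y => ((Tr.mulLin k (V := V) x).map_smul c y).symm⟩

/-- A decorated tree as an element of the algebra of decorated trees. -/
def TrAlg.of {α : Type*} [Fintype α] (T : RTree α) (v : α → V) : TrAlg k V := Tr.of k T v

theorem TrAlg.of_mul_of {α β : Type*} [Fintype α] [Fintype β] (T : RTree α) (t : α → V)
    (S : RTree β) (s : β → V) :
    TrAlg.of k T t * TrAlg.of k S s = ∑ x, TrAlg.of k (T.graft S x) (Sum.elim t s) :=
  Tr.mulLin_of k T t S s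

theorem TrAlg.of_relabel {α β : Type*} [Fintype α] [Fintype β] (e : α ≃ β) (T : RTree α)
    (v : β → V) : TrAlg.of k (T.relabel e) v = TrAlg.of k T (v ∘ e) := Tr.of_relabel k e T v

theorem TrAlg.induction_on {p : TrAlg k V → Prop} (x : TrAlg k V) (zero : p 0)
    (add : ∀ x y, p x → p y → p (x + y)) (smul : ∀ (c : k) x, p x → p (c • x))
    (of : ∀ n (T : RTree (Fin n)) v, p (TrAlg.of k T v)) : p x :=
  Tr.induction_on k x zero add smul fun n T v => by
    rw [Tr.mk_eq_of]
    exact of n T v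

/-- In `(T ⋆ S) ⋆ U` the tree `U` is joined to a vertex of `T` or of `S`; by `graft_graft_inr` the
second kind is subtracted by `T ⋆ (S ⋆ U)`. -/
theorem TrAlg.associator_of {α β γ : Type*} [Fintype α] [Fintype β] [Fintype γ] (T : RTree α)
    (t : α → V) (S : RTree β) (s : β → V) (U : RTree γ) (u : γ → V) :
    associator (TrAlg.of k T t) (TrAlg.of k S s) (TrAlg.of k U u)
      = ∑ x, ∑ y, TrAlg.of k ((T.graft S x).graft U (Sum.inl y))
          (Sum.elim (Sum.elim t s) u) := by
  simp only [associator, TrAlg.of_mul_of, Finset.sum_mul, Finset.mul_sum, Fintype.sum_sum_type,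
    Finset.sum_add_distrib]
  rw [add_sub_assoc, add_eq_left, sub_eq_zero, Finset.sum_comm]
  refine Finset.sum_congr rfl fun y _ => Finset.sum_congr rfl fun x _ => ?_
  rw [← RTree.graft_graft_inr, TrAlg.of_relabel]
  congr 1
  ext z; rcases z with (z | z) | z <;> rfl

instance : RightPreLieRing (TrAlg k V) where
  assoc_symm' x y z := by
    induction x using TrAlg.induction_on with
    | zero => simp [associator]
    | add a b ha hb => rw [assoc_add₁, assoc_add₁, ha, hb]
    | smul c a ha => rw [assoc_smul₁, assoc_smul₁, ha]
    | of l T t =>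
    induction y using TrAlg.induction_on with
    | zero => simp [associator]
    | add a b ha hb => rw [assoc_add₂, assoc_add₃, ha, hb]
    | smul c a ha => rw [assoc_smul₂, assoc_smul₃, ha]
    | of m S s =>
    induction z using TrAlg.induction_on with
    | zero => simp [associator]
    | add a b ha hb => rw [assoc_add₂, assoc_add₃, ha, hb]
    | smul c a ha => rw [assoc_smul₂, assoc_smul₃, ha]
    | of n U u =>
    rw [TrAlg.associator_of, TrAlg.associator_of, Finset.sum_comm]
    refine Finset.sum_congr rfl fun y _ => Finset.sum_congr rfl fun x _ => ?_
    rw [← RTree.graft_graft_inl, TrAlg.of_relabel]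
    congr 1
    ext z; rcases z with (z | z) | z <;> rfl

instance : RightPreLieAlgebra k (TrAlg k V) where

variable (V) in
/-- The one-vertex trees, as a linear function of the decoration. -/
def TrAlg.gen : V →ₗ[k] TrAlg k V where
  toFun v := TrAlg.of k (RTree.single (Fin 1)) fun _ => v
  map_add' x y := by
    have h := (Tr.ofMultilinear k (RTree.single (Fin 1))).map_update_add (fun _ => (0 : V)) 0 x y
    simp only [Tr.ofMultilinear_apply, update_eq_const_of_subsingleton] at h
    exact h
  map_smul' c x := by
    have h := (Tr.ofMultilinear k (RTree.single (Fin 1))).map_update_smul (fun _ => (0 : V)) 0 c x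
    simp only [Tr.ofMultilinear_apply, update_eq_const_of_subsingleton] at h
    exact h

theorem TrAlg.of_single {α : Type*} [Fintype α] [Unique α] (v : α → V) :
    TrAlg.of k (RTree.single α) v = TrAlg.gen k V (v default) := by
  have h : RTree.single α = (RTree.single (Fin 1)).relabel (Equiv.ofUnique (Fin 1) α) := by
    ext z <;> exact Subsingleton.elim _ _
  rw [h, TrAlg.of_relabel]
  change _ = TrAlg.of k _ _
  congr 1

/-- In the algebra of decorated trees, a decorated tree is the value of the same tree, decorated by
one-vertex trees. -/
theorem TrAlg.ev_gen {α : Type} [Fintype α] (T : RTree α) (v : α → V) :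
    T.ev (fun x => TrAlg.gen k V (v x)) = TrAlg.of k T v := by
  -- Both sides turn products into sums of insertions, the left by `ev_mul_ev` and the right by the
  -- definition of the product, so one-vertex trees suffice.
  refine RTree.eq_of_mul (fun _ _ T v => T.ev fun x => TrAlg.gen k V (v x))
    (fun _ _ T v => TrAlg.of k T v) ?_ (fun _ _ _ _ => TrAlg.of_relabel k) ?_
    (fun _ _ _ _ T t S s => TrAlg.of_mul_of k T t S s) ?_ α T v
  · intro α β _ _ e T v
    exact RTree.ev_relabel e T _
  · intro α β _ _ T t S s
    rw [RTree.ev_mul_ev]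
    refine Finset.sum_congr rfl fun x _ => congrArg _ ?_
    ext z; rcases z with z | z <;> rfl
  · intro α _ _ v
    rw [RTree.ev_single, TrAlg.of_single]

end TrAlg

/-! ### The universal property of the free pre-Lie algebra -/

section Universal

variable {k V : Type*} [Field k] [AddCommGroup V] [Module k V]

theorem FreePreLie.induction_on {p : FreePreLie k V → Prop} (x : FreePreLie k V)
    (gen : ∀ v, p (FreePreLie.gen k V v)) (add : ∀ x y, p x → p y → p (x + y))
    (smul : ∀ (c : k) x, p x → p (c • x)) (mul : ∀ x y, p x → p y → p (x * y)) : p x := by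
  obtain ⟨x, rfl⟩ := quotMk_surjective k _ x
  induction x using MonoidAlgebra.induction_linear with
  | zero =>
    -- The induction principle has no case for zero, which is obtained as `0 • gen 0`.
    have := smul 0 _ (gen 0)
    rwa [zero_smul, ← map_zero (quotMk k {r | PreLieRel k V r})] at this
  | add f g hf hg => rw [map_add]; exact add _ _ hf hg
  | single a b =>
    have : MonoidAlgebra.single a b = b • MonoidAlgebra.ofMagma k _ a := by simp
    rw [this, map_smul]
    refine smul _ _ ?_
    clear this
    induction a with
    | ih1 v => exact gen v
    | ih2 x y hx hy =>
      rw [map_mul (MonoidAlgebra.ofMagma k (FreeMagma V)) x y, map_mul]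
      exact mul _ _ hx hy

variable {A : Type*} [RightPreLieRing A] [RightPreLieAlgebra k A]

/-- The homomorphism from the free pre-Lie algebra induced by a linear map. -/
def FreePreLie.lift (f : V →ₗ[k] A) : FreePreLie k V →ₙₐ[k] A :=
  quotLift k _ (FreeNonUnitalNonAssocAlgebra.lift k f) (by
    intro r hr
    cases hr with
    | add v w => simp [FreeNonUnitalNonAssocAlgebra.lift_of_apply]
    | smul c v => simp [FreeNonUnitalNonAssocAlgebra.lift_of_apply]
    | assoc x y z =>
      rw [map_sub, map_associator', map_associator', RightPreLieRing.assoc_symm', sub_self])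

@[simp]
theorem FreePreLie.lift_gen (f : V →ₗ[k] A) (v : V) :
    FreePreLie.lift f (FreePreLie.gen k V v) = f v :=
  FreeNonUnitalNonAssocAlgebra.lift_of_apply k f v

variable (k V) in
/-- The generators, as a linear map. -/
def FreePreLie.genLin : V →ₗ[k] FreePreLie k V where
  toFun := FreePreLie.gen k V
  map_add' v w := by
    have := (quotMk_eq_zero k {r | PreLieRel k V r} _).2
      (subset_idealSpan k _ (PreLieRel.add v w))
    rw [map_sub, map_sub, sub_sub, sub_eq_zero] at this
    exact this
  map_smul' c v := by
    have := (quotMk_eq_zero k {r | PreLieRel k V r} _).2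
      (subset_idealSpan k _ (PreLieRel.smul c v))
    rw [map_sub, map_smul, sub_eq_zero] at this
    exact this

end Universal

/-! ### The Chapoton–Livernet theorem -/

section ChapotonLivernet

variable {k V : Type*} [Field k] [AddCommGroup V] [Module k V]

section Eval

variable {A : Type*} [RightPreLieRing A] [RightPreLieAlgebra k A]

/-- Evaluation of decorated trees in a pre-Lie algebra `A`, for a linear map `V → A`. -/
def Tr.eval (f : V →ₗ[k] A) : Tr k V →ₗ[k] A :=
  Tr.lift (fun _ T => (T.evMultilinear k).compLinearMap fun _ => f) fun _ σ T v => by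
    simp only [MultilinearMap.compLinearMap_apply, RTree.evMultilinear_apply, RTree.ev_relabel]
    rfl

theorem Tr.eval_of (f : V →ₗ[k] A) {α : Type*} [Fintype α] (T : RTree α) (v : α → V) :
    Tr.eval f (Tr.of k T v) = T.ev fun x => f (v x) := by
  rw [Tr.of, Tr.eval, Tr.lift_mk]
  simp only [MultilinearMap.compLinearMap_apply, RTree.evMultilinear_apply, RTree.ev_relabel]
  congr 1
  ext x
  simp

theorem Tr.eval_mk (f : V →ₗ[k] A) {n : ℕ} (T : RTree (Fin n)) (v : Fin n → V) :
    Tr.eval f (Tr.mk k T v) = T.ev fun x => f (v x) := by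
  rw [Tr.mk_eq_of, Tr.eval_of]

theorem Tr.mk_append {m n : ℕ} (T : RTree (Fin m)) (t : Fin m → V) (S : RTree (Fin n))
    (s : Fin n → V) (x : Fin m) :
    Tr.mk k ((T.graft S x).relabel finSumFinEquiv) (Fin.append t s)
      = Tr.of k (T.graft S x) (Sum.elim t s) := by
  rw [Tr.mk_eq_of, Tr.of_relabel]
  congr 1
  ext z; rcases z with z | z <;> simp

theorem Tr.eval_mul (f : V →ₗ[k] A) {m n : ℕ} (T : RTree (Fin m)) (t : Fin m → V)
    (S : RTree (Fin n)) (s : Fin n → V) :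
    Tr.eval f (∑ x : Fin m, Tr.mk k ((T.graft S x).relabel finSumFinEquiv) (Fin.append t s))
      = Tr.eval f (Tr.mk k T t) * Tr.eval f (Tr.mk k S s) := by
  rw [Tr.eval_mk, Tr.eval_mk, RTree.ev_mul_ev, map_sum]
  refine Finset.sum_congr rfl fun x _ => ?_
  rw [Tr.mk_append, Tr.eval_of]
  congr 1
  ext z; rcases z with z | z <;> rfl

end Eval

variable (k V) in
/-- Evaluation of decorated trees in the free pre-Lie algebra. -/
def treeToFree : Tr k V →ₗ[k] FreePreLie k V := Tr.eval (FreePreLie.genLin k V)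

theorem treeToFree_single (v : V) :
    treeToFree k V (Tr.mk k (RTree.single (Fin 1)) fun _ => v) = FreePreLie.gen k V v := by
  rw [treeToFree, Tr.eval_mk, RTree.ev_single]
  rfl

/-- For uniqueness: with any candidate `e`, the composite `treeToFree ∘ e` is an algebra
endomorphism of `pL(V)`. Bilinearity reduces this to trees, where it is `Tr.eval_mul`. -/
theorem treeToFree_mul {e : FreePreLie k V ≃ₗ[k] Tr k V} (he : ∀ (m n : ℕ) (T : RTree (Fin m))
    (t : Fin m → V) (S : RTree (Fin n)) (s : Fin n → V) (a b : FreePreLie k V),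
      e a = Tr.mk k T t → e b = Tr.mk k S s → e (a * b) =
        ∑ x : Fin m, Tr.mk k ((T.graft S x).relabel finSumFinEquiv) (Fin.append t s))
    (a b : FreePreLie k V) :
    treeToFree k V (e (a * b)) = treeToFree k V (e a) * treeToFree k V (e b) := by
  obtain ⟨x, rfl⟩ := e.symm.surjective a
  obtain ⟨y, rfl⟩ := e.symm.surjective b
  rw [e.apply_symm_apply, e.apply_symm_apply]
  induction x using Tr.induction_on with
  | zero => simp
  | add x x' hx hx' => simp only [map_add, add_mul, hx, hx']
  | smul c x hx => simp only [map_smul, smul_mul_assoc, hx]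
  | mk m T t =>
  induction y using Tr.induction_on with
  | zero => simp
  | add x x' hx hx' => simp only [map_add, mul_add, hx, hx']
  | smul c x hx => simp only [map_smul, mul_smul_comm, hx]
  | mk n S s =>
    rw [he m n T t S s _ _ (e.apply_symm_apply _) (e.apply_symm_apply _)]
    exact Tr.eval_mul _ T t S s

/-- Homomorphisms commute with evaluation (`RTree.map_ev`), and evaluation in `TrAlg` at the
generators gives back the tree (`TrAlg.ev_gen`). -/
theorem lift_treeToFree (x : Tr k V) :
    FreePreLie.lift (TrAlg.gen k V) (treeToFree k V x) = (x : TrAlg k V) := by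
  induction x using Tr.induction_on with
  | zero => rw [map_zero, map_zero]; rfl
  | add x y hx hy => rw [map_add, map_add, hx, hy]; rfl
  | smul c x hx => rw [map_smul, map_smul, hx]; rfl
  | mk n T v =>
    rw [treeToFree, Tr.eval_mk, RTree.map_ev]
    have h : (FreePreLie.lift (TrAlg.gen k V) ∘ fun x => FreePreLie.genLin k V (v x))
        = fun x => TrAlg.gen k V (v x) := by
      ext x
      exact FreePreLie.lift_gen _ _
    rw [h, TrAlg.ev_gen, Tr.mk_eq_of]
    rfl

/-- Injective by the left inverse above. The range is a subspace that contains the generators and,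
since evaluation turns insertion into the product, is closed under products. -/
theorem treeToFree_bijective : Bijective (treeToFree k V) := by
  constructor
  · intro x y h
    rw [← lift_treeToFree x, ← lift_treeToFree y, h]
  · intro x
    induction x using FreePreLie.induction_on with
    | gen v => exact ⟨_, treeToFree_single v⟩
    | add x y hx hy =>
      obtain ⟨a, rfl⟩ := hx
      obtain ⟨b, rfl⟩ := hy
      exact ⟨a + b, map_add _ _ _⟩
    | smul c x hx =>
      obtain ⟨a, rfl⟩ := hx
      exact ⟨c • a, map_smul _ _ _⟩
    | mul x y hx hy =>
      obtain ⟨a, rfl⟩ := hx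
      obtain ⟨b, rfl⟩ := hy
      induction a using Tr.induction_on with
      | zero => exact ⟨0, by simp⟩
      | add x x' hx hx' =>
        obtain ⟨c, hc⟩ := hx
        obtain ⟨d, hd⟩ := hx'
        exact ⟨c + d, by simp only [map_add, add_mul, hc, hd]⟩
      | smul r x hx =>
        obtain ⟨c, hc⟩ := hx
        exact ⟨r • c, by simp only [map_smul, smul_mul_assoc, hc]⟩
      | mk m T t =>
      induction b using Tr.induction_on with
      | zero => exact ⟨0, by simp⟩
      | add x x' hx hx' =>
        obtain ⟨c, hc⟩ := hx
        obtain ⟨d, hd⟩ := hx'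
        exact ⟨c + d, by simp only [map_add, mul_add, hc, hd]⟩
      | smul r x hx =>
        obtain ⟨c, hc⟩ := hx
        exact ⟨r • c, by simp only [map_smul, mul_smul_comm, hc]⟩
      | mk n S s => exact ⟨_, Tr.eval_mul _ T t S s⟩

variable (k V) in
/-- The Chapoton–Livernet isomorphism. -/
def chapotonLivernet : FreePreLie k V ≃ₗ[k] Tr k V :=
  (LinearEquiv.ofBijective (treeToFree k V) treeToFree_bijective).symm

theorem chapotonLivernet_eq_iff {x : FreePreLie k V} {y : Tr k V} :
    chapotonLivernet k V x = y ↔ x = treeToFree k V y :=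
  LinearEquiv.symm_apply_eq _

theorem isChapotonLivernet_chapotonLivernet : IsChapotonLivernet (chapotonLivernet k V) where
  gen v := chapotonLivernet_eq_iff.2 (treeToFree_single v).symm
  mul m n T t S s a b ha hb := by
    rw [chapotonLivernet_eq_iff] at *
    rw [ha, hb]
    exact (Tr.eval_mul _ T t S s).symm

/-- An endomorphism of `pL(V)` that fixes the generators is the identity. So every candidate is the
inverse of `treeToFree`. -/
theorem IsChapotonLivernet.treeToFree_apply {e : FreePreLie k V ≃ₗ[k] Tr k V}
    (he : IsChapotonLivernet e) (x : FreePreLie k V) : treeToFree k V (e x) = x := by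
  induction x using FreePreLie.induction_on with
  | gen v => rw [he.gen, treeToFree_single]
  | add x y hx hy => rw [map_add, map_add, hx, hy]
  | smul c x hx => rw [map_smul, map_smul, hx]
  | mul x y hx hy => rw [treeToFree_mul he.mul, hx, hy]

theorem IsChapotonLivernet.eq {e : FreePreLie k V ≃ₗ[k] Tr k V} (he : IsChapotonLivernet e) :
    e = chapotonLivernet k V :=
  LinearEquiv.ext fun x => (chapotonLivernet_eq_iff.2 (he.treeToFree_apply x).symm).symm

end ChapotonLivernet

/-! ### Square-zero extensions of pre-Lie algebras -/

/-- A bimodule over a right pre-Lie algebra. -/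
structure PreLieBimodule (k A M : Type*) [CommRing k] [RightPreLieRing A] [RightPreLieAlgebra k A]
    [AddCommGroup M] [Module k M] where
  l : A →ₗ[k] M →ₗ[k] M
  r : M →ₗ[k] A →ₗ[k] M
  assoc_right : ∀ m a b, r (r m a) b - r m (a * b) = r (r m b) a - r m (b * a)
  assoc_mid : ∀ a m b, r (l a m) b - l a (r m b) = l (a * b) m - l a (l b m)

namespace PreLieBimodule

variable {k A M : Type*} [CommRing k] [RightPreLieRing A] [RightPreLieAlgebra k A]
    [AddCommGroup M] [Module k M] (B : PreLieBimodule k A M)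

/-- The square-zero extension of a pre-Lie algebra by a bimodule. -/
@[ext]
structure Ext (_ : PreLieBimodule k A M) where
  fst : A
  snd : M

/-- The underlying module of a square-zero extension. -/
def Ext.equivProd : B.Ext ≃ A × M := ⟨fun x => (x.fst, x.snd), fun x => ⟨x.1, x.2⟩, fun _ => rfl,
  fun _ => rfl⟩

instance : AddCommGroup B.Ext := (Ext.equivProd B).addCommGroup

instance : Module k B.Ext := (Ext.equivProd B).module k

instance : Mul B.Ext := ⟨fun x y => ⟨x.1 * y.1, B.l x.1 y.2 + B.r x.2 y.1⟩⟩

theorem mul_fst (x y : B.Ext) : (x * y).1 = x.1 * y.1 := rfl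

theorem mul_snd (x y : B.Ext) : (x * y).2 = B.l x.1 y.2 + B.r x.2 y.1 := rfl

theorem add_fst (x y : B.Ext) : (x + y).1 = x.1 + y.1 := rfl

theorem add_snd (x y : B.Ext) : (x + y).2 = x.2 + y.2 := rfl

theorem sub_fst (x y : B.Ext) : (x - y).1 = x.1 - y.1 := rfl

theorem sub_snd (x y : B.Ext) : (x - y).2 = x.2 - y.2 := rfl

theorem zero_fst : (0 : B.Ext).1 = 0 := rfl

theorem zero_snd : (0 : B.Ext).2 = 0 := rfl

theorem smul_fst (c : k) (x : B.Ext) : (c • x).1 = c • x.1 := rfl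

theorem smul_snd (c : k) (x : B.Ext) : (c • x).2 = c • x.2 := rfl

instance : NonUnitalNonAssocRing B.Ext where
  left_distrib x y z := by
    apply Ext.ext <;> simp only [mul_fst, mul_snd, add_fst, add_snd, mul_add, map_add]
    abel
  right_distrib x y z := by
    apply Ext.ext <;>
    simp only [mul_fst, mul_snd, add_fst, add_snd, add_mul, map_add, LinearMap.add_apply]
    abel
  zero_mul x := by
    apply Ext.ext <;> simp [mul_fst, mul_snd, zero_fst, zero_snd]
  mul_zero x := by
    apply Ext.ext <;> simp [mul_fst, mul_snd, zero_fst, zero_snd]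

instance : IsScalarTower k B.Ext B.Ext :=
  ⟨fun c x y => by
    apply Ext.ext <;> simp [mul_fst, mul_snd, smul_fst, smul_snd, smul_eq_mul, smul_mul_assoc]⟩

instance : SMulCommClass k B.Ext B.Ext :=
  ⟨fun c x y => by
    apply Ext.ext <;> simp [mul_fst, mul_snd, smul_fst, smul_snd, smul_eq_mul, mul_smul_comm]⟩

instance : RightPreLieRing B.Ext where
  assoc_symm' x y z := by
    apply Ext.ext
    · exact RightPreLieRing.assoc_symm' x.1 y.1 z.1
    · change ((x * y) * z - x * (y * z)).snd = ((x * z) * y - x * (z * y)).snd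
      simp only [sub_snd, mul_snd, mul_fst, map_add, LinearMap.add_apply]
      have h1 := B.assoc_right x.2 y.1 z.1
      have h2 := B.assoc_mid x.1 y.2 z.1
      have h3 := B.assoc_mid x.1 z.2 y.1
      rw [← sub_eq_zero] at h1 h2 h3 ⊢
      -- The component in `M` of the pre-Lie identity has three parts, by the position of the
      -- argument from `M`. The third position is the second axiom with the last two arguments
      -- exchanged, hence the minus sign.
      have h := congrArg₂ (· - ·) (congrArg₂ (· + ·) h1 h2) h3
      rw [add_zero, sub_zero] at h
      rw [← h]
      abel

instance : RightPreLieAlgebra k B.Ext where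

variable (k A) in
/-- A pre-Lie algebra as a bimodule over itself. -/
def self : PreLieBimodule k A A where
  l := LinearMap.mul k A
  r := LinearMap.mul k A
  assoc_right m a b := RightPreLieRing.assoc_symm' m a b
  assoc_mid a m b := RightPreLieRing.assoc_symm' a m b

theorem sum_fst {ι : Type*} (s : Finset ι) (f : ι → B.Ext) : (∑ i ∈ s, f i).1 = ∑ i ∈ s, (f i).1 :=
  map_sum (⟨⟨fun x => x.1, rfl⟩, fun _ _ => rfl⟩ : B.Ext →+ A) f s

theorem sum_snd {ι : Type*} (s : Finset ι) (f : ι → B.Ext) : (∑ i ∈ s, f i).2 = ∑ i ∈ s, (f i).2 :=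
  map_sum (⟨⟨fun x => x.2, rfl⟩, fun _ _ => rfl⟩ : B.Ext →+ M) f s

open Classical in
/-- Evaluation of trees over the dual numbers. -/
theorem ev_self {α : Type} [Fintype α] [inst : DecidableEq α] (T : RTree α)
    (v : α → (self k A).Ext) :
    T.ev v = ⟨T.ev fun x => (v x).1, ∑ j, T.ev (update (fun x => (v x).1) j (v j).2)⟩ := by
  obtain rfl : inst = fun a b => propDecidable (a = b) := Subsingleton.elim _ _
  -- The claimed `ε`-part is the derivative of the multilinear map `T.ev`. The Leibniz rule makes
  -- the right-hand side multiplicative, so again one-vertex trees suffice.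
  refine RTree.eq_of_mul (C := (self k A).Ext) (M := (self k A).Ext) (fun _ _ T v => T.ev v)
    (fun _ _ T v => ⟨T.ev fun x => (v x).1,
      ∑ j, T.ev (update (fun x => (v x).1) j (v j).2)⟩)
    (fun _ _ _ _ e T v => RTree.ev_relabel e T v) ?_
    (fun _ _ _ _ T t S s => RTree.ev_mul_ev T S t s) ?_ ?_ α T v
  · intro α β _ _ e T v
    apply Ext.ext
    · exact RTree.ev_relabel e T _
    · refine (Fintype.sum_equiv e _ _ fun j => ?_).symm
      rw [RTree.ev_relabel]
      congr 1
      exact (update_comp_eq_of_injective (fun x => (v x).1) e.injective j (v (e j)).2).symm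
  · intro α β _ _ T t S s
    have h1 : ∀ x : α ⊕ β, (Sum.elim t s x).1
        = Sum.elim (fun x => (t x).1) (fun x => (s x).1) x := by
      rintro (x | x) <;> rfl
    apply Ext.ext
    · rw [sum_fst]
      refine (RTree.ev_mul_ev T S _ _).trans (Finset.sum_congr rfl fun x _ => ?_)
      exact congrArg _ (funext fun z => (h1 z).symm)
    · rw [sum_snd, mul_snd]
      simp only [h1, Fintype.sum_sum_type, Finset.sum_add_distrib, Sum.elim_inl, Sum.elim_inr]
      change LinearMap.mul k A _ _ + LinearMap.mul k A _ _ = _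
      rw [LinearMap.mul_apply', LinearMap.mul_apply', add_comm, Finset.mul_sum, Finset.sum_mul]
      congr 1
      · rw [Finset.sum_comm]
        refine Finset.sum_congr rfl fun j _ => ?_
        rw [RTree.ev_mul_ev]
        refine Finset.sum_congr rfl fun x _ => congrArg _ ?_
        ext (z | z)
        · by_cases h : z = j
          · subst h; simp
          · simp [h]
        · simp
      · rw [Finset.sum_comm]
        refine Finset.sum_congr rfl fun j _ => ?_
        rw [RTree.ev_mul_ev]
        refine Finset.sum_congr rfl fun x _ => congrArg _ ?_
        ext (z | z)
        · simp
        · by_cases h : z = j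
          · subst h; simp
          · simp [h]
  · intro α _ _ v
    apply Ext.ext
    · simp [RTree.ev_single]
    · simp [RTree.ev_single]

end PreLieBimodule

section DegreeOne

variable {k V : Type*} [Field k] [AddCommGroup V] [Module k V]

/-! ### The bimodule `pL¹(V)` -/

theorem GradedPreLie.exists_toGraded (w : FreeMagma (Option V)) (hw : deg w = 0) :
    ∃ a : FreePreLie k V, FreePreLie.toGraded k V a = GradedPreLie.mon k w := by
  induction w with
  | ih1 o =>
    cases o with
    | none => exact absurd hw one_ne_zero
    | some v => exact ⟨_, FreePreLie.toGraded_gen k V v⟩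
  | ih2 x y hx hy =>
    have h : deg x + deg y = 0 := hw
    obtain ⟨a, ha⟩ := hx (by omega)
    obtain ⟨b, hb⟩ := hy (by omega)
    exact ⟨a * b, by rw [map_mul, ha, hb, GradedPreLie.mon_mul]⟩

/-- A monomial of degree one is `∘` or the product of a monomial of degree zero and one of degree
one; thus `∘` generates `pL¹(V)` as a bimodule. -/
theorem homogOne_induction_on {p : GradedPreLie.homog k V 1 → Prop} (x : GradedPreLie.homog k V 1)
    (dummy : p ⟨GradedPreLie.dummy k V, GradedPreLie.dummy_mem k V⟩) (zero : p 0)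
    (add : ∀ x y, p x → p y → p (x + y)) (smul : ∀ (c : k) x, p x → p (c • x))
    (lmul : ∀ a x, p x → p (FreePreLie.lmul k V a x))
    (rmul : ∀ x a, p x → p (FreePreLie.rmul k V x a)) : p x := by
  let G : Submodule k (GradedPreLie.homog k V 1) :=
    ⟨⟨⟨{x | p x}, fun hx hy => add _ _ hx hy⟩, zero⟩, smul⟩
  have hw : ∀ w : FreeMagma (Option V), deg w = 1 →
      ∃ x : GradedPreLie.homog k V 1, p x ∧ (x : GradedPreLie k V) = GradedPreLie.mon k w := by
    intro w hw
    induction w with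
    | ih1 o =>
      cases o with
      | none => exact ⟨_, dummy, rfl⟩
      | some v => exact absurd hw zero_ne_one
    | ih2 x y hx hy =>
      have h : deg x + deg y = 1 := hw
      rcases Nat.add_eq_one_iff.1 h with ⟨h1, h2⟩ | ⟨h1, h2⟩
      · obtain ⟨a, ha⟩ := GradedPreLie.exists_toGraded (k := k) x h1
        obtain ⟨b, hb, hb'⟩ := hy h2
        refine ⟨_, lmul a b hb, ?_⟩
        change FreePreLie.toGraded k V a * (b : GradedPreLie k V) = _
        rw [ha, hb', GradedPreLie.mon_mul]
      · obtain ⟨a, ha⟩ := GradedPreLie.exists_toGraded (k := k) y h2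
        obtain ⟨b, hb, hb'⟩ := hx h1
        refine ⟨_, rmul b a hb, ?_⟩
        change (b : GradedPreLie k V) * FreePreLie.toGraded k V a = _
        rw [ha, hb', GradedPreLie.mon_mul]
  have hle : GradedPreLie.homog k V 1 ≤ G.map (GradedPreLie.homog k V 1).subtype := by
    refine Submodule.span_le.2 ?_
    rintro _ ⟨w, h, rfl⟩
    obtain ⟨x, hx, hx'⟩ := hw w h
    exact ⟨x, hx, hx'⟩
  obtain ⟨y, hy, hyx⟩ := hle x.2
  obtain rfl : y = x := Subtype.ext hyx
  exact hy

variable (k V) in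
/-- The `pL(V)`-bimodule `pL¹(V)`. -/
def homogOneBimodule : PreLieBimodule k (FreePreLie k V) (GradedPreLie.homog k V 1) where
  l := LinearMap.mk₂ k (FreePreLie.lmul k V)
    (fun a b x => Subtype.ext (by simp [FreePreLie.lmul, add_mul]))
    (fun c a x => Subtype.ext (by simp [FreePreLie.lmul, smul_mul_assoc]))
    (fun a x y => Subtype.ext (by simp [FreePreLie.lmul, mul_add]))
    (fun c a x => Subtype.ext (by simp [FreePreLie.lmul, mul_smul_comm]))
  r := LinearMap.mk₂ k (FreePreLie.rmul k V)
    (fun a b x => Subtype.ext (by simp [FreePreLie.rmul, add_mul]))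
    (fun c a x => Subtype.ext (by simp [FreePreLie.rmul, smul_mul_assoc]))
    (fun a x y => Subtype.ext (by simp [FreePreLie.rmul, mul_add]))
    (fun c a x => Subtype.ext (by simp [FreePreLie.rmul, mul_smul_comm]))
  -- In both axioms at least one of the two exchanged elements has degree `0`, so the sign of the
  -- graded identity is `+1`.
  assoc_right m a b := Subtype.ext (by
    have h := GradedPreLie.assoc_homog k V (m : GradedPreLie k V)
      (FreePreLie.toGraded_mem_homog k V a) (FreePreLie.toGraded_mem_homog k V b)
    simpa [associator, FreePreLie.rmul] using h)
  assoc_mid a m b := Subtype.ext (by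
    have h := GradedPreLie.assoc_homog k V (FreePreLie.toGraded k V a) m.2
      (FreePreLie.toGraded_mem_homog k V b)
    simpa [associator, FreePreLie.rmul, FreePreLie.lmul] using h)

theorem homogOneBimodule_l (a : FreePreLie k V) (x : GradedPreLie.homog k V 1) :
    (homogOneBimodule k V).l a x = FreePreLie.lmul k V a x := rfl

theorem homogOneBimodule_r (a : FreePreLie k V) (x : GradedPreLie.homog k V 1) :
    (homogOneBimodule k V).r x a = FreePreLie.rmul k V x a := rfl

/-- The inclusion of a pre-Lie algebra into a square-zero extension. -/
def PreLieBimodule.inl {A M : Type*} [RightPreLieRing A] [RightPreLieAlgebra k A]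
    [AddCommGroup M] [Module k M] (B : PreLieBimodule k A M) : A →ₙₐ[k] B.Ext where
  toFun a := ⟨a, 0⟩
  map_smul' c a := by apply PreLieBimodule.Ext.ext <;> simp [smul_fst, smul_snd]
  map_zero' := rfl
  map_add' a b := by apply PreLieBimodule.Ext.ext <;> simp [add_fst, add_snd]
  map_mul' a b := by apply PreLieBimodule.Ext.ext <;> simp [mul_fst, mul_snd]

/-- The projection of a square-zero extension of a pre-Lie algebra. -/
def PreLieBimodule.proj {A M : Type*} [RightPreLieRing A] [RightPreLieAlgebra k A]
    [AddCommGroup M] [Module k M] (B : PreLieBimodule k A M) : B.Ext →ₙₐ[k] A where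
  toFun a := a.1
  map_smul' _ _ := rfl
  map_zero' := rfl
  map_add' _ _ := rfl
  map_mul' _ _ := rfl

/-- The projection of a square-zero extension to the bimodule. -/
def PreLieBimodule.sndLin {A M : Type*} [RightPreLieRing A] [RightPreLieAlgebra k A]
    [AddCommGroup M] [Module k M] (B : PreLieBimodule k A M) : B.Ext →ₗ[k] M where
  toFun a := a.2
  map_smul' _ _ := rfl
  map_add' _ _ := rfl

theorem ev_eq_zero {α A : Type*} [Fintype α] [RightPreLieRing A] [RightPreLieAlgebra k A]
    (T : RTree α) (v : α → A) (i : α) (hi : v i = 0) : T.ev v = 0 :=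
  (T.evMultilinear k).map_coord_zero i hi

/-! ### Trees with a special vertex in `pL¹(V)` -/

/-- The decorations `v` of the vertices, and the dummy variable at the special vertex, as elements
of the square-zero extension of `pL(V)` by `pL¹(V)`. -/
def decOne {α : Type*} (v : α → V) : Option α → (homogOneBimodule k V).Ext
  | none => ⟨0, ⟨GradedPreLie.dummy k V, GradedPreLie.dummy_mem k V⟩⟩
  | some a => (homogOneBimodule k V).inl (FreePreLie.genLin k V (v a))

theorem decOne_update {α : Type*} [DecidableEq α] (v : α → V) (i : α) (x : V) :
    decOne (k := k) (update v i x)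
      = update (decOne v) (some i) ((homogOneBimodule k V).inl (FreePreLie.genLin k V x)) := by
  ext1 (_ | j)
  · rfl
  · by_cases h : j = i
    · subst h; simp [decOne]
    · simp [decOne, h]

theorem decOne_comp {α β : Type*} (e : α ≃ β) (v : β → V) :
    decOne (k := k) v ∘ e.optionCongr = decOne (v ∘ e) := by
  ext1 (_ | j) <;> rfl

/-- The projection to `pL(V)` takes the decoration of the special vertex to `0`, and evaluation is
multilinear. The value therefore lies in `pL¹(V)`. -/
theorem ev_decOne_fst {α : Type*} [Fintype α] (T : RTree (Option α)) (v : α → V) :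
    (T.ev (decOne (k := k) v)).1 = 0 :=
  (RTree.map_ev (homogOneBimodule k V).proj T (decOne v)).trans
    (ev_eq_zero (k := k) T _ none rfl)

variable (k) in
/-- The value of a tree with a special vertex as a multilinear function of the decorations. -/
def evOne {α : Type*} [Fintype α] (T : RTree (Option α)) :
    MultilinearMap k (fun _ : α => V) (GradedPreLie.homog k V 1) where
  toFun v := (T.ev (decOne v)).2
  map_update_add' v i x y := by
    classical
    have h := (T.evMultilinear k).map_update_add (decOne v) (some i)
      ((homogOneBimodule k V).inl (FreePreLie.genLin k V x))
      ((homogOneBimodule k V).inl (FreePreLie.genLin k V y))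
    rw [← map_add, ← map_add] at h
    simp only [RTree.evMultilinear_apply, ← decOne_update] at h
    have h' := congrArg PreLieBimodule.Ext.snd h
    rw [PreLieBimodule.add_snd] at h'
    convert h'
  map_update_smul' v i c x := by
    classical
    have h := (T.evMultilinear k).map_update_smul (decOne v) (some i) c
      ((homogOneBimodule k V).inl (FreePreLie.genLin k V x))
    rw [← map_smul, ← map_smul] at h
    simp only [RTree.evMultilinear_apply, ← decOne_update] at h
    have h' := congrArg PreLieBimodule.Ext.snd h
    rw [PreLieBimodule.smul_snd] at h'
    convert h'

theorem evOne_apply {α : Type*} [Fintype α] (T : RTree (Option α)) (v : α → V) :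
    evOne k T v = (T.ev (decOne (k := k) v)).2 := rfl

theorem ev_decOne {α : Type*} [Fintype α] (T : RTree (Option α)) (v : α → V) :
    T.ev (decOne (k := k) v) = ⟨0, evOne k T v⟩ :=
  PreLieBimodule.Ext.ext (ev_decOne_fst T v) rfl

variable (k V) in
/-- Evaluation of trees with a special vertex in `pL¹(V)`. -/
def treeToFreeOne : TrOne k V →ₗ[k] GradedPreLie.homog k V 1 :=
  TrOne.lift (fun _ T => evOne k T) fun n σ T v => by
    rw [evOne_apply, RTree.ev_relabel, decOne_comp]
    rfl

theorem treeToFreeOne_mk {n : ℕ} (T : RTree (Option (Fin n))) (v : Fin n → V) :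
    treeToFreeOne k V (TrOne.mk k T v) = evOne k T v := by
  rw [treeToFreeOne, TrOne.lift_mk]

theorem inl_treeToFree {n : ℕ} (T : RTree (Fin n)) (t : Fin n → V) :
    (homogOneBimodule k V).inl (treeToFree k V (Tr.mk k T t))
      = T.ev fun x => (homogOneBimodule k V).inl (FreePreLie.genLin k V (t x)) := by
  rw [treeToFree, Tr.eval_mk, RTree.map_ev]
  rfl

theorem treeToFreeOne_single : treeToFreeOne k V (TrOne.mk k (RTree.single (Option (Fin 0)))
    Fin.elim0) = ⟨GradedPreLie.dummy k V, GradedPreLie.dummy_mem k V⟩ := by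
  rw [treeToFreeOne_mk, evOne_apply, RTree.ev_single]
  rfl

/-- This is `RTree.ev_mul_ev` in the square-zero extension: the factor `(a, 0)` on the left meets
`(0, b)` on the right, and only the left action of `a` on `b` contributes. -/
theorem treeToFreeOne_lmul {m n : ℕ} (T : RTree (Fin m)) (t : Fin m → V)
    (S : RTree (Option (Fin n))) (s : Fin n → V) :
    treeToFreeOne k V (∑ x : Fin m,
      TrOne.mk k ((T.graft S x).relabel (optionSumRight finSumFinEquiv)) (Fin.append t s))
      = FreePreLie.lmul k V (treeToFree k V (Tr.mk k T t))
        (treeToFreeOne k V (TrOne.mk k S s)) := by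
  have h := RTree.ev_mul_ev T S
    (fun x => (homogOneBimodule k V).inl (FreePreLie.genLin k V (t x))) (decOne s)
  rw [← inl_treeToFree, ev_decOne] at h
  have h2 := congrArg PreLieBimodule.Ext.snd h
  rw [PreLieBimodule.mul_snd, PreLieBimodule.sum_snd, map_zero, add_zero] at h2
  rw [map_sum, treeToFreeOne_mk, ← homogOneBimodule_l]
  refine Eq.trans ?_ h2.symm
  refine Finset.sum_congr rfl fun x _ => ?_
  rw [treeToFreeOne_mk, evOne_apply, RTree.ev_relabel]
  congr 2
  ext1 z
  rcases z with z | _ | z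
  · simp [decOne, optionSumRight]
  · rfl
  · simp [decOne, optionSumRight]

theorem treeToFreeOne_rmul {m n : ℕ} (T : RTree (Option (Fin m))) (t : Fin m → V)
    (S : RTree (Fin n)) (s : Fin n → V) :
    treeToFreeOne k V (∑ x : Option (Fin m),
      TrOne.mk k ((T.graft S x).relabel (optionSumLeft finSumFinEquiv)) (Fin.append t s))
      = FreePreLie.rmul k V (treeToFreeOne k V (TrOne.mk k T t))
        (treeToFree k V (Tr.mk k S s)) := by
  have h := RTree.ev_mul_ev T S (decOne t)
    (fun x => (homogOneBimodule k V).inl (FreePreLie.genLin k V (s x)))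
  rw [← inl_treeToFree, ev_decOne] at h
  have h2 := congrArg PreLieBimodule.Ext.snd h
  rw [PreLieBimodule.mul_snd, PreLieBimodule.sum_snd, LinearMap.map_zero₂, zero_add] at h2
  rw [map_sum, treeToFreeOne_mk, ← homogOneBimodule_r]
  refine Eq.trans ?_ h2.symm
  refine Finset.sum_congr rfl fun x _ => ?_
  rw [treeToFreeOne_mk, evOne_apply, RTree.ev_relabel]
  congr 2
  ext1 z
  rcases z with (_ | z) | z
  · rfl
  · simp [decOne, optionSumLeft]
  · simp [decOne, optionSumLeft]

theorem lmul_add (a : FreePreLie k V) (x y : GradedPreLie.homog k V 1) :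
    FreePreLie.lmul k V a (x + y) = FreePreLie.lmul k V a x + FreePreLie.lmul k V a y :=
  map_add ((homogOneBimodule k V).l a) x y

theorem lmul_smul (a : FreePreLie k V) (c : k) (x : GradedPreLie.homog k V 1) :
    FreePreLie.lmul k V a (c • x) = c • FreePreLie.lmul k V a x :=
  map_smul ((homogOneBimodule k V).l a) c x

theorem lmul_zero (a : FreePreLie k V) : FreePreLie.lmul k V a 0 = 0 :=
  map_zero ((homogOneBimodule k V).l a)

theorem add_lmul (a b : FreePreLie k V) (x : GradedPreLie.homog k V 1) :
    FreePreLie.lmul k V (a + b) x = FreePreLie.lmul k V a x + FreePreLie.lmul k V b x :=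
  LinearMap.map_add₂ (homogOneBimodule k V).l a b x

theorem smul_lmul (c : k) (a : FreePreLie k V) (x : GradedPreLie.homog k V 1) :
    FreePreLie.lmul k V (c • a) x = c • FreePreLie.lmul k V a x :=
  LinearMap.map_smul₂ (homogOneBimodule k V).l c a x

theorem zero_lmul (x : GradedPreLie.homog k V 1) : FreePreLie.lmul k V 0 x = 0 :=
  LinearMap.map_zero₂ (homogOneBimodule k V).l x

theorem rmul_add (x : GradedPreLie.homog k V 1) (a b : FreePreLie k V) :
    FreePreLie.rmul k V x (a + b) = FreePreLie.rmul k V x a + FreePreLie.rmul k V x b :=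
  map_add ((homogOneBimodule k V).r x) a b

theorem rmul_smul (x : GradedPreLie.homog k V 1) (c : k) (a : FreePreLie k V) :
    FreePreLie.rmul k V x (c • a) = c • FreePreLie.rmul k V x a :=
  map_smul ((homogOneBimodule k V).r x) c a

theorem rmul_zero (x : GradedPreLie.homog k V 1) : FreePreLie.rmul k V x 0 = 0 :=
  map_zero ((homogOneBimodule k V).r x)

theorem add_rmul (x y : GradedPreLie.homog k V 1) (a : FreePreLie k V) :
    FreePreLie.rmul k V (x + y) a = FreePreLie.rmul k V x a + FreePreLie.rmul k V y a :=
  LinearMap.map_add₂ (homogOneBimodule k V).r x y a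

theorem smul_rmul (c : k) (x : GradedPreLie.homog k V 1) (a : FreePreLie k V) :
    FreePreLie.rmul k V (c • x) a = c • FreePreLie.rmul k V x a :=
  LinearMap.map_smul₂ (homogOneBimodule k V).r c x a

theorem zero_rmul (a : FreePreLie k V) : FreePreLie.rmul k V 0 a = 0 :=
  LinearMap.map_zero₂ (homogOneBimodule k V).r a

/-- The range contains `∘` and is stable under both actions, because every element of `pL(V)` is a
combination of values of trees. -/
theorem treeToFreeOne_surjective : Surjective (treeToFreeOne k V) := by
  intro x
  induction x using homogOne_induction_on with
  | dummy => exact ⟨_, treeToFreeOne_single⟩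
  | zero => exact ⟨0, map_zero _⟩
  | add x y hx hy =>
    obtain ⟨a, rfl⟩ := hx
    obtain ⟨b, rfl⟩ := hy
    exact ⟨a + b, map_add _ _ _⟩
  | smul c x hx =>
    obtain ⟨a, rfl⟩ := hx
    exact ⟨c • a, map_smul _ _ _⟩
  | lmul a x hx =>
    obtain ⟨y, rfl⟩ := hx
    obtain ⟨z, rfl⟩ := treeToFree_bijective.2 a
    induction z using Tr.induction_on with
    | zero => exact ⟨0, by simp only [map_zero, zero_lmul]⟩
    | add z z' h h' =>
      obtain ⟨u, hu⟩ := h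
      obtain ⟨u', hu'⟩ := h'
      exact ⟨u + u', by simp only [map_add, add_lmul, hu, hu']⟩
    | smul c z h =>
      obtain ⟨u, hu⟩ := h
      exact ⟨c • u, by simp only [map_smul, smul_lmul, hu]⟩
    | mk m T t =>
    induction y using TrOne.induction_on with
    | zero => exact ⟨0, by simp only [map_zero, lmul_zero]⟩
    | add z z' h h' =>
      obtain ⟨u, hu⟩ := h
      obtain ⟨u', hu'⟩ := h'
      exact ⟨u + u', by simp only [map_add, lmul_add, hu, hu']⟩
    | smul c z h =>
      obtain ⟨u, hu⟩ := h
      exact ⟨c • u, by simp only [map_smul, lmul_smul, hu]⟩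
    | mk n S s => exact ⟨_, treeToFreeOne_lmul T t S s⟩
  | rmul x a hx =>
    obtain ⟨y, rfl⟩ := hx
    obtain ⟨z, rfl⟩ := treeToFree_bijective.2 a
    induction z using Tr.induction_on with
    | zero => exact ⟨0, by simp only [map_zero, rmul_zero]⟩
    | add z z' h h' =>
      obtain ⟨u, hu⟩ := h
      obtain ⟨u', hu'⟩ := h'
      exact ⟨u + u', by simp only [map_add, rmul_add, hu, hu']⟩
    | smul c z h =>
      obtain ⟨u, hu⟩ := h
      exact ⟨c • u, by simp only [map_smul, rmul_smul, hu]⟩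
    | mk m T t =>
    induction y using TrOne.induction_on with
    | zero => exact ⟨0, by simp only [map_zero, zero_rmul]⟩
    | add z z' h h' =>
      obtain ⟨u, hu⟩ := h
      obtain ⟨u', hu'⟩ := h'
      exact ⟨u + u', by simp only [map_add, add_rmul, hu, hu']⟩
    | smul c z h =>
      obtain ⟨u, hu⟩ := h
      exact ⟨c • u, by simp only [map_smul, smul_rmul, hu]⟩
    | mk n S s => exact ⟨_, treeToFreeOne_rmul S s T t⟩

end DegreeOne

section DegreeOneIso

variable {k V : Type*} [Field k] [AddCommGroup V] [Module k V]

/-! ### Trees with a special vertex as trees decorated by `V × k` -/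

open Classical in
/-- The tree `T`, decorated by pairs in `V × k`, with the vertex `i` made special. -/
def markAt {α : Type*} [Fintype α] (T : RTree α) (i : α) :
    MultilinearMap k (fun _ : α => V × k) (TrOne k V) where
  -- The decoration of `i` enters only through its scalar coordinate, the others only through their
  -- `V`-coordinates; this gives linearity in each.
  toFun w := (w i).2 • TrOne.of k (T.relabel (Equiv.optionSubtypeNe i).symm)
    fun j : {j // j ≠ i} => (w j).1
  map_update_add' {inst} w j x y := by
    obtain rfl : inst = fun a b => propDecidable (a = b) := Subsingleton.elim _ _
    by_cases h : j = i
    · subst h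
      have e : ∀ z : V × k, (fun l : {l // l ≠ j} => (update w j z l).1) = fun l : {l // l ≠ j} => (w l).1 :=
        fun z => funext fun l => by rw [update_of_ne l.2]
      simp only [e, update_self, Prod.snd_add]
      exact add_smul (R := k) (M := TrOne k V) _ _ _
    · have e : ∀ z : V × k, (fun l : {l // l ≠ i} => (update w j z l).1)
          = update (fun l : {l // l ≠ i} => (w l).1) ⟨j, h⟩ z.1 := fun z => funext fun l => by
        by_cases hl : l = ⟨j, h⟩
        · subst hl; simp
        · rw [update_of_ne hl, update_of_ne fun h' => hl (Subtype.ext h')]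
      simp only [e, update_of_ne (Ne.symm h), Prod.fst_add, ← TrOne.ofMultilinear_apply]
      rw [MultilinearMap.map_update_add]
      exact smul_add (M := k) (A := TrOne k V) _ _ _
  map_update_smul' {inst} w j c x := by
    obtain rfl : inst = fun a b => propDecidable (a = b) := Subsingleton.elim _ _
    by_cases h : j = i
    · subst h
      have e : ∀ z : V × k, (fun l : {l // l ≠ j} => (update w j z l).1) = fun l : {l // l ≠ j} => (w l).1 :=
        fun z => funext fun l => by rw [update_of_ne l.2]
      simp only [e, update_self, Prod.smul_snd]
      exact smul_assoc (M := k) (N := k) (α := TrOne k V) _ _ _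
    · have e : ∀ z : V × k, (fun l : {l // l ≠ i} => (update w j z l).1)
          = update (fun l : {l // l ≠ i} => (w l).1) ⟨j, h⟩ z.1 := fun z => funext fun l => by
        by_cases hl : l = ⟨j, h⟩
        · subst hl; simp
        · rw [update_of_ne hl, update_of_ne fun h' => hl (Subtype.ext h')]
      simp only [e, update_of_ne (Ne.symm h), Prod.smul_fst, ← TrOne.ofMultilinear_apply]
      rw [MultilinearMap.map_update_smul]
      exact smul_comm (M := k) (N := k) (α := TrOne k V) _ _ _

open Classical in
theorem markAt_apply {α : Type*} [Fintype α] (T : RTree α) (i : α) (w : α → V × k) :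
    markAt T i w = (w i).2 • TrOne.of k (T.relabel (Equiv.optionSubtypeNe i).symm)
      fun j : {j // j ≠ i} => (w j).1 := rfl

theorem markAt_relabel {α β : Type*} [Fintype α] [Fintype β] (e : α ≃ β) (T : RTree α) (i : α)
    (w : β → V × k) : markAt (T.relabel e) (e i) w = markAt T i (w ∘ e) := by
  classical
  set s : {j // j ≠ i} ≃ {j // j ≠ e i} := e.subtypeEquiv fun a => by simp
  have h : (T.relabel e).relabel (Equiv.optionSubtypeNe (e i)).symm
      = (T.relabel (Equiv.optionSubtypeNe i).symm).relabel s.optionCongr := by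
    rw [RTree.relabel_relabel, RTree.relabel_relabel]
    congr 1
    ext1 x
    obtain ⟨o, rfl⟩ := (Equiv.optionSubtypeNe i).surjective x
    rw [Equiv.trans_apply, Equiv.trans_apply, Equiv.symm_apply_apply, Equiv.symm_apply_eq]
    cases o <;> rfl
  have h2 : TrOne.of k ((T.relabel e).relabel (Equiv.optionSubtypeNe (e i)).symm)
      (fun j : {j // j ≠ e i} => (w j).1)
      = TrOne.of k (T.relabel (Equiv.optionSubtypeNe i).symm)
        (fun j : {j // j ≠ i} => (w (e j)).1) := by
    rw [h, TrOne.of_relabel]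
    rfl
  rw [markAt_apply, markAt_apply]
  congr 1

variable (k V) in
/-- The linear map `Tr(V × k) → Tr¹(V)` that takes a tree to the sum of the trees obtained by making
a vertex special. -/
def markVertex : Tr k (V × k) →ₗ[k] TrOne k V :=
  Tr.lift (fun _ T => ∑ i, markAt T i) fun n σ T w => by
    simp only [sum_apply]
    exact (Fintype.sum_equiv σ _ _ fun i => (markAt_relabel σ T i w).symm).symm

theorem markVertex_of {α : Type*} [Fintype α] (T : RTree α) (w : α → V × k) :
    markVertex k V (Tr.of k T w) = ∑ i, markAt T i w := by
  rw [Tr.of, markVertex, Tr.lift_mk, sum_apply]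
  refine (Fintype.sum_equiv (Fintype.equivFin α) _ _ fun i => ?_).symm
  rw [markAt_relabel]
  congr 1
  ext1 x
  simp

/-- The decorations `v`, and `(0, 1)` at the special vertex. -/
def decPair {α : Type*} (v : α → V) : Option α → V × k
  | none => (0, 1)
  | some a => (v a, 0)

/-- Only the special vertex has a nonzero scalar coordinate, namely `1`, so of all markings just the
original one survives. -/
theorem markVertex_decPair {α : Type*} [Fintype α] (T : RTree (Option α)) (v : α → V) :
    markVertex k V (Tr.of k T (decPair v)) = TrOne.of k T v := by
  classical
  rw [markVertex_of, Fintype.sum_option, Finset.sum_eq_zero, add_zero, markAt_apply]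
  · set s : α ≃ {j : Option α // j ≠ none} :=
      ⟨fun a => ⟨some a, Option.some_ne_none a⟩, fun j => j.1.get (Option.ne_none_iff_isSome.1 j.2),
        fun _ => rfl, fun j => Subtype.ext (Option.some_get _)⟩
    have h : T.relabel (Equiv.optionSubtypeNe none).symm = T.relabel s.optionCongr := by
      congr 1
      ext1 x
      rw [Equiv.symm_apply_eq]
      cases x <;> rfl
    have h2 : TrOne.of k (T.relabel (Equiv.optionSubtypeNe none).symm)
        (fun j : {j // j ≠ none} => (decPair (k := k) v j).1) = TrOne.of k T v := by
      rw [h, TrOne.of_relabel]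
      rfl
    refine (one_smul k (_ : TrOne k V)).trans ?_
    convert h2
  · intro i _
    rw [markAt_apply]
    exact zero_smul k (_ : TrOne k V)

/-! ### The map from `pL(V, ∘)` to the dual numbers over trees -/

variable (k V) in
/-- The algebra of trees decorated by `V × k`, over the dual numbers. -/
abbrev DualTr : Type _ := (PreLieBimodule.self k (TrAlg k (V × k))).Ext

variable (k V) in
/-- The images of the generators of `pL(V, ∘)`. -/
def dualGen : Option V → DualTr k V
  | none => ⟨0, TrAlg.gen k (V × k) (0, 1)⟩
  | some v => (PreLieBimodule.self k (TrAlg k (V × k))).inl (TrAlg.gen k (V × k) (v, 0))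

/-- A monomial in which `∘` occurs is sent to a multiple of `ε`. -/
theorem lift_monom_fst (w : FreeMagma (Option V)) (hw : deg w ≠ 0) :
    (FreeNonUnitalNonAssocAlgebra.lift k (dualGen k V) (monom k w)).1 = 0 := by
  induction w with
  | ih1 o =>
    have e : FreeNonUnitalNonAssocAlgebra.lift k (dualGen k V) (monom k (FreeMagma.of o))
        = dualGen k V o := FreeNonUnitalNonAssocAlgebra.lift_of_apply k _ o
    rw [e]
    cases o with
    | none => rfl
    | some v => exact absurd rfl hw
  | ih2 x y hx hy =>
    have h : deg x + deg y ≠ 0 := hw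
    change (FreeNonUnitalNonAssocAlgebra.lift k (dualGen k V) (monom k (x * y))).1 = 0
    rw [GradedPreLie.monom_mul, map_mul, PreLieBimodule.mul_fst]
    by_cases hx' : deg x = 0
    · rw [hy (by omega), mul_zero]
    · rw [hx hx', zero_mul]

variable (k V) in
/-- The homomorphism from `pL(V, ∘)` to the dual numbers over trees decorated by `V × k`. -/
def gradedToDual : GradedPreLie k V →ₙₐ[k] DualTr k V :=
  quotLift k _ (FreeNonUnitalNonAssocAlgebra.lift k (dualGen k V)) (by
    intro r hr
    cases hr with
    | add v w =>
      have h : (v + w, (0 : k)) = (v, 0) + (w, 0) := by simp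
      simp only [map_sub, FreeNonUnitalNonAssocAlgebra.lift_of_apply, dualGen]
      rw [h, map_add, map_add, sub_sub, sub_self]
    | smul c v =>
      have h : (c • v, (0 : k)) = c • (v, 0) := by simp
      simp only [map_sub, map_smul, FreeNonUnitalNonAssocAlgebra.lift_of_apply, dualGen]
      rw [h, map_smul, map_smul, sub_self]
    | assoc x y z =>
      rw [map_sub, map_smul, map_associator', map_associator']
      -- If the product of the degrees is zero, the sign is `+1` and the ordinary pre-Lie identity
      -- applies. Otherwise both `y` and `z` go to multiples of `ε`, and both associators contain
      -- `ε² = 0`.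
      by_cases h : deg y * deg z = 0
      · rw [h, pow_zero, one_smul, RightPreLieRing.assoc_symm', sub_self]
      · rw [Nat.mul_eq_zero, not_or] at h
        have hy := lift_monom_fst (k := k) y h.1
        have hz := lift_monom_fst (k := k) z h.2
        have e : ∀ X Y Z : DualTr k V, Y.1 = 0 → Z.1 = 0 → associator X Y Z = 0 := by
          intro X Y Z hY hZ
          rw [associator]
          apply PreLieBimodule.Ext.ext
          · simp [PreLieBimodule.sub_fst, PreLieBimodule.mul_fst, hY, hZ, PreLieBimodule.zero_fst]
          · simp [PreLieBimodule.sub_snd, PreLieBimodule.mul_fst, PreLieBimodule.mul_snd, hY, hZ,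
              PreLieBimodule.zero_snd]
        rw [e _ _ _ hy hz, e _ _ _ hz hy, smul_zero, sub_zero])

theorem gradedToDual_dummy : gradedToDual k V (GradedPreLie.dummy k V) = dualGen k V none :=
  FreeNonUnitalNonAssocAlgebra.lift_of_apply k _ _

theorem gradedToDual_gen (v : V) :
    gradedToDual k V (GradedPreLie.gen k V v) = dualGen k V (some v) :=
  FreeNonUnitalNonAssocAlgebra.lift_of_apply k _ _

theorem gradedToDual_fst {x : GradedPreLie k V} (hx : x ∈ GradedPreLie.homog k V 1) :
    (gradedToDual k V x).1 = 0 := by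
  induction hx using Submodule.span_induction with
  | zero => rw [map_zero]; rfl
  | add a b _ _ ha hb => rw [map_add, PreLieBimodule.add_fst, ha, hb, add_zero]
  | smul c a _ ha => rw [map_smul, PreLieBimodule.smul_fst, ha, smul_zero]
  | mem x hx =>
    obtain ⟨w, hw, rfl⟩ := hx
    exact lift_monom_fst w (by omega)

variable (k V) in
/-- The same map on the square-zero extension of `pL(V)` by `pL¹(V)`. -/
def extToDual : (homogOneBimodule k V).Ext →ₙₐ[k] DualTr k V where
  toFun x := gradedToDual k V (FreePreLie.toGraded k V x.1) + gradedToDual k V x.2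
  map_smul' c x := by
    simp [PreLieBimodule.smul_fst, PreLieBimodule.smul_snd]
  map_zero' := by
    simp [PreLieBimodule.zero_fst, PreLieBimodule.zero_snd]
  map_add' x y := by
    simp only [PreLieBimodule.add_fst, PreLieBimodule.add_snd, map_add, Submodule.coe_add]
    abel
  map_mul' x y := by
    -- Products of two elements of degree one are zero in the square-zero extension; their images
    -- are multiples of `ε`, so they also multiply to zero.
    have h : gradedToDual k V x.2 * gradedToDual k V y.2 = 0 := by
      have hx := gradedToDual_fst x.2.2
      have hy := gradedToDual_fst y.2.2
      apply PreLieBimodule.Ext.ext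
      · simp [PreLieBimodule.mul_fst, hx, PreLieBimodule.zero_fst]
      · simp [PreLieBimodule.mul_snd, hx, hy, PreLieBimodule.zero_snd]
    rw [add_mul, mul_add, mul_add, h, add_zero, PreLieBimodule.mul_fst, PreLieBimodule.mul_snd,
      homogOneBimodule_l, homogOneBimodule_r, Submodule.coe_add, map_add, map_mul, map_mul,
      add_assoc]
    congr 1
    exact congrArg₂ (· + ·) (map_mul (gradedToDual k V) _ _) (map_mul (gradedToDual k V) _ _)

theorem extToDual_decOne {α : Type*} (v : α → V) (o : Option α) :
    extToDual k V (decOne v o) = dualGen k V (o.map v) := by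
  cases o with
  | none =>
    change gradedToDual k V (FreePreLie.toGraded k V 0) + gradedToDual k V (GradedPreLie.dummy k V)
      = _
    rw [map_zero, map_zero, zero_add, gradedToDual_dummy]
    rfl
  | some a =>
    change gradedToDual k V (FreePreLie.toGraded k V (FreePreLie.gen k V (v a)))
      + gradedToDual k V ((0 : GradedPreLie.homog k V 1) : GradedPreLie k V) = _
    rw [FreePreLie.toGraded_gen, gradedToDual_gen, ZeroMemClass.coe_zero, map_zero, add_zero]
    rfl

/-- By `ev_self` the coefficient of `ε` is a sum over the vertices whose decoration is replaced by
its `ε`-part. Unless this is the special vertex, the special vertex keeps the decoration `0` and the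
term vanishes. The remaining term is the tree itself by `TrAlg.ev_gen`. -/
theorem gradedToDual_evOne {α : Type} [Fintype α] (T : RTree (Option α)) (v : α → V) :
    (gradedToDual k V (evOne k T v)).2 = TrAlg.of k T (decPair v) := by
  classical
  have h1 : extToDual k V (T.ev (decOne v)) = gradedToDual k V (evOne k T v) := by
    rw [ev_decOne]
    change gradedToDual k V (FreePreLie.toGraded k V 0) + _ = _
    rw [map_zero, map_zero, zero_add]
  have h2 : (extToDual k V ∘ decOne v) = fun o : Option α => dualGen k V (o.map v) :=
    funext fun o => extToDual_decOne v o
  rw [← h1, RTree.map_ev, h2, PreLieBimodule.ev_self]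
  change ∑ j, _ = _
  rw [Fintype.sum_option, Finset.sum_eq_zero, add_zero, ← TrAlg.ev_gen]
  · congr 1
    ext1 o
    cases o with
    | none => exact update_self _ _ _
    | some a => exact update_of_ne (Option.some_ne_none a) _ _
  · intro j _
    exact ev_eq_zero (k := k) T _ none (update_of_ne (Option.some_ne_none j).symm _ _)

variable (k V) in
/-- The inverse of `treeToFreeOne`. -/
def freeToTreeOne : GradedPreLie.homog k V 1 →ₗ[k] TrOne k V :=
  markVertex k V ∘ₗ (PreLieBimodule.self k (TrAlg k (V × k))).sndLin
    ∘ₗ (gradedToDual k V : GradedPreLie k V →ₗ[k] DualTr k V)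
    ∘ₗ (GradedPreLie.homog k V 1).subtype

theorem freeToTreeOne_treeToFreeOne (x : TrOne k V) :
    freeToTreeOne k V (treeToFreeOne k V x) = x := by
  have h : freeToTreeOne k V ∘ₗ treeToFreeOne k V = LinearMap.id :=
    TrOne.hom_ext fun n T v => by
      rw [LinearMap.comp_apply, treeToFreeOne_mk]
      change markVertex k V (gradedToDual k V (evOne k T v)).2 = TrOne.mk k T v
      rw [gradedToDual_evOne]
      exact (markVertex_decPair T v).trans (TrOne.mk_eq_of k T v).symm
  exact LinearMap.congr_fun h x

variable (k V) in
/-- The Chapoton–Livernet isomorphism for trees with a special vertex. -/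
def chapotonLivernetOne : GradedPreLie.homog k V 1 ≃ₗ[k] TrOne k V :=
  (LinearEquiv.ofBijective (treeToFreeOne k V)
    ⟨LeftInverse.injective freeToTreeOne_treeToFreeOne, treeToFreeOne_surjective⟩).symm

theorem chapotonLivernetOne_eq_iff {x : GradedPreLie.homog k V 1} {y : TrOne k V} :
    chapotonLivernetOne k V x = y ↔ x = treeToFreeOne k V y :=
  LinearEquiv.symm_apply_eq _

theorem IsChapotonLivernet.isChapotonLivernetOne {e : FreePreLie k V ≃ₗ[k] Tr k V}
    (he : IsChapotonLivernet e) : IsChapotonLivernetOne e (chapotonLivernetOne k V) where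
  dummy := chapotonLivernetOne_eq_iff.2 treeToFreeOne_single.symm
  mul_left m n T t S s a b ha hb := by
    rw [chapotonLivernetOne_eq_iff] at hb ⊢
    rw [treeToFreeOne_lmul, ← ha, he.treeToFree_apply, hb]
  mul_right m n T t S s a b ha hb := by
    rw [chapotonLivernetOne_eq_iff] at ha ⊢
    rw [treeToFreeOne_rmul, ← hb, he.treeToFree_apply, ha]

/-! ### Uniqueness of the isomorphism in degree one -/

section Unique

variable {e : FreePreLie k V ≃ₗ[k] Tr k V} {e₁ : GradedPreLie.homog k V 1 ≃ₗ[k] TrOne k V}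

theorem IsChapotonLivernetOne.treeToFreeOne_lmul_apply (he : IsChapotonLivernet e)
    (h : IsChapotonLivernetOne e e₁) (a : FreePreLie k V) (b : GradedPreLie.homog k V 1) :
    treeToFreeOne k V (e₁ (FreePreLie.lmul k V a b))
      = FreePreLie.lmul k V a (treeToFreeOne k V (e₁ b)) := by
  obtain ⟨x, rfl⟩ := e.symm.surjective a
  obtain ⟨y, rfl⟩ := e₁.symm.surjective b
  rw [e₁.apply_symm_apply]
  induction x using Tr.induction_on with
  | zero => simp only [map_zero, zero_lmul]
  | add x x' hx hx' => simp only [map_add, add_lmul, hx, hx']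
  | smul c x hx => simp only [map_smul, smul_lmul, hx]
  | mk m T t =>
  induction y using TrOne.induction_on with
  | zero => simp only [map_zero, lmul_zero]
  | add x x' hx hx' => simp only [map_add, lmul_add, hx, hx']
  | smul c x hx => simp only [map_smul, lmul_smul, hx]
  | mk n S s =>
    rw [h.mul_left m n T t S s _ _ (e.apply_symm_apply _) (e₁.apply_symm_apply _),
      treeToFreeOne_lmul]
    conv_rhs => rw [← he.treeToFree_apply (e.symm _), e.apply_symm_apply]

theorem IsChapotonLivernetOne.treeToFreeOne_rmul_apply (he : IsChapotonLivernet e)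
    (h : IsChapotonLivernetOne e e₁) (b : GradedPreLie.homog k V 1) (a : FreePreLie k V) :
    treeToFreeOne k V (e₁ (FreePreLie.rmul k V b a))
      = FreePreLie.rmul k V (treeToFreeOne k V (e₁ b)) a := by
  obtain ⟨x, rfl⟩ := e.symm.surjective a
  obtain ⟨y, rfl⟩ := e₁.symm.surjective b
  rw [e₁.apply_symm_apply]
  induction x using Tr.induction_on with
  | zero => simp only [map_zero, rmul_zero]
  | add x x' hx hx' => simp only [map_add, rmul_add, hx, hx']
  | smul c x hx => simp only [map_smul, rmul_smul, hx]
  | mk m T t =>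
  induction y using TrOne.induction_on with
  | zero => simp only [map_zero, zero_rmul]
  | add x x' hx hx' => simp only [map_add, add_rmul, hx, hx']
  | smul c x hx => simp only [map_smul, smul_rmul, hx]
  | mk n S s =>
    rw [h.mul_right n m S s T t _ _ (e₁.apply_symm_apply _) (e.apply_symm_apply _),
      treeToFreeOne_rmul]
    conv_rhs => rw [← he.treeToFree_apply (e.symm _), e.apply_symm_apply]

/-- The composite `treeToFreeOne ∘ e₁` fixes `∘` and commutes with both actions of `pL(V)`, and `∘`
generates. -/
theorem IsChapotonLivernetOne.treeToFreeOne_apply (he : IsChapotonLivernet e)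
    (h : IsChapotonLivernetOne e e₁) (x : GradedPreLie.homog k V 1) :
    treeToFreeOne k V (e₁ x) = x := by
  induction x using homogOne_induction_on with
  | dummy => rw [h.dummy, treeToFreeOne_single]
  | zero => rw [map_zero, map_zero]
  | add x y hx hy => rw [map_add, map_add, hx, hy]
  | smul c x hx => rw [map_smul, map_smul, hx]
  | lmul a x hx => rw [h.treeToFreeOne_lmul_apply he, hx]
  | rmul x a hx => rw [h.treeToFreeOne_rmul_apply he, hx]

theorem IsChapotonLivernetOne.eq (he : IsChapotonLivernet e) (h : IsChapotonLivernetOne e e₁) :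
    e₁ = chapotonLivernetOne k V :=
  LinearEquiv.ext fun x =>
    (chapotonLivernetOne_eq_iff.2 (h.treeToFreeOne_apply he x).symm).symm

end Unique

end DegreeOneIso

/-! ### The blow-ups of a tree -/

namespace RTree

section BlowUp

variable {α β : Type*}

theorem exists_iterate_eq {p : β → β} {r : β} (μ : β → ℕ) (h : ∀ x, x ≠ r → μ (p x) < μ x)
    (x : β) : ∃ m : ℕ, p^[m] x = r := by
  induction hn : μ x using Nat.strong_induction_on generalizing x with
  | _ n ih =>
    by_cases hx : x = r
    · exact ⟨0, hx⟩
    · obtain ⟨m, hm⟩ := ih (μ (p x)) (hn ▸ h x hx) (p x) rfl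
      exact ⟨m + 1, hm⟩

theorem eq_root_of_parent_eq {T : RTree α} {x : α} (h : T.parent x = x) : x = T.root := by
  obtain ⟨m, hm⟩ := T.reach x
  rw [iterate_fixed h] at hm
  exact hm

theorem parent_ne_self {T : RTree α} {x : α} (h : x ≠ T.root) : T.parent x ≠ x :=
  fun h' => h (eq_root_of_parent_eq h')

open Classical in
/-- The blow-up of `T` at the vertex `y` in which `y` is joined to the special vertex by an edge
that leads to the special vertex; the children of `y` that belong to `A` are moved to the special
vertex. -/
def blowIn (T : RTree α) (y : α) (A : Finset α) : RTree (Option α) where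
  root := if y = T.root then none else some T.root
  parent
    | none => if y = T.root then none else some (T.parent y)
    -- The conditions besides `z ∈ A` produce a tree for every finite set `A`; for a set of children
    -- of `y` they hold automatically.
    | some z => if z = y ∨ z ≠ T.root ∧ T.parent z = y ∧ z ∈ A then none else some (T.parent z)
  parent_root := by
    by_cases h : y = T.root
    · simp [h]
    · simp [h, Ne.symm h, T.parent_root]
  -- Doubled depths leave room for the special vertex: here it lies strictly between `y`, at `2 *
  -- depth y + 1`, and the parent of `y`.
  reach := exists_iterate_eq (fun | none => 2 * T.depth y | some z => 2 * T.depth z + 1) (by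
    rintro (_ | z) hx
    · by_cases h : y = T.root
      · simp [h] at hx
      · have := T.depth_parent h
        simp only [h, if_false]
        omega
    · by_cases hz : z = y
      · simp [hz]
      · by_cases h : z ≠ T.root ∧ T.parent z = y ∧ z ∈ A
        · have := T.depth_parent h.1
          simp only [h.2.1] at this
          simp only [h, ne_eq, not_false_iff, and_self, or_true, if_true]
          omega
        · have hr : z ≠ T.root := by
            rintro rfl
            rw [if_neg (Ne.symm hz)] at hx
            exact hx rfl
          have := T.depth_parent hr
          simp only [hz, h, false_or, if_false]
          omega)

open Classical in
/-- The blow-up of `T` at the vertex `y` in which `y` is joined to the special vertex by an edge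
that leads to `y`; the children of `y` that belong to `A` are moved to the special vertex. -/
def blowOut (T : RTree α) (y : α) (A : Finset α) : RTree (Option α) where
  root := some T.root
  parent
    | none => some y
    | some z => if z ≠ T.root ∧ T.parent z = y ∧ z ∈ A then none else some (T.parent z)
  parent_root := by simp [T.parent_root]
  -- Here the special vertex lies strictly between `y`, at `2 * depth y`, and the children of `y`.
  reach := exists_iterate_eq (fun | none => 2 * T.depth y + 1 | some z => 2 * T.depth z) (by
    rintro (_ | z) hx
    · simp
    · have hz : z ≠ T.root := by rintro rfl; exact hx rfl
      have := T.depth_parent hz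
      by_cases h : T.parent z = y ∧ z ∈ A
      · simp only [h.1] at this
        simp only [hz, h, ne_eq, not_false_iff, and_self, if_true]
        omega
      · simp only [h, and_false, if_false]
        omega)

theorem blowIn_parent_self (T : RTree α) (y : α) (A : Finset α) :
    (T.blowIn y A).parent (some y) = none := by simp [blowIn]

theorem blowOut_parent_none (T : RTree α) (y : α) (A : Finset α) :
    (T.blowOut y A).parent none = some y := rfl

theorem blowOut_parent_self (T : RTree α) (y : α) (A : Finset α) :
    (T.blowOut y A).parent (some y) = some (T.parent y) :=
  if_neg fun h => parent_ne_self h.1 h.2.1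

theorem contract_blowIn (T : RTree α) (y : α) (A : Finset α) :
    (T.blowIn y A).contract y (Or.inl (T.blowIn_parent_self y A)) = T := by
  classical
  ext z
  · by_cases h : y = T.root <;> simp [contract, blowIn, merge, h]
  · by_cases hz : z = y
    · subst hz
      by_cases h : z = T.root
      · simp [contract, contractParent, blowIn, merge, h, T.parent_root]
      · simp [contract, contractParent, blowIn, merge, h]
    · by_cases h : z ≠ T.root ∧ T.parent z = y ∧ z ∈ A
      · simp [contract, contractParent, blowIn, merge, hz, h]
      · simp [contract, contractParent, blowIn, merge, hz, h]

theorem contract_blowOut (T : RTree α) (y : α) (A : Finset α) :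
    (T.blowOut y A).contract y (Or.inr (T.blowOut_parent_none y A)) = T := by
  classical
  ext z
  · rfl
  · change contractParent _ y z = _
    rw [contractParent, blowOut_parent_self]
    by_cases h : z ≠ T.root ∧ T.parent z = y ∧ z ∈ A
    · simp [blowOut, merge, h]
    · simp [blowOut, merge, h]

theorem root_contract {S : RTree (Option α)} {y : α} (h : S.IsSpecial y) :
    (S.contract y h).root = merge y S.root := rfl

theorem parent_contract_of_in {S : RTree (Option α)} {y : α} (h : S.IsSpecial y)
    (hy : S.parent (some y) = none) : (S.contract y h).parent y = merge y (S.parent none) :=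
  if_pos ⟨rfl, hy⟩

theorem parent_contract_of_ne {S : RTree (Option α)} {y z : α} (h : S.IsSpecial y)
    (hz : z ≠ y) : (S.contract y h).parent z = merge y (S.parent (some z)) :=
  if_neg fun h' => hz h'.1

theorem parent_contract_of_out {S : RTree (Option α)} {y : α} (h : S.IsSpecial y)
    (hy : S.parent (some y) ≠ none) (z : α) :
    (S.contract y h).parent z = merge y (S.parent (some z)) :=
  if_neg fun h' => hy h'.2

/-- The root of the contraction is `y` if the special vertex was the root, and otherwise a vertex
fixed by `parent`; `z` is neither. -/
theorem ne_root_of_moved {S : RTree (Option α)} {y z : α} (h : S.IsSpecial y) (hz : z ≠ y)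
    (hS : S.parent (some z) = none) : z ≠ (S.contract y h).root := by
  rw [root_contract]
  intro hr
  cases hS' : S.root with
  | none => rw [hS'] at hr; exact hz hr
  | some w =>
    have := S.parent_root
    rw [hS'] at hr this
    obtain rfl : z = w := hr
    rw [this] at hS
    cases hS

open Classical in
/-- The vertices other than `y` joined to the special vertex by an edge that leads there. -/
def moved [Fintype α] (S : RTree (Option α)) (y : α) : Finset α :=
  Finset.univ.filter fun z => z ≠ y ∧ S.parent (some z) = none

theorem mem_moved [Fintype α] {S : RTree (Option α)} {y z : α} :
    z ∈ S.moved y ↔ z ≠ y ∧ S.parent (some z) = none := by simp [moved]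

/-- Contraction forgets only the direction of the edge and which vertices besides `y` led to the
special vertex; with the direction given, these vertices determine `S`. -/
theorem eq_blowIn [Fintype α] {S : RTree (Option α)} {T : RTree α} {y : α} (h : S.IsSpecial y)
    (hT : S.contract y h = T) (hy : S.parent (some y) = none) : S = T.blowIn y (S.moved y) := by
  have h1 : T.root = merge y S.root := by rw [← hT, root_contract]
  have h2 : T.parent y = merge y (S.parent none) := by rw [← hT, parent_contract_of_in h hy]
  have h3 : ∀ z, z ≠ y → T.parent z = merge y (S.parent (some z)) := fun z hz => by
    rw [← hT, parent_contract_of_ne h hz]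
  have h4 : ∀ z ∈ S.moved y, z ≠ T.root := fun z hz => by
    rw [← hT]
    exact ne_root_of_moved h (mem_moved.1 hz).1 (mem_moved.1 hz).2
  have hr : S.root ≠ some y := fun h' => by
    have := S.parent_root
    rw [h', hy] at this
    cases this
  have hroot : y = T.root ↔ S.root = none := by
    rw [h1]
    cases hS : S.root with
    | none => simp [merge]
    | some w => rw [hS] at hr; simpa [merge, eq_comm] using hr
  ext1
  · simp only [blowIn, hroot]
    split_ifs with h'
    · exact h'
    · rw [h1]
      cases hS : S.root with
      | none => exact absurd hS h'
      | some w => rfl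
  · funext x
    cases x with
    | none =>
      simp only [blowIn, hroot]
      split_ifs with h'
      · rw [← h', S.parent_root]
      · rw [h2]
        cases hS : S.parent none with
        | none => exact absurd (eq_root_of_parent_eq hS).symm h'
        | some w => rfl
    | some z =>
      simp only [blowIn]
      by_cases hz : z = y
      · rw [if_pos (Or.inl hz), hz, hy]
      · cases hS : S.parent (some z) with
        | none =>
          have hm : z ∈ S.moved y := mem_moved.2 ⟨hz, hS⟩
          rw [if_pos (Or.inr ⟨h4 z hm, by rw [h3 z hz, hS]; rfl, hm⟩)]
        | some w =>
          have hm : z ∉ S.moved y := fun hm => by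
            have := (mem_moved.1 hm).2
            rw [hS] at this
            cases this
          rw [if_neg (by simp [hz, hm]), h3 z hz, hS]
          rfl

theorem eq_blowOut [Fintype α] {S : RTree (Option α)} {T : RTree α} {y : α} (h : S.IsSpecial y)
    (hT : S.contract y h = T) (hy : S.parent (some y) ≠ none) : S = T.blowOut y (S.moved y) := by
  have hn : S.parent none = some y := h.resolve_left hy
  have h1 : some T.root = S.root := by
    rw [← hT, root_contract]
    cases hS : S.root with
    | none =>
      have := S.parent_root
      rw [hS, hn] at this
      cases this
    | some w => rfl
  have h3 : ∀ z, T.parent z = merge y (S.parent (some z)) := fun z => by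
    rw [← hT, parent_contract_of_out h hy]
  have h4 : ∀ z ∈ S.moved y, z ≠ T.root := fun z hz => by
    rw [← hT]
    exact ne_root_of_moved h (mem_moved.1 hz).1 (mem_moved.1 hz).2
  ext1
  · exact h1.symm
  · funext x
    cases x with
    | none => exact hn
    | some z =>
      simp only [blowOut]
      cases hS : S.parent (some z) with
      | none =>
        have hm : z ∈ S.moved y := mem_moved.2 ⟨fun hz => hy (hz ▸ hS), hS⟩
        rw [if_pos ⟨h4 z hm, by rw [h3 z, hS]; rfl, hm⟩]
      | some w =>
        have hm : z ∉ S.moved y := fun hm => by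
          have := (mem_moved.1 hm).2
          rw [hS] at this
          cases this
        rw [if_neg (by simp [hm]), h3 z, hS]
        rfl

variable [Fintype α]

theorem notMem_of_subset_children {T : RTree α} {y : α} {A : Finset α} (hA : A ⊆ T.children y) :
    y ∉ A :=
  fun h => parent_ne_self (mem_children.1 (hA h)).1 (mem_children.1 (hA h)).2

/-- The edge from `y` is itself incoming at the special vertex, hence the `+ 1`, and arity at least
`2` means `1 ≤ A.card`. In `blowOut` that edge is outgoing, and the condition is `2 ≤ A.card`. -/
theorem arity_blowIn (T : RTree α) {y : α} {A : Finset α} (hA : A ⊆ T.children y) :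
    (T.blowIn y A).arity none = A.card + 1 := by
  classical
  have hy := notMem_of_subset_children hA
  have : {z | z ≠ (T.blowIn y A).root ∧ (T.blowIn y A).parent z = none}
      = ((insert y A).map .some : Finset (Option α)) := by
    ext x
    rcases x with _ | z
    · by_cases h : y = T.root <;> simp [blowIn, h]
    · by_cases hz : z = y
      · subst hz
        by_cases h : z = T.root <;> simp [blowIn, h]
      · by_cases h : z ∈ A
        · have h' := mem_children.1 (hA h)
          by_cases h'' : y = T.root
          · simp [blowIn, h', h, h'']
          · simp [blowIn, h', h, h'']
        · simp [blowIn, hz, h]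
  rw [arity, this, Set.ncard_coe_finset, Finset.card_map, Finset.card_insert_of_notMem hy]

theorem arity_blowOut (T : RTree α) {y : α} {A : Finset α} (hA : A ⊆ T.children y) :
    (T.blowOut y A).arity none = A.card := by
  classical
  have : {z | z ≠ (T.blowOut y A).root ∧ (T.blowOut y A).parent z = none}
      = (A.map .some : Finset (Option α)) := by
    ext x
    rcases x with _ | z
    · simp [blowOut]
    · by_cases h : z ∈ A
      · have h' := mem_children.1 (hA h)
        simp [blowOut, h, h']
      · simp [blowOut, h]
  rw [arity, this, Set.ncard_coe_finset, Finset.card_map]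

theorem moved_blowIn (T : RTree α) {y : α} {A : Finset α} (hA : A ⊆ T.children y) :
    (T.blowIn y A).moved y = A := by
  ext z
  rw [mem_moved]
  have hy := notMem_of_subset_children hA
  by_cases h : z ∈ A
  · have h' := mem_children.1 (hA h)
    have : z ≠ y := by rintro rfl; exact hy h
    simp [blowIn, h, h', this]
  · by_cases hz : z = y <;> simp [blowIn, h, hz, hy]

theorem moved_blowOut (T : RTree α) {y : α} {A : Finset α} (hA : A ⊆ T.children y) :
    (T.blowOut y A).moved y = A := by
  ext z
  rw [mem_moved]
  have hy := notMem_of_subset_children hA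
  by_cases h : z ∈ A
  · have h' := mem_children.1 (hA h)
    have : z ≠ y := by rintro rfl; exact hy h
    simp [blowOut, h, h', this]
  · by_cases hz : z = y <;> simp [blowOut, h, hz, hy]

theorem moved_subset_children {S : RTree (Option α)} {T : RTree α} {y : α} (h : S.IsSpecial y)
    (hT : S.contract y h = T) : S.moved y ⊆ T.children y := by
  subst hT
  intro z hz
  have hz := mem_moved.1 hz
  exact mem_children.2 ⟨ne_root_of_moved h hz.1 hz.2, by
    rw [parent_contract_of_ne h hz.1, hz.2]; rfl⟩

open Classical in
/-- The signed sum of the values of `f` at the blow-ups of `T`. -/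
def blow {M : Type*} [AddCommGroup M] (f : RTree (Option α) → M) (T : RTree α) : M :=
  ∑ y, ∑ A ∈ (T.children y).powerset,
    ((if 1 ≤ A.card then f (T.blowIn y A) else 0) - if 2 ≤ A.card then f (T.blowOut y A) else 0)

/-- The blow-ups are split by the direction of the edge. In each class `(S, y) ↦ (y, S.moved y)` is
a bijection with inverse `blowIn` or `blowOut`, and the sign is constant. -/
theorem sum_blowUps {k M : Type*} [Ring k] [AddCommGroup M] [Module k M]
    (f : RTree (Option α) → M) (T : RTree α) :
    ∑ p ∈ (Set.toFinite T.blowUps).toFinset, blowUpSign k p • f p.1 = T.blow f := by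
  classical
  rw [← Finset.sum_filter_add_sum_filter_not _ fun p => p.1.parent (some p.2) = none]
  simp only [blow, Finset.sum_sub_distrib]
  rw [sub_eq_add_neg]
  congr 1
  · simp only [← Finset.sum_filter]
    rw [Finset.sum_sigma']
    refine Finset.sum_bij' (fun p _ => ⟨p.2, p.1.moved p.2⟩)
      (fun q _ => (T.blowIn q.1 q.2, q.1)) ?_ ?_ ?_ ?_ ?_
    · rintro ⟨S, y⟩ hp
      obtain ⟨⟨h, hT, hS⟩, hy⟩ : (∃ h : S.IsSpecial y, S.contract y h = T ∧ 2 ≤ S.arity none) ∧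
        S.parent (some y) = none := by simpa [blowUps] using hp
      have hc := moved_subset_children h hT
      rw [eq_blowIn h hT hy, arity_blowIn _ hc] at hS
      simp only [Finset.mem_sigma, Finset.mem_univ, true_and, Finset.mem_filter,
        Finset.mem_powerset]
      exact ⟨hc, by omega⟩
    · rintro ⟨y, A⟩ hq
      obtain ⟨hA, hc⟩ : A ⊆ T.children y ∧ 1 ≤ A.card := by simpa using hq
      simp only [Finset.mem_filter, Set.Finite.mem_toFinset]
      exact ⟨⟨_, contract_blowIn T y A, by rw [arity_blowIn _ hA]; omega⟩,
        by simp [blowIn_parent_self T y A]⟩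
    · rintro ⟨S, y⟩ hp
      obtain ⟨⟨h, hT, hS⟩, hy⟩ : (∃ h : S.IsSpecial y, S.contract y h = T ∧ 2 ≤ S.arity none) ∧
        S.parent (some y) = none := by simpa [blowUps] using hp
      exact Prod.ext (eq_blowIn h hT hy).symm rfl
    · rintro ⟨y, A⟩ hq
      obtain ⟨hA, hc⟩ : A ⊆ T.children y ∧ 1 ≤ A.card := by simpa using hq
      simp only [moved_blowIn T hA]
    · rintro ⟨S, y⟩ hp
      obtain ⟨⟨h, hT, hS⟩, hy⟩ : (∃ h : S.IsSpecial y, S.contract y h = T ∧ 2 ≤ S.arity none) ∧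
        S.parent (some y) = none := by simpa [blowUps] using hp
      simp only [blowUpSign, hy, if_true, one_smul]
      rw [← eq_blowIn h hT hy]
  · simp only [← Finset.sum_filter (s := Finset.powerset _)]
    rw [Finset.sum_sigma', ← Finset.sum_neg_distrib]
    refine Finset.sum_bij' (fun p _ => ⟨p.2, p.1.moved p.2⟩)
      (fun q _ => (T.blowOut q.1 q.2, q.1)) ?_ ?_ ?_ ?_ ?_
    · rintro ⟨S, y⟩ hp
      obtain ⟨⟨h, hT, hS⟩, hy⟩ : (∃ h : S.IsSpecial y, S.contract y h = T ∧ 2 ≤ S.arity none) ∧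
        S.parent (some y) ≠ none := by simpa [blowUps] using hp
      have hc := moved_subset_children h hT
      rw [eq_blowOut h hT hy, arity_blowOut _ hc] at hS
      simp only [Finset.mem_sigma, Finset.mem_univ, true_and, Finset.mem_filter,
        Finset.mem_powerset]
      exact ⟨hc, by omega⟩
    · rintro ⟨y, A⟩ hq
      obtain ⟨hA, hc⟩ : A ⊆ T.children y ∧ 2 ≤ A.card := by simpa using hq
      simp only [Finset.mem_filter, Set.Finite.mem_toFinset]
      exact ⟨⟨_, contract_blowOut T y A, by rw [arity_blowOut _ hA]; omega⟩,
        by simp [blowOut_parent_self T y A]⟩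
    · rintro ⟨S, y⟩ hp
      obtain ⟨⟨h, hT, hS⟩, hy⟩ : (∃ h : S.IsSpecial y, S.contract y h = T ∧ 2 ≤ S.arity none) ∧
        S.parent (some y) ≠ none := by simpa [blowUps] using hp
      exact Prod.ext (eq_blowOut h hT hy).symm rfl
    · rintro ⟨y, A⟩ hq
      obtain ⟨hA, hc⟩ : A ⊆ T.children y ∧ 2 ≤ A.card := by simpa using hq
      simp only [moved_blowOut T hA]
    · rintro ⟨S, y⟩ hp
      obtain ⟨⟨h, hT, hS⟩, hy⟩ : (∃ h : S.IsSpecial y, S.contract y h = T ∧ 2 ≤ S.arity none) ∧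
        S.parent (some y) ≠ none := by simpa [blowUps] using hp
      simp only [blowUpSign, hy, if_false, neg_smul, one_smul]
      rw [← eq_blowOut h hT hy]

end BlowUp

end RTree

/-! ### Blow-ups and insertion -/

namespace RTree

section BlowUpGraft

variable {α β : Type*}

theorem eq_relabel {e : α ≃ β} {T : RTree α} {U : RTree β} (hr : U.root = e T.root)
    (hp : ∀ x, U.parent (e x) = e (T.parent x)) : U = T.relabel e := by
  ext1
  · exact hr
  · funext z
    obtain ⟨z, rfl⟩ := e.surjective z
    simp [hp, relabel]

theorem blowIn_relabel (e : α ≃ β) (T : RTree α) (y : α) (A : Finset α) :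
    (T.relabel e).blowIn (e y) (A.map e.toEmbedding)
      = (T.blowIn y A).relabel e.optionCongr := by
  refine eq_relabel ?_ ?_
  · by_cases h : y = T.root <;> simp [blowIn, relabel, h]
  · rintro (_ | z)
    · by_cases h : y = T.root <;> simp [blowIn, relabel, h]
    · by_cases h : z = y ∨ z ≠ T.root ∧ T.parent z = y ∧ z ∈ A <;> simp [blowIn, relabel, h]

theorem blowOut_relabel (e : α ≃ β) (T : RTree α) (y : α) (A : Finset α) :
    (T.relabel e).blowOut (e y) (A.map e.toEmbedding)
      = (T.blowOut y A).relabel e.optionCongr := by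
  refine eq_relabel ?_ ?_
  · simp [blowOut, relabel]
  · rintro (_ | z)
    · simp [blowOut]
    · by_cases h : z ≠ T.root ∧ T.parent z = y ∧ z ∈ A <;> simp [blowOut, relabel, h]

/-- Insertion of a tree into a tree with a special vertex. -/
def graftLeft (T : RTree (Option α)) (S : RTree β) (x : Option α) : RTree (Option (α ⊕ β)) :=
  (T.graft S x).relabel (optionSumLeft (Equiv.refl _))

/-- Insertion of a tree with a special vertex into a tree. -/
def graftRight (T : RTree α) (S : RTree (Option β)) (x : α) : RTree (Option (α ⊕ β)) :=
  (T.graft S x).relabel (optionSumRight (Equiv.refl _))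

/-- Blowing up at a vertex of `S` commutes with joining the root of `S` to `x`, also at the root of
`S`, where the special vertex becomes the new root to be joined. -/
theorem blowIn_graft_inr (T : RTree α) (S : RTree β) (x : α) (y : β) (A : Finset β) :
    (T.graft S x).blowIn (Sum.inr y) (A.map .inr) = T.graftRight (S.blowIn y A) x := by
  refine eq_relabel ?_ ?_
  · simp [blowIn, graft, optionSumRight]
  · rintro (z | _ | z)
    · simp [blowIn, graft, optionSumRight]
    · by_cases h : y = S.root <;> simp [blowIn, graft, optionSumRight, h]
    · by_cases hz : z = S.root
      · by_cases h : y = S.root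
        · simp [blowIn, graft, optionSumRight, h, hz]
        · simp [blowIn, graft, optionSumRight, h, hz, Ne.symm h]
      · by_cases hy : y = S.root
        · subst hy
          by_cases h : S.parent z = S.root ∧ z ∈ A <;>
            simp [blowIn, graft, optionSumRight, h, hz]
        · by_cases h : z = y ∨ S.parent z = y ∧ z ∈ A <;>
            simp [blowIn, graft, optionSumRight, h, hz, hy]

theorem blowOut_graft_inr (T : RTree α) (S : RTree β) (x : α) (y : β) (A : Finset β) :
    (T.graft S x).blowOut (Sum.inr y) (A.map .inr) = T.graftRight (S.blowOut y A) x := by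
  refine eq_relabel ?_ ?_
  · simp [blowOut, graft, optionSumRight]
  · rintro (z | _ | z)
    · simp [blowOut, graft, optionSumRight]
    · simp [blowOut, graft, optionSumRight]
    · by_cases hz : z = S.root
      · simp [blowOut, graft, optionSumRight, hz]
      · by_cases h : S.parent z = y ∧ z ∈ A <;> simp [blowOut, graft, optionSumRight, h, hz]

theorem blowIn_graft_inl (T : RTree α) (S : RTree β) (x y : α) (A : Finset α) :
    (T.graft S x).blowIn (Sum.inl y) (A.map .inl) = (T.blowIn y A).graftLeft S (some x) := by
  refine eq_relabel ?_ ?_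
  · by_cases h : y = T.root <;> simp [blowIn, graft, optionSumLeft, h]
  · rintro ((_ | z) | z)
    · by_cases h : y = T.root <;> simp [blowIn, graft, optionSumLeft, h]
    · by_cases h : z = y ∨ z ≠ T.root ∧ T.parent z = y ∧ z ∈ A <;>
        simp [blowIn, graft, optionSumLeft, h]
    · by_cases hz : z = S.root <;> simp [blowIn, graft, optionSumLeft, hz]

theorem blowOut_graft_inl (T : RTree α) (S : RTree β) (x y : α) (A : Finset α) :
    (T.graft S x).blowOut (Sum.inl y) (A.map .inl) = (T.blowOut y A).graftLeft S (some x) := by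
  refine eq_relabel ?_ ?_
  · simp [blowOut, graft, optionSumLeft]
  · rintro ((_ | z) | z)
    · simp [blowOut, graft, optionSumLeft]
    · by_cases h : z ≠ T.root ∧ T.parent z = y ∧ z ∈ A <;>
        simp [blowOut, graft, optionSumLeft, h]
    · by_cases hz : z = S.root <;> simp [blowOut, graft, optionSumLeft, hz]

/-- If the root of `S` is among the moved children of `x`, then `S` hangs on the special vertex: it
is inserted at `none`. -/
theorem blowIn_graft_insert [DecidableEq α] [DecidableEq β] (T : RTree α) (S : RTree β) (x : α)
    (A : Finset α) :
    (T.graft S x).blowIn (Sum.inl x) (insert (Sum.inr S.root) (A.map .inl))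
      = (T.blowIn x A).graftLeft S none := by
  refine eq_relabel ?_ ?_
  · by_cases h : x = T.root <;> simp [blowIn, graft, optionSumLeft, h]
  · rintro ((_ | z) | z)
    · by_cases h : x = T.root <;> simp [blowIn, graft, optionSumLeft, h]
    · by_cases h : z = x ∨ z ≠ T.root ∧ T.parent z = x ∧ z ∈ A <;>
        simp [blowIn, graft, optionSumLeft, h]
    · by_cases hz : z = S.root <;> simp [blowIn, graft, optionSumLeft, hz]

theorem blowOut_graft_insert [DecidableEq α] [DecidableEq β] (T : RTree α) (S : RTree β) (x : α)
    (A : Finset α) :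
    (T.graft S x).blowOut (Sum.inl x) (insert (Sum.inr S.root) (A.map .inl))
      = (T.blowOut x A).graftLeft S none := by
  refine eq_relabel ?_ ?_
  · simp [blowOut, graft, optionSumLeft]
  · rintro ((_ | z) | z)
    · simp [blowOut, graft, optionSumLeft]
    · by_cases h : z ≠ T.root ∧ T.parent z = x ∧ z ∈ A <;>
        simp [blowOut, graft, optionSumLeft, h]
    · by_cases hz : z = S.root <;> simp [blowOut, graft, optionSumLeft, hz]

/-- The special vertex inserted between a vertex `z` and its parent. -/
theorem blowOut_singleton (T : RTree α) {y z : α} (hz : z ≠ T.root) (h : T.parent z = y) :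
    T.blowOut y {z} = T.blowIn z ∅ := by
  ext1
  · simp [blowOut, blowIn, hz]
  · funext x
    cases x with
    | none => simp [blowOut, blowIn, hz, h]
    | some w =>
      by_cases hw : w = z
      · subst hw; simp [blowOut, blowIn, hz, h]
      · simp [blowOut, blowIn, hw]

variable [Fintype α] [Fintype β] {M : Type*} [AddCommGroup M]

theorem sum_powerset_map {ι κ : Type*} (e : ι ↪ κ) (s : Finset ι) (g : Finset κ → M) :
    ∑ A ∈ (s.map e).powerset, g A = ∑ A ∈ s.powerset, g (A.map e) := by
  classical
  rw [Finset.map_eq_image, Finset.powerset_image, Finset.sum_image]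
  · simp only [Finset.map_eq_image]
  · intro A _ B _ h
    exact Finset.image_injective e.injective h

/-- The signed sum of the values of `f` at the blow-ups of `T` at `y`. -/
def blowAt (f : RTree (Option α) → M) (T : RTree α) (y : α) : M :=
  ∑ A ∈ (T.children y).powerset,
    ((if 1 ≤ A.card then f (T.blowIn y A) else 0) - if 2 ≤ A.card then f (T.blowOut y A) else 0)

theorem blow_eq (f : RTree (Option α) → M) (T : RTree α) : T.blow f = ∑ y, T.blowAt f y := rfl

theorem blow_relabel (e : α ≃ β) (f : RTree (Option β) → M) (T : RTree α) :
    (T.relabel e).blow f = T.blow fun U => f (U.relabel e.optionCongr) := by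
  rw [blow_eq, blow_eq, ← Equiv.sum_comp e]
  refine Finset.sum_congr rfl fun y _ => ?_
  rw [blowAt, blowAt, children_relabel, sum_powerset_map]
  simp only [blowIn_relabel, blowOut_relabel, Finset.card_map]

theorem blowAt_graft_inr (f : RTree (Option (α ⊕ β)) → M) (T : RTree α) (S : RTree β) (x : α)
    (y : β) : (T.graft S x).blowAt f (Sum.inr y) = S.blowAt (fun U => f (T.graftRight U x)) y := by
  rw [blowAt, blowAt, children_graft_inr, sum_powerset_map]
  simp only [blowIn_graft_inr, blowOut_graft_inr, Finset.card_map]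

theorem blowAt_graft_inl_of_ne (f : RTree (Option (α ⊕ β)) → M) (T : RTree α) (S : RTree β)
    {x y : α} (h : y ≠ x) :
    (T.graft S x).blowAt f (Sum.inl y) = T.blowAt (fun U => f (U.graftLeft S (some x))) y := by
  rw [blowAt, blowAt, children_graft_inl_of_ne _ _ h, sum_powerset_map]
  simp only [blowIn_graft_inl, blowOut_graft_inl, Finset.card_map]

/-- Once the root of `S` is moved as well, the bounds on the other moved children drop by one. The
newly admitted sets are the empty one for the incoming edge and the singletons for the outgoing
edge. -/
theorem sum_eq_empty_add_singletons {ι : Type*} (s : Finset ι) (g h : Finset ι → M) :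
    ∑ A ∈ s.powerset, ((if 1 ≤ A.card + 1 then g A else 0) - if 2 ≤ A.card + 1 then h A else 0)
      = ∑ A ∈ s.powerset, ((if 1 ≤ A.card then g A else 0) - if 2 ≤ A.card then h A else 0)
        + (g ∅ - ∑ z ∈ s, h {z}) := by
  classical
  have h0 : ∑ A ∈ s.powerset, (if A = ∅ then g A else 0) = g ∅ := by
    rw [Finset.sum_ite_eq' s.powerset ∅ g, if_pos (Finset.empty_mem_powerset s)]
  have h1 : ∑ A ∈ s.powerset, (if A.card = 1 then h A else 0) = ∑ z ∈ s, h {z} := by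
    rw [← Finset.sum_filter, ← Finset.powersetCard_eq_filter, Finset.powersetCard_one,
      Finset.sum_map]
    rfl
  rw [← h0, ← h1, ← Finset.sum_sub_distrib, ← Finset.sum_add_distrib]
  refine Finset.sum_congr rfl fun A _ => ?_
  rcases Nat.eq_zero_or_pos A.card with hA | hA
  · rw [Finset.card_eq_zero] at hA
    subst hA
    simp
  · have hA' : A ≠ ∅ := by rintro rfl; simp at hA
    by_cases h1 : A.card = 1
    · simp [h1, hA', sub_eq_add_neg]
    · have : 2 ≤ A.card := by omega
      have : 1 ≤ A.card := by omega
      simp [*]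

/-- The sets of children of `x` in `T ←ₓ S` are divided by whether they contain the root of `S`.
Those that do give insertions at the special vertex plus the surplus terms, where
`blowOut_singleton` rewrites an outgoing edge at `x` as an incoming one at a child `z`. -/
theorem blowAt_graft_inl_self (f : RTree (Option (α ⊕ β)) → M) (T : RTree α) (S : RTree β) (x : α) :
    (T.graft S x).blowAt f (Sum.inl x) = T.blowAt (fun U => f (U.graftLeft S (some x))) x
      + (T.blowAt (fun U => f (U.graftLeft S none)) x + (f ((T.blowIn x ∅).graftLeft S none)
        - ∑ z ∈ T.children x, f ((T.blowIn z ∅).graftLeft S none))) := by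
  classical
  rw [blowAt, children_graft_inl_self, Finset.sum_powerset_insert (by simp), sum_powerset_map,
    sum_powerset_map, blowAt, blowAt]
  simp only [blowIn_graft_inl, blowOut_graft_inl, Finset.card_map, blowIn_graft_insert,
    blowOut_graft_insert]
  congr 1
  have hc : ∀ A : Finset α, (insert (Sum.inr S.root) (A.map .inl) : Finset (α ⊕ β)).card = A.card + 1 := by
    intro A
    rw [Finset.card_insert_of_notMem (by simp), Finset.card_map]
  simp only [hc]
  rw [sum_eq_empty_add_singletons _ (fun A => f ((T.blowIn x A).graftLeft S none))
    (fun A => f ((T.blowOut x A).graftLeft S none))]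
  congr 2
  refine Finset.sum_congr rfl fun z hz => ?_
  obtain ⟨hz, h⟩ := mem_children.1 hz
  rw [blowOut_singleton T hz h]

/-- Every vertex except the root is a child of exactly one vertex, so the double sum runs once over
the vertices other than the root. -/
theorem sum_children (T : RTree α) (g : α → M) :
    ∑ x, g x - ∑ x, ∑ z ∈ T.children x, g z = g T.root := by
  classical
  have : ∑ x, ∑ z ∈ T.children x, g z = ∑ z ∈ Finset.univ.erase T.root, g z := by
    rw [← Finset.sum_fiberwise (Finset.univ.erase T.root) T.parent]
    refine Finset.sum_congr rfl fun x _ => Finset.sum_congr ?_ fun _ _ => rfl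
    ext z
    simp [mem_children]
  rw [this, ← Finset.add_sum_erase _ _ (Finset.mem_univ T.root), add_sub_cancel_right]

/-- The twisted Leibniz rule for blow-ups. The surplus terms at `x` and at its children telescope by
`sum_children`; what remains has the special vertex below the root of `T` and `S` on the special
vertex, and this is `Φ(∘, T, S)` by `dummy_assoc_of`. -/
theorem sum_blow_graft (f : RTree (Option (α ⊕ β)) → M) (T : RTree α) (S : RTree β) :
    ∑ x, (T.graft S x).blow f = ∑ x, T.blow (fun U => f (U.graftLeft S x))
      + ∑ x, S.blow (fun U => f (T.graftRight U x)) + f ((T.blowIn T.root ∅).graftLeft S none) := by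
  classical
  have h : ∀ x, (T.graft S x).blow f = T.blow (fun U => f (U.graftLeft S (some x)))
      + S.blow (fun U => f (T.graftRight U x))
      + (T.blowAt (fun U => f (U.graftLeft S none)) x + (f ((T.blowIn x ∅).graftLeft S none)
        - ∑ z ∈ T.children x, f ((T.blowIn z ∅).graftLeft S none))) := by
    intro x
    have hx := Finset.mem_univ x
    rw [blow_eq, Fintype.sum_sum_type, ← Finset.add_sum_erase _ _ hx, blowAt_graft_inl_self,
      blow_eq, blow_eq, ← Finset.add_sum_erase Finset.univ _ hx,
      Finset.sum_congr rfl fun y hy => blowAt_graft_inl_of_ne f T S (Finset.ne_of_mem_erase hy),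
      Finset.sum_congr rfl fun y _ => blowAt_graft_inr f T S x y]
    abel
  simp only [h, Finset.sum_add_distrib, Finset.sum_sub_distrib]
  rw [sum_children T fun x => f ((T.blowIn x ∅).graftLeft S none), Fintype.sum_option,
    ← blow_eq (fun U => f (U.graftLeft S none))]
  abel

end BlowUpGraft

end RTree

/-! ### The differential and the blow-up map -/

namespace RTree

variable {α β : Type*}

theorem graft_blowIn_root (T : RTree α) (S : RTree β) (x : α) :
    (T.graft S x).blowIn (T.graft S x).root ∅ = (T.blowIn T.root ∅).graftLeft S (some x) :=
  blowIn_graft_inl T S x T.root ∅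

theorem blowIn_root_relabel (e : α ≃ β) (T : RTree α) :
    (T.relabel e).blowIn (T.relabel e).root ∅ = (T.blowIn T.root ∅).relabel e.optionCongr :=
  blowIn_relabel e T T.root ∅

theorem graftLeft_single (T : RTree α) {ι : Type*} [IsEmpty ι] :
    ((single (Option ι)).graftLeft T none).relabel (Equiv.emptySum ι α).optionCongr
      = T.blowIn T.root ∅ := by
  have hr : (single (Option ι)).root = none := Subsingleton.elim _ _
  symm
  rw [graftLeft, relabel_relabel]
  refine eq_relabel ?_ ?_
  · simp [blowIn, graft, hr, optionSumLeft]
  · rintro ((_ | z) | z)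
    · simp [blowIn, graft, single, optionSumLeft]
    · exact isEmptyElim z
    · by_cases hz : z = T.root <;> simp [blowIn, graft, single, optionSumLeft, hz]

variable [Fintype α] {M M' : Type*} [AddCommGroup M] [AddCommGroup M']

theorem map_blow {F : Type*} [FunLike F M M'] [AddMonoidHomClass F M M'] (φ : F)
    (f : RTree (Option α) → M) (T : RTree α) : φ (T.blow f) = T.blow fun U => φ (f U) := by
  simp only [blow, map_sum, map_sub, apply_ite φ, map_zero]

theorem blow_sum {ι : Type*} [Fintype ι] (f : ι → RTree (Option α) → M) (T : RTree α) :
    T.blow (fun U => ∑ i, f i U) = ∑ i, T.blow (f i) := by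
  simp only [blow]
  rw [Finset.sum_comm]
  refine Finset.sum_congr rfl fun y _ => ?_
  rw [Finset.sum_comm]
  refine Finset.sum_congr rfl fun A _ => ?_
  rw [Finset.sum_sub_distrib]
  congr 1 <;> split_ifs <;> simp

end RTree

section Comparison

variable {k V : Type*} [Field k] [AddCommGroup V] [Module k V]

theorem delta_of {α : Type*} [Fintype α] (T : RTree α) (v : α → V) :
    delta k V (Tr.of k T v) = T.blow fun U => TrOne.of k U v := by
  rw [Tr.of_eq_mk k (Fintype.equivFin α), delta_mk]
  refine (RTree.sum_blowUps (k := k) (fun U => TrOne.mk k U _) _).trans ?_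
  rw [RTree.blow_relabel]
  congr 1

theorem TrOne.mk_append_left {m n : ℕ} (T : RTree (Option (Fin m))) (t : Fin m → V)
    (S : RTree (Fin n)) (s : Fin n → V) (x : Option (Fin m)) :
    TrOne.mk k ((T.graft S x).relabel (optionSumLeft finSumFinEquiv)) (Fin.append t s)
      = TrOne.of k (T.graftLeft S x) (Sum.elim t s) := by
  have h1 : optionSumLeft (finSumFinEquiv (m := m) (n := n))
      = (optionSumLeft (Equiv.refl _)).trans finSumFinEquiv.optionCongr := by
    ext1 z; rcases z with (_ | z) | z <;> rfl
  rw [h1, ← RTree.relabel_relabel, TrOne.mk_eq_of, TrOne.of_relabel, RTree.graftLeft]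
  congr 1
  ext z; rcases z with z | z <;> simp

theorem TrOne.mk_append_right {m n : ℕ} (T : RTree (Fin m)) (t : Fin m → V)
    (S : RTree (Option (Fin n))) (s : Fin n → V) (x : Fin m) :
    TrOne.mk k ((T.graft S x).relabel (optionSumRight finSumFinEquiv)) (Fin.append t s)
      = TrOne.of k (T.graftRight S x) (Sum.elim t s) := by
  have h1 : optionSumRight (finSumFinEquiv (m := m) (n := n))
      = (optionSumRight (Equiv.refl _)).trans finSumFinEquiv.optionCongr := by
    ext1 z; rcases z with z | _ | z <;> rfl
  rw [h1, ← RTree.relabel_relabel, TrOne.mk_eq_of, TrOne.of_relabel, RTree.graftRight]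
  congr 1
  ext z; rcases z with z | z <;> simp

variable (k V) in
/-- The dummy variable as an element of `pL¹(V)`. -/
def dummyOne : GradedPreLie.homog k V 1 := ⟨GradedPreLie.dummy k V, GradedPreLie.dummy_mem k V⟩

theorem FreePreLie.d_gen (v : V) : FreePreLie.d k V (FreePreLie.gen k V v) = 0 := by
  refine ReducedPreLie.proj_injective_homog_one k V ?_
  rw [map_zero]
  change ReducedPreLie.proj k V (FreePreLie.d k V (FreePreLie.gen k V v)) = 0
  rw [FreePreLie.proj_d, FreePreLie.toGraded_gen]
  exact (ReducedPreLie.differential_spec k V).gen v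

/-- The rule for the differential of `rpL(V)` in degree `0`, where the sign is `+1`, pulled back
along the projection, which is injective on `pL¹(V)`. -/
theorem FreePreLie.d_mul (a b : FreePreLie k V) :
    FreePreLie.d k V (a * b) = FreePreLie.rmul k V (FreePreLie.d k V a) b
      + FreePreLie.lmul k V a (FreePreLie.d k V b)
      + (FreePreLie.rmul k V (FreePreLie.rmul k V (dummyOne k V) a) b
        - FreePreLie.rmul k V (dummyOne k V) (a * b)) := by
  refine ReducedPreLie.proj_injective_homog_one k V ?_
  change ReducedPreLie.proj k V (FreePreLie.d k V (a * b)) = ReducedPreLie.proj k V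
    ((FreePreLie.d k V a : GradedPreLie k V) * FreePreLie.toGraded k V b
      + FreePreLie.toGraded k V a * (FreePreLie.d k V b : GradedPreLie k V)
      + (GradedPreLie.dummy k V * FreePreLie.toGraded k V a * FreePreLie.toGraded k V b
        - GradedPreLie.dummy k V * FreePreLie.toGraded k V (a * b)))
  simp only [map_add, map_sub, map_mul, FreePreLie.proj_d]
  have h := (ReducedPreLie.differential_spec k V).mul 0
    (ReducedPreLie.proj k V (FreePreLie.toGraded k V a))
    ⟨_, FreePreLie.toGraded_mem_homog k V a, rfl⟩
    (ReducedPreLie.proj k V (FreePreLie.toGraded k V b))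
  rw [pow_zero, one_smul] at h
  exact h

variable {e : FreePreLie k V ≃ₗ[k] Tr k V} {e₁ : GradedPreLie.homog k V 1 ≃ₗ[k] TrOne k V}

theorem IsChapotonLivernet.mul_of (he : IsChapotonLivernet e) {m n : ℕ} (T : RTree (Fin m))
    (t : Fin m → V) (S : RTree (Fin n)) (s : Fin n → V) :
    e (e.symm (Tr.mk k T t) * e.symm (Tr.mk k S s))
      = ∑ x, Tr.of k (T.graft S x) (Sum.elim t s) := by
  rw [he.mul m n T t S s _ _ (e.apply_symm_apply _) (e.apply_symm_apply _)]
  exact Finset.sum_congr rfl fun x _ => Tr.mk_append T t S s x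

theorem IsChapotonLivernetOne.rmul_of (h : IsChapotonLivernetOne e e₁) {m n : ℕ}
    (T : RTree (Option (Fin m))) (t : Fin m → V) (S : RTree (Fin n)) (s : Fin n → V) :
    e₁ (FreePreLie.rmul k V (e₁.symm (TrOne.of k T t)) (e.symm (Tr.mk k S s)))
      = ∑ x, TrOne.of k (T.graftLeft S x) (Sum.elim t s) := by
  rw [← TrOne.mk_eq_of,
    h.mul_right m n T t S s _ _ (e₁.apply_symm_apply _) (e.apply_symm_apply _)]
  exact Finset.sum_congr rfl fun x _ => TrOne.mk_append_left T t S s x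

theorem IsChapotonLivernetOne.lmul_of (h : IsChapotonLivernetOne e e₁) {m n : ℕ}
    (T : RTree (Fin m)) (t : Fin m → V) (S : RTree (Option (Fin n))) (s : Fin n → V) :
    e₁ (FreePreLie.lmul k V (e.symm (Tr.mk k T t)) (e₁.symm (TrOne.of k S s)))
      = ∑ x, TrOne.of k (T.graftRight S x) (Sum.elim t s) := by
  rw [← TrOne.mk_eq_of,
    h.mul_left m n T t S s _ _ (e.apply_symm_apply _) (e₁.apply_symm_apply _)]
  exact Finset.sum_congr rfl fun x _ => TrOne.mk_append_right T t S s x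

/-- The tree of `∘` has a single vertex, so `∘ ⋆ T` has a single term: the special vertex becomes
the root below `T`. -/
theorem IsChapotonLivernetOne.dummy_rmul_of (h : IsChapotonLivernetOne e e₁) {α : Type*} [Fintype α]
    (T : RTree α) (t : α → V) :
    e₁ (FreePreLie.rmul k V (dummyOne k V) (e.symm (Tr.of k T t)))
      = TrOne.of k (T.blowIn T.root ∅) t := by
  rw [Tr.of_eq_mk k (Fintype.equivFin α),
    h.mul_right 0 _ _ _ _ _ (dummyOne k V) _ h.dummy (e.apply_symm_apply _), Fintype.sum_option,
    Finset.univ_eq_empty, Finset.sum_empty, add_zero, TrOne.mk_append_left]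
  have h1 := RTree.graftLeft_single (ι := Fin 0) (T.relabel (Fintype.equivFin α))
  rw [RTree.blowIn_root_relabel] at h1
  have h2 : t = (t ∘ (Fintype.equivFin α).symm) ∘ Fintype.equivFin α := by ext; simp
  rw [h2, ← TrOne.of_relabel, ← h1, TrOne.of_relabel, ← h2]
  congr 1
  ext z
  rcases z with z | z
  · exact isEmptyElim z
  · rfl

/-- In `(∘ ⋆ T) ⋆ S - ∘ ⋆ (T ⋆ S)` the insertions of `S` at the vertices of `T` cancel; the
insertion at the special vertex is left. -/
theorem IsChapotonLivernetOne.dummy_assoc_of (he : IsChapotonLivernet e)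
    (h : IsChapotonLivernetOne e e₁) {m n : ℕ} (T : RTree (Fin m)) (t : Fin m → V)
    (S : RTree (Fin n)) (s : Fin n → V) :
    e₁ (FreePreLie.rmul k V (FreePreLie.rmul k V (dummyOne k V) (e.symm (Tr.mk k T t)))
          (e.symm (Tr.mk k S s))
        - FreePreLie.rmul k V (dummyOne k V) (e.symm (Tr.mk k T t) * e.symm (Tr.mk k S s)))
      = TrOne.of k ((T.blowIn T.root ∅).graftLeft S none) (Sum.elim t s) := by
  have h1 : FreePreLie.rmul k V (dummyOne k V) (e.symm (Tr.mk k T t))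
      = e₁.symm (TrOne.of k (T.blowIn T.root ∅) t) := by
    rw [LinearEquiv.eq_symm_apply, Tr.mk_eq_of, h.dummy_rmul_of]
  have h2 : e₁ (FreePreLie.rmul k V (dummyOne k V) (e.symm (Tr.mk k T t) * e.symm (Tr.mk k S s)))
      = ∑ x, TrOne.of k ((T.blowIn T.root ∅).graftLeft S (some x)) (Sum.elim t s) := by
    rw [← e.symm_apply_apply (_ * _), he.mul_of, map_sum, ← homogOneBimodule_r, map_sum, map_sum]
    refine Finset.sum_congr rfl fun x _ => ?_
    rw [homogOneBimodule_r, h.dummy_rmul_of, RTree.graft_blowIn_root]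
  rw [map_sub, h2, h1, h.rmul_of, Fintype.sum_option, add_sub_cancel_right]

/-- Bilinearity reduces to two trees, where the three summands on the right are those of
`RTree.sum_blow_graft`. -/
theorem IsChapotonLivernetOne.delta_mul (he : IsChapotonLivernet e)
    (h : IsChapotonLivernetOne e e₁) (a b : FreePreLie k V) :
    delta k V (e (a * b)) = e₁ (FreePreLie.rmul k V (e₁.symm (delta k V (e a))) b
      + FreePreLie.lmul k V a (e₁.symm (delta k V (e b)))
      + (FreePreLie.rmul k V (FreePreLie.rmul k V (dummyOne k V) a) b
        - FreePreLie.rmul k V (dummyOne k V) (a * b))) := by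
  obtain ⟨x, rfl⟩ := e.symm.surjective a
  obtain ⟨y, rfl⟩ := e.symm.surjective b
  simp only [← homogOneBimodule_r, ← homogOneBimodule_l]
  induction x using Tr.induction_on with
  | zero => simp
  | add x x' hx hx' =>
    simp only [map_add, map_sub, add_mul, LinearMap.add_apply] at hx hx' ⊢
    rw [hx, hx']; abel
  | smul c x hx =>
    simp only [map_smul, smul_mul_assoc, LinearMap.smul_apply, hx, ← smul_add, ← smul_sub]
  | mk m T t =>
  induction y using Tr.induction_on with
  | zero => simp
  | add x x' hx hx' =>
    simp only [map_add, map_sub, mul_add] at hx hx' ⊢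
    rw [hx, hx']; abel
  | smul c x hx =>
    simp only [map_smul, mul_smul_comm, hx, ← smul_add, ← smul_sub]
  | mk n S s =>
    rw [map_add, map_add]
    simp only [homogOneBimodule_r, homogOneBimodule_l]
    rw [h.dummy_assoc_of he, he.mul_of, map_sum]
    simp only [delta_of]
    rw [RTree.sum_blow_graft]
    congr 2
    · rw [e.apply_symm_apply, Tr.mk_eq_of, delta_of]
      have := RTree.map_blow (e₁.toLinearMap ∘ₗ (homogOneBimodule k V).r.flip
        (e.symm (Tr.mk k S s)) ∘ₗ e₁.symm.toLinearMap) (fun U => TrOne.of k U t) T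
      refine Eq.trans ?_ this.symm
      rw [← RTree.blow_sum]
      congr 1
      funext U
      exact (h.rmul_of U t S s).symm
    · rw [e.apply_symm_apply (Tr.mk k S s), Tr.mk_eq_of k S, delta_of]
      have := RTree.map_blow (e₁.toLinearMap ∘ₗ (homogOneBimodule k V).l
        (e.symm (Tr.mk k T t)) ∘ₗ e₁.symm.toLinearMap) (fun U => TrOne.of k U s) S
      refine Eq.trans ?_ this.symm
      rw [← RTree.blow_sum]
      congr 1
      funext U
      exact (h.lmul_of T t U s).symm

/-- By `d_mul` and `delta_mul`, `d` and the transported `δ` obey the same product rule, so agreement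
on the generators propagates to `pL(V)`. -/
theorem IsChapotonLivernetOne.apply_d (he : IsChapotonLivernet e)
    (h : IsChapotonLivernetOne e e₁) (x : FreePreLie k V) :
    e₁ (FreePreLie.d k V x) = delta k V (e x) := by
  induction x using FreePreLie.induction_on with
  | gen v =>
    -- Without children only `A = ∅` remains, which is excluded for both directions of the edge;
    -- hence `δ` vanishes on one-vertex trees.
    have hc : ∀ x, (RTree.single (Fin 1)).children x = ∅ := fun x => by
      ext z
      simp [RTree.mem_children, RTree.single, Subsingleton.elim z 0]
    rw [FreePreLie.d_gen, map_zero, he.gen, Tr.mk_eq_of, delta_of, RTree.blow]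
    simp [hc]
  | add x y hx hy => rw [map_add, map_add, hx, hy, map_add, map_add]
  | smul c x hx => rw [map_smul, map_smul, hx, map_smul, map_smul]
  | mul x y hx hy =>
    rw [h.delta_mul he, ← hx, ← hy, e₁.symm_apply_apply, e₁.symm_apply_apply, FreePreLie.d_mul]

end Comparison

end PreLieTrees

end

theorem mainTheorem3 (k : Type*) (V : Type*) [Field k] [CharZero k] [AddCommGroup V] [Module k V] :
    (∃! e : PreLieTrees.FreePreLie k V ≃ₗ[k] PreLieTrees.Tr k V,
      PreLieTrees.IsChapotonLivernet e) ∧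
    ∀ e : PreLieTrees.FreePreLie k V ≃ₗ[k] PreLieTrees.Tr k V,
      PreLieTrees.IsChapotonLivernet e →
      (∃! e₁ : PreLieTrees.GradedPreLie.homog k V 1 ≃ₗ[k] PreLieTrees.TrOne k V,
        PreLieTrees.IsChapotonLivernetOne e e₁) ∧
      ∀ e₁ : PreLieTrees.GradedPreLie.homog k V 1 ≃ₗ[k] PreLieTrees.TrOne k V,
        PreLieTrees.IsChapotonLivernetOne e e₁ →
        ∀ x : PreLieTrees.FreePreLie k V,
          e₁ (PreLieTrees.FreePreLie.d k V x) = PreLieTrees.delta k V (e x) := by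
  refine ⟨⟨PreLieTrees.chapotonLivernet k V, PreLieTrees.isChapotonLivernet_chapotonLivernet,
    fun e he => he.eq⟩, fun e he => ⟨⟨PreLieTrees.chapotonLivernetOne k V,
    he.isChapotonLivernetOne, fun e₁ h => PreLieTrees.IsChapotonLivernetOne.eq he h⟩,
    fun e₁ h x => h.apply_d he x⟩⟩
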